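/- Let $k>0$ and $\Lambda>0$, let $\theta\in(0,\pi)$, $\alpha=k\cos\theta$, $\beta=\sqrt{k^2-\alpha^2}$, and for $m\in\mathbb Z$ put $\alpha_m=\alpha+\frac{2\pi}{\Lambda}m$, $\beta_m=\sqrt{k^2-\alpha_m^2}$ if $|\alpha_m|\le k$ and $\beta_m=i\sqrt{\alpha_m^2-k^2}$ if $|\alpha_m|>k$. Assume that $\alpha$ is not a Wood's anomaly, i.e. $|\alpha_m|\ne k$ for all $m\in\mathbb Z$. Let $\Omega=(-\frac\Lambda2,\frac\Lambda2)\times\mathbb R$ be the unit cell and let $\gamma:\mathbb R^2\to\mathbb C$ satisfy $\gamma(x_1+\Lambda,x_2)=\gamma(x_1,x_2)$ and $\gamma-1\in L^\infty(\Omega)$. Assume that the support $D=\overline{\{x\in\Omega:\gamma(x)\neq1\}}$ is compact and contained in $\Omega$. Let $u^{inc}_\alpha(x)=e^{i\alpha x_1-i\beta x_2}$ and let $u_\alpha=u^s_\alpha+u^{inc}_\alpha$ be a locally integrable solution, in the sense of distributions, of the Helmholtz equation $\Delta u_\alpha+k^2\gamma u_\alpha=0$ in $\mathbb R^2$ (every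 weak solution in $H^1_{loc}$ is one), where $u^s_\alpha$ is represented so that it is continuous on $\Omega\setminus D$, is $\alpha$-quasi-periodic, $u^s_\alpha(x_1+\Lambda,x_2)e^{-i\Lambda\alpha}=u^s_\alpha(x_1,x_2)$, and satisfies the Rayleigh expansion condition: for some $H>0$ and some complex coefficients $u_m^{\pm}$, $$u^s_\alpha(x)=\sum_{m\in\mathbb Z}u_m^{+}e^{i\alpha_mx_1+i\beta_mx_2}\quad(x\in\Omega,\ x_2\ge H),\qquad u^s_\alpha(x)=\sum_{m\in\mathbb Z}u_m^{-}e^{i\alpha_mx_1-i\beta_mx_2}\quad(x\in\Omega,\ x_2\le -H),$$ both series being absolutely convergent at every such $x$. Let $G^{qp}_\alpha$ be the quasi-periodic Green's function $$G^{qp}_\alpha(x,y)=\frac i4\sum_{n\in\mathbb Z}H^{(1)}_0(k|x-y_n|)\,e^{in\Lambda\alpha},\qquad y_n=(y_1+n\Lambda,y_2),$$ where $H_0^{(1)}$ is the Hankel function of the first kind of order zero and the sum is the limit of $\sum_{n=-M}^{N}$ as $M,N\to\infty$ independently. Then for every $x\in\Omega\setminus D$ this series converges for every $y\in D$, the integrand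 below is integrable over $D$, and $u^s_\alpha$ satisfies the quasi-periodic Lippmann–Schwinger equation $$u^s_\alpha(x)=\int_D k^2(\gamma(y)-1)\,G^{qp}_\alpha(x,y)\,u_\alpha(y)\,dy .$$ -/

import Mathlib

open MeasureTheory Set
open scoped ContDiff Laplacian

noncomputable section

namespace QPScattering

/-- The plane `ℝ²` with the Euclidean norm; `x 0`, `x 1` are the two Cartesian coordinates. -/
abbrev Plane : Type := EuclideanSpace ℝ (Fin 2)

/-! ### The Hankel function of order zero -/

/-- The Bessel function `J₀(t) = ∑ₘ (-1)ᵐ (t/2)²ᵐ / (m!)²`. -/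
def besselJ0 (t : ℝ) : ℝ :=
  ∑' m : ℕ, (-1 : ℝ) ^ m * (t / 2) ^ (2 * m) / (m.factorial : ℝ) ^ 2

/-- The Bessel function of the second kind, for `t > 0`:
`Y₀(t) = (2/π) (log (t/2) + C) J₀(t) - (2/π) ∑ₘ (-1)ᵐ hₘ (t/2)²ᵐ / (m!)²`,
where `C` is the Euler-Mascheroni constant and `hₘ = 1 + 1/2 + ⋯ + 1/m` (so `h₀ = 0`). -/
def besselY0 (t : ℝ) : ℝ :=
  2 / Real.pi * (Real.log (t / 2) + Real.eulerMascheroniConstant) * besselJ0 t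
    - 2 / Real.pi * ∑' m : ℕ,
        (-1 : ℝ) ^ m * (harmonic m : ℝ) * (t / 2) ^ (2 * m) / (m.factorial : ℝ) ^ 2

/-- The Hankel function of the first kind `H₀⁽¹⁾(t) = J₀(t) + i Y₀(t)`, for `t > 0`. -/
def hankelH0 (t : ℝ) : ℂ := (besselJ0 t : ℂ) + Complex.I * (besselY0 t : ℂ)

/-! ### Periodic geometry -/

/-- Translation by `s` in the first coordinate. -/
def shift (s : ℝ) (x : Plane) : Plane := !₂[x 0 + s, x 1]

/-- The unit cell `Ω = (-Λ/2, Λ/2) × ℝ`. -/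
def unitCell (Λ : ℝ) : Set Plane := {x | x 0 ∈ Ioo (-Λ / 2) (Λ / 2)}

/-- The scatterer `D`: the support, inside the unit cell, of `γ - 1`. -/
def scatterer (Λ : ℝ) (γ : Plane → ℂ) : Set Plane :=
  closure {x | x ∈ unitCell Λ ∧ γ x - 1 ≠ 0}

/-- `u (x₁ + Λ, x₂) e^{-iΛα} = u (x₁, x₂)`. -/
def IsQuasiPeriodic (Λ α : ℝ) (u : Plane → ℂ) : Prop :=
  ∀ x, u (shift Λ x) * Complex.exp (-Complex.I * (Λ * α : ℝ)) = u x

/-! ### Rayleigh modes -/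

/-- `αₘ = α + 2πm/Λ`. -/
def alphaMode (Λ α : ℝ) (m : ℤ) : ℝ := α + 2 * Real.pi / Λ * m

/-- `βₘ = √(k² - αₘ²)` if `|αₘ| ≤ k`, and `βₘ = i √(αₘ² - k²)` if `|αₘ| > k`. -/
def betaMode (k Λ α : ℝ) (m : ℤ) : ℂ :=
  if |alphaMode Λ α m| ≤ k then (Real.sqrt (k ^ 2 - alphaMode Λ α m ^ 2) : ℂ)
  else Complex.I * (Real.sqrt (alphaMode Λ α m ^ 2 - k ^ 2) : ℂ)

/-- The Rayleigh expansion condition: for some `H > 0` the field is a convergent superposition of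
upward modes on `{x ∈ Ω | x₂ ≥ H}` and of downward modes on `{x ∈ Ω | x₂ ≤ -H}`. -/
def SatisfiesRayleigh (k Λ α : ℝ) (u : Plane → ℂ) : Prop :=
  ∃ H : ℝ, 0 < H ∧ ∃ cUp cDown : ℤ → ℂ,
    (∀ x ∈ unitCell Λ, H ≤ x 1 →
      HasSum (fun m : ℤ => cUp m * Complex.exp
        (Complex.I * (alphaMode Λ α m : ℂ) * (x 0 : ℂ)
          + Complex.I * betaMode k Λ α m * (x 1 : ℂ))) (u x)) ∧
    (∀ x ∈ unitCell Λ, x 1 ≤ -H →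
      HasSum (fun m : ℤ => cDown m * Complex.exp
        (Complex.I * (alphaMode Λ α m : ℂ) * (x 0 : ℂ)
          - Complex.I * betaMode k Λ α m * (x 1 : ℂ))) (u x))

/-! ### Fields -/

/-- The incident plane wave `e^{iαx₁ - iβx₂}`. -/
def incidentWave (α β : ℝ) (x : Plane) : ℂ :=
  Complex.exp (Complex.I * ((α * x 0 : ℝ) : ℂ) - Complex.I * ((β * x 1 : ℝ) : ℂ))

/-- `u` is a locally integrable solution of `Δu + k²γu = 0` in `ℝ²` in the sense of
distributions. Classical solutions and weak solutions in `H¹_loc` are solutions in this sense. -/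
def SolvesHelmholtz (k : ℝ) (γ u : Plane → ℂ) : Prop :=
  LocallyIntegrable u ∧
    ∀ φ : Plane → ℂ, ContDiff ℝ ∞ φ → HasCompactSupport φ →
      ∫ x, u x * (Δ φ x + (k : ℂ) ^ 2 * γ x * φ x) = 0

/-! ### The quasi-periodic Green's function -/

/-- The `n`-th term `(i/4) H₀⁽¹⁾(k |x - yₙ|) e^{inΛα}`, with `yₙ = (y₁ + nΛ, y₂)`. -/
def greenTerm (k Λ α : ℝ) (x y : Plane) (n : ℤ) : ℂ :=
  Complex.I / 4 * (hankelH0 (k * ‖x - shift (n * Λ) y‖)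
    * Complex.exp (Complex.I * (n * Λ * α : ℝ)))

/-- The quasi-periodic Green's function. The series converges only conditionally: its value is the
limit of the sums over `{-M, …, N}` as `M, N → ∞` independently. -/
def qpGreen (k Λ α : ℝ) (x y : Plane) : ℂ :=
  ∑'[SummationFilter.conditional ℤ] n : ℤ, greenTerm k Λ α x y n

end QPScattering

end

noncomputable section
namespace QPScattering
open Filter Topology

/-! ### Power series with infinite radius of convergence -/

/-! A quasi-periodic field on the unit cell is determined by its Fourier coefficients against
`e^{-iα_m x₁}`, and in each mode the scattering problem is one-dimensional. Put `ζ_m = decay k α_m`,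
so that `ζ_m² = α_m² - k²` and `ζ_m = -iβ_m`. Testing the Helmholtz equation with a mode times a
function of `x₂` shows that the `m`-th coefficient `A` of the total field satisfies `A'' - ζ_m² A =
-F_m` weakly, where `F_m` is the `m`-th coefficient of the source `k²(γ-1)u`
(`integral_mode_helmholtz`). The incident wave contributes nothing, since it solves the homogeneous
equation. The Rayleigh condition says that the scattered coefficient is a multiple of `e^{-ζ_m s}`
far above and of `e^{ζ_m s}` far below. The outgoing fundamental solution of this ordinary
differential operator is `profile`, that is `e^{-ζ|s|}/(2ζ)`, and hence the scattered coefficient is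
its convolution with `F_m` (`ae_integral_scattered_mul_modeExp`).

The `m`-th coefficient of the lattice sum `G` is the same `profile`
(`integral_latticeGreen_mul_exp`). Consequently the volume potential of the source and the scattered
field have equal modes, so they agree almost everywhere in the cell (`ae_eq_latticePotential`). Both
are continuous off `D`, which gives equality at every point there.

The analytic work lies in `G`, a conditionally convergent series of Hankel functions that are
defined by power series. `hankelH0_eq_integral` identifies `H₀⁽¹⁾` with the Poisson and
Mehler-Sonine integrals: both sides solve Bessel's equation and their difference tends to `0` at the
origin, which forces it to vanish (`bessel_unique`). Rotating the contour by the polar angle of the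
argument and substituting `ξ = k sin t` and `ξ = ±k cosh t` turns this into a plane-wave expansion
with density `profile a (decay k ξ)`.

That density decays too slowly at distance `a = 0` to be integrable. It is therefore compared with
the screened potential `K₀`, the analogue for `Δ - k²`: the difference `profileDiff` is `O(|ξ|⁻³)`
uniformly in `a`, with integrable inverse square root singularities at `±k`. The lattice sum of `K₀`
converges absolutely, by exponential decay, and its logarithmic singularity sits in the single term
`n = 0`. The lattice sum of the difference is evaluated by Poisson summation. Away from Wood's
anomalies the points `α_m` keep a positive distance from `±k`, so the density is Lipschitz near each
of them, and this Dini-type regularity is enough for convergence of the sums over `{-M, …, N}` with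
independent limits (`hasSum_conditional_integral_intChar`). The two parts together give
`hasSum_greenTerm`. -/

lemma summable_abs_deriv_coeff {c : ℕ → ℝ} (hc : ∀ R : ℝ, 0 ≤ R → Summable fun n => |c n| * R ^ n)
    (R : ℝ) (hR : 0 ≤ R) : Summable fun n : ℕ => |((n : ℝ) + 1) * c (n + 1)| * R ^ n := by
  -- Doubling the radius pays for the factor `n + 1 ≤ 2 ^ (n + 1)`; replacing `R` by `R + 1 ≥ 1`
  -- lets the exponent grow from `n` to `n + 1`.
  have h := (summable_nat_add_iff 1).2 (hc (2 * (R + 1)) (by positivity))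
  refine Summable.of_nonneg_of_le (fun n => by positivity) (fun n => ?_) h
  have h2 : ((n : ℝ) + 1) ≤ 2 ^ (n + 1) := by
    exact_mod_cast (Nat.lt_two_pow_self (n := n + 1)).le
  rw [abs_mul, abs_of_nonneg (by positivity : (0 : ℝ) ≤ (n : ℝ) + 1), mul_pow]
  have h3 : R ^ n ≤ (R + 1) ^ (n + 1) := by
    calc R ^ n ≤ (R + 1) ^ n := pow_le_pow_left₀ hR (by linarith) n
      _ ≤ (R + 1) ^ (n + 1) := pow_le_pow_right₀ (by linarith) (by omega)
  calc ((n : ℝ) + 1) * |c (n + 1)| * R ^ n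
      ≤ 2 ^ (n + 1) * |c (n + 1)| * (R + 1) ^ (n + 1) := by gcongr
    _ = _ := by ring

lemma hasDerivAt_powerSeries {c : ℕ → ℝ}
    (hc : ∀ R : ℝ, 0 ≤ R → Summable fun n => |c n| * R ^ n) (q : ℝ) :
    HasDerivAt (fun q => ∑' n, c n * q ^ n) (∑' n : ℕ, (((n : ℝ) + 1) * c (n + 1)) * q ^ n) q := by
  set R := |q| + 1 with hRdef
  have hR : 0 ≤ R := by positivity
  have hs : Summable fun n : ℕ => |(n : ℝ) * c n| * R ^ (n - 1) := by
    rw [← summable_nat_add_iff 1]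
    simpa using summable_abs_deriv_coeff hc R hR
  have h := hasDerivAt_tsum_of_isPreconnected (g := fun n (y : ℝ) => c n * y ^ n)
    (g' := fun n y => c n * (n * y ^ (n - 1))) (t := Metric.ball 0 R) (y₀ := 0) (y := q)
    hs Metric.isOpen_ball (convex_ball 0 R).isPreconnected
    (fun n y _ => (hasDerivAt_pow n y).const_mul (c n))
    (fun n y hy => by
      have hy' : |y| ≤ R := by simpa using (mem_ball_zero_iff.1 hy).le
      rw [Real.norm_eq_abs, abs_mul, abs_mul, abs_pow, abs_mul, ← mul_assoc, mul_comm |c n|]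
      gcongr)
    (by simp; positivity)
    (by
      refine summable_of_ne_finset_zero (s := {0}) (fun n hn => ?_)
      have : n ≠ 0 := by simpa using hn
      simp [this])
    (by simp [hRdef])
  refine h.congr_deriv ?_
  have hs' : Summable fun n : ℕ => c n * (n * q ^ (n - 1)) := by
    refine Summable.of_norm_bounded hs (fun n => ?_)
    rw [Real.norm_eq_abs, abs_mul, abs_mul, abs_pow, abs_mul, ← mul_assoc, mul_comm |c n|]
    gcongr
    simp [hRdef]
  rw [hs'.tsum_eq_zero_add]
  simp only [Nat.cast_zero, zero_mul, mul_zero, zero_add, Nat.cast_add, Nat.cast_one,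
    Nat.add_sub_cancel]
  exact tsum_congr fun n => by ring

lemma summable_powerSeries {c : ℕ → ℝ}
    (hc : ∀ R : ℝ, 0 ≤ R → Summable fun n => |c n| * R ^ n) (q : ℝ) :
    Summable fun n => c n * q ^ n := by
  refine Summable.of_norm_bounded (hc |q| (abs_nonneg q)) (fun n => ?_)
  simp

/-! ### The Bessel equation of order zero, in terms of `q = t² / 4` -/

def besselCoeff (n : ℕ) : ℝ := (-1) ^ n / (n.factorial : ℝ) ^ 2

def besselHarmonicCoeff (n : ℕ) : ℝ := besselCoeff n * (harmonic n : ℝ)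

/-- Coefficient form of `(q f')' = -f`, which is Bessel's equation of order zero in the variable `q
= t² / 4`. -/
lemma besselCoeff_succ (n : ℕ) : ((n : ℝ) + 1) ^ 2 * besselCoeff (n + 1) = -besselCoeff n := by
  unfold besselCoeff
  rw [Nat.factorial_succ]
  have : (n.factorial : ℝ) ≠ 0 := by positivity
  push_cast
  field_simp
  ring

lemma harmonic_le_self (n : ℕ) : (harmonic n : ℝ) ≤ n := by
  induction n with
  | zero => simp
  | succ n ih =>
    rw [harmonic_succ]
    push_cast
    have : ((n : ℝ) + 1)⁻¹ ≤ 1 := inv_le_one_of_one_le₀ (by linarith [n.cast_nonneg (α := ℝ)])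
    linarith

lemma harmonic_nonneg (n : ℕ) : (0 : ℝ) ≤ (harmonic n : ℝ) := by
  unfold harmonic
  push_cast
  positivity

lemma abs_besselCoeff_le (n : ℕ) : |besselCoeff n| ≤ 1 / n.factorial := by
  unfold besselCoeff
  have h1 : (1 : ℝ) ≤ n.factorial := by exact_mod_cast n.factorial_pos
  rw [abs_div, abs_pow, abs_neg, abs_one, one_pow, abs_of_nonneg (by positivity)]
  refine one_div_le_one_div_of_le (by positivity) ?_
  nlinarith

lemma abs_besselHarmonicCoeff_le (n : ℕ) : |besselHarmonicCoeff n| ≤ 1 / n.factorial := by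
  unfold besselHarmonicCoeff besselCoeff
  have h1 : (1 : ℝ) ≤ n.factorial := by exact_mod_cast n.factorial_pos
  have h2 : (n : ℝ) ≤ n.factorial := by exact_mod_cast n.self_le_factorial
  rw [abs_mul, abs_div, abs_pow, abs_neg, abs_one, one_pow, abs_of_nonneg (by positivity),
    abs_of_nonneg (harmonic_nonneg n)]
  have := (harmonic_le_self n).trans h2
  calc 1 / (n.factorial : ℝ) ^ 2 * (harmonic n : ℝ) ≤ 1 / (n.factorial : ℝ) ^ 2 * n.factorial := by
        gcongr
    _ = _ := by field_simp

lemma summable_of_le_inv_factorial {c : ℕ → ℝ} (hc : ∀ n, |c n| ≤ 1 / n.factorial) (R : ℝ)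
    (hR : 0 ≤ R) : Summable fun n => |c n| * R ^ n := by
  refine Summable.of_nonneg_of_le (fun n => by positivity) (fun n => ?_)
    (Real.summable_pow_div_factorial R)
  calc |c n| * R ^ n ≤ 1 / n.factorial * R ^ n := by gcongr; exact hc n
    _ = _ := by ring

def besselSeries (q : ℝ) : ℝ := ∑' n, besselCoeff n * q ^ n

def besselSeriesDeriv (q : ℝ) : ℝ := ∑' n : ℕ, (((n : ℝ) + 1) * besselCoeff (n + 1)) * q ^ n

def besselHarmonicSeries (q : ℝ) : ℝ := ∑' n, besselHarmonicCoeff n * q ^ n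

def besselHarmonicSeriesDeriv (q : ℝ) : ℝ :=
  ∑' n : ℕ, (((n : ℝ) + 1) * besselHarmonicCoeff (n + 1)) * q ^ n

lemma hasDerivAt_besselSeries (q : ℝ) : HasDerivAt besselSeries (besselSeriesDeriv q) q :=
  hasDerivAt_powerSeries (summable_of_le_inv_factorial abs_besselCoeff_le) q

lemma hasDerivAt_besselHarmonicSeries (q : ℝ) :
    HasDerivAt besselHarmonicSeries (besselHarmonicSeriesDeriv q) q :=
  hasDerivAt_powerSeries (summable_of_le_inv_factorial abs_besselHarmonicCoeff_le) q

/-- The operator `f ↦ (q f')'` multiplies the coefficient of `q ^ (n + 1)` by `(n + 1)²` and lowers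
the degree by one, so a two-term recurrence becomes a differential equation. -/
lemma mul_powerSeries_deriv {c e : ℕ → ℝ}
    (hc : ∀ R : ℝ, 0 ≤ R → Summable fun n => |c n| * R ^ n)
    (he : ∀ n : ℕ, ((n : ℝ) + 1) ^ 2 * c (n + 1) = e n) (q : ℝ) :
    HasDerivAt (fun q => q * ∑' n : ℕ, (((n : ℝ) + 1) * c (n + 1)) * q ^ n)
      (∑' n, e n * q ^ n) q := by
  have hc1 := summable_abs_deriv_coeff hc
  have hc2 := summable_abs_deriv_coeff hc1
  have h := (hasDerivAt_id q).mul (hasDerivAt_powerSeries hc1 q)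
  refine h.congr_deriv ?_
  simp only [id, one_mul]
  have hs2 := summable_powerSeries hc2 q
  rw [(summable_powerSeries hc1 q).tsum_eq_zero_add, ← tsum_mul_left, add_assoc,
    ← ((summable_nat_add_iff 1).2 (summable_powerSeries hc1 q)).tsum_add (hs2.mul_left q)]
  have hs3 : Summable fun n => e n * q ^ n := by
    rw [← summable_nat_add_iff 1]
    refine (((summable_nat_add_iff 1).2 (summable_powerSeries hc1 q)).add
      (hs2.mul_left q)).congr fun n => ?_
    rw [← he]
    push_cast
    ring
  rw [hs3.tsum_eq_zero_add]
  congr 1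
  · rw [← he]; simp
  · refine tsum_congr fun n => ?_
    rw [← he]
    push_cast
    ring

lemma hasDerivAt_mul_besselSeriesDeriv (q : ℝ) :
    HasDerivAt (fun q => q * besselSeriesDeriv q) (-besselSeries q) q := by
  have h := mul_powerSeries_deriv (summable_of_le_inv_factorial abs_besselCoeff_le)
    (fun n => besselCoeff_succ n) q
  refine h.congr_deriv ?_
  rw [besselSeries, ← tsum_neg]
  exact tsum_congr fun n => by ring

/-- The recurrence for the harmonic coefficients is that of `besselCoeff` up to the jump `h_{n+1} -
h_n = 1 / (n + 1)`, and this jump produces the extra source `besselSeriesDeriv`. It is what the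
derivative of the logarithm in `Y₀` cancels. -/
lemma hasDerivAt_mul_besselHarmonicSeriesDeriv (q : ℝ) :
    HasDerivAt (fun q => q * besselHarmonicSeriesDeriv q)
      (besselSeriesDeriv q - besselHarmonicSeries q) q := by
  have hb := summable_of_le_inv_factorial abs_besselCoeff_le
  have hh := summable_of_le_inv_factorial abs_besselHarmonicCoeff_le
  have h := mul_powerSeries_deriv hh
    (e := fun n => ((n : ℝ) + 1) * besselCoeff (n + 1) - besselHarmonicCoeff n) (fun n => by
      have h1 := besselCoeff_succ n
      unfold besselHarmonicCoeff
      rw [harmonic_succ]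
      push_cast
      have h2 : ((n : ℝ) + 1) ≠ 0 := by positivity
      linear_combination (↑(harmonic n) : ℝ) * h1 + ((n : ℝ) + 1) * besselCoeff (n + 1) *
        (mul_inv_cancel₀ h2)) q
  refine h.congr_deriv ?_
  rw [besselSeriesDeriv, besselHarmonicSeries,
    ← (summable_powerSeries (summable_abs_deriv_coeff hb) q).tsum_sub (summable_powerSeries hh q)]
  exact tsum_congr fun n => by ring

lemma besselJ0_eq (t : ℝ) : besselJ0 t = besselSeries (t ^ 2 / 4) := by
  unfold besselJ0 besselSeries besselCoeff
  refine tsum_congr fun n => ?_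
  rw [pow_mul, div_pow]
  norm_num
  ring

lemma besselY0_eq (t : ℝ) : besselY0 t =
    2 / Real.pi * (Real.log (t / 2) + Real.eulerMascheroniConstant) * besselSeries (t ^ 2 / 4)
      - 2 / Real.pi * besselHarmonicSeries (t ^ 2 / 4) := by
  unfold besselY0 besselHarmonicSeries besselHarmonicCoeff besselCoeff
  rw [besselJ0_eq]
  congr 2
  refine tsum_congr fun n => ?_
  rw [pow_mul, div_pow]
  norm_num
  ring

/-- A solution of the Bessel equation that tends to zero at the origin vanishes. -/
lemma bessel_unique {w p : ℝ → ℝ} (hw : ∀ x > 0, HasDerivAt w (p x / x) x)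
    (hp : ∀ x > 0, HasDerivAt p (-(x * w x)) x) (h0 : Tendsto w (𝓝[>] 0) (𝓝 0)) :
    ∀ x > 0, w x = 0 := by
  have hwc : ContinuousOn w (Ioi 0) := fun x hx => (hw x hx).continuousAt.continuousWithinAt
  have hpc : ContinuousOn p (Ioi 0) := fun x hx => (hp x hx).continuousAt.continuousWithinAt
  -- A one-sided estimate, used for both `(w, p)` and `(-w, -p)`. If `p x > M x`, then `p` is
  -- bounded below by a positive `c` on `(0, x]`, because `|p'| ≤ M` there; then `w' ≥ c / s`, and
  -- the logarithmic growth contradicts `|w| ≤ M`.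
  have key : ∀ (w p : ℝ → ℝ), (∀ x > 0, HasDerivAt w (p x / x) x) →
      (∀ x > 0, HasDerivAt p (-(x * w x)) x) → ∀ M : ℝ, 0 ≤ M →
      (∀ x ∈ Ioc (0 : ℝ) (1 / 2), |w x| ≤ M) → ∀ x ∈ Ioc (0 : ℝ) (1 / 2), p x ≤ M * x := by
    intro w p hw hp M hM hb x hx
    by_contra! hlt
    set c := p x - M * x with hc
    have hc0 : 0 < c := by linarith
    have hpy : ∀ y ∈ Ioc 0 x, c ≤ p y := by
      intro y hy
      have := (convex_Icc y x).norm_image_sub_le_of_norm_hasDerivWithin_le (f := p)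
        (f' := fun s => -(s * w s)) (C := M) (x := y) (y := x)
        (fun s hs => (hp s (hy.1.trans_le hs.1)).hasDerivWithinAt)
        (fun s hs => by
          have hs0 := hy.1.trans_le hs.1
          have hs1 := hs.2.trans hx.2
          rw [norm_neg, norm_mul, Real.norm_eq_abs, Real.norm_eq_abs, abs_of_pos hs0]
          have := hb s ⟨hs0, hs1⟩
          nlinarith [abs_nonneg (w s)]) (left_mem_Icc.2 hy.2) (right_mem_Icc.2 hy.2)
      rw [Real.norm_eq_abs, Real.norm_eq_abs, abs_of_nonneg (by linarith [hy.2] : 0 ≤ x - y)] at this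
      have h2 := (abs_le.1 this).2
      have : M * (x - y) ≤ M * x := by nlinarith [hy.1]
      linarith
    -- Chosen so that `c * log (x / y) = 2 * M + 1`, more than the largest oscillation `2 * M` of
    -- `w`.
    set y := x * Real.exp (-((2 * M + 1) / c)) with hy
    have hy0 : 0 < y := mul_pos hx.1 (Real.exp_pos _)
    have hyx : y ≤ x := by
      have : Real.exp (-((2 * M + 1) / c)) ≤ 1 := Real.exp_le_one_iff.2 (by
        have : 0 ≤ (2 * M + 1) / c := by positivity
        linarith)
      nlinarith [hx.1]
    have hmono : MonotoneOn (fun s => w s - c * Real.log s) (Icc y x) := by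
      refine monotoneOn_of_hasDerivWithinAt_nonneg (convex_Icc y x)
        (f' := fun s => p s / s - c * s⁻¹) ?_ ?_ ?_
      · intro s hs
        have hs0 : 0 < s := hy0.trans_le hs.1
        exact (((hw s hs0).sub ((Real.hasDerivAt_log hs0.ne').const_mul c)).continuousAt).continuousWithinAt
      · intro s hs
        rw [interior_Icc] at hs
        have hs0 : 0 < s := hy0.trans hs.1
        exact ((hw s hs0).sub ((Real.hasDerivAt_log hs0.ne').const_mul c)).hasDerivWithinAt
      · intro s hs
        rw [interior_Icc] at hs
        have hs0 : 0 < s := hy0.trans hs.1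
        have := hpy s ⟨hs0, hs.2.le⟩
        rw [div_eq_mul_inv, ← sub_mul]
        exact mul_nonneg (by linarith) (by positivity)
    have h1 := hmono (left_mem_Icc.2 hyx) (right_mem_Icc.2 hyx) hyx
    have hlog : Real.log y = Real.log x - (2 * M + 1) / c := by
      rw [hy, Real.log_mul hx.1.ne' (Real.exp_pos _).ne', Real.log_exp]; ring
    have h2 : c * ((2 * M + 1) / c) = 2 * M + 1 := by field_simp
    have h3 := abs_le.1 (hb y ⟨hy0, hyx.trans hx.2⟩)
    have h4 := abs_le.1 (hb x hx)
    simp only [hlog] at h1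
    nlinarith
  have habs : ∀ M : ℝ, 0 ≤ M → (∀ x ∈ Ioc (0 : ℝ) (1 / 2), |w x| ≤ M) →
      ∀ x ∈ Ioc (0 : ℝ) (1 / 2), |p x| ≤ M * x := by
    intro M hM hb x hx
    rw [abs_le']
    refine ⟨key w p hw hp M hM hb x hx, ?_⟩
    refine key (fun s => -w s) (fun s => -p s) (fun s hs => ?_) (fun s hs => ?_) M hM
      (by simpa using hb) x hx
    · exact (hw s hs).neg.congr_deriv (by ring)
    · exact (hp s hs).neg.congr_deriv (by ring)
  -- Since `|w'| = |p / s| ≤ M` and `w` tends to `0` at the origin, a bound `M` improves to `M * x`.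
  -- On `(0, 1/2]` this at least halves it, and iterating gives `w = 0` there.
  have hlin : ∀ M : ℝ, 0 ≤ M → (∀ x ∈ Ioc (0 : ℝ) (1 / 2), |w x| ≤ M) →
      ∀ x ∈ Ioc (0 : ℝ) (1 / 2), |w x| ≤ M * x := by
    intro M hM hb x hx
    have hle : ∀ y ∈ Ioo 0 x, |w x - w y| ≤ M * x := by
      intro y hy
      have := (convex_Icc y x).norm_image_sub_le_of_norm_hasDerivWithin_le (f := w)
        (f' := fun s => p s / s) (C := M) (x := y) (y := x)
        (fun s hs => (hw s (hy.1.trans_le hs.1)).hasDerivWithinAt)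
        (fun s hs => by
          have hs0 := hy.1.trans_le hs.1
          rw [norm_div, Real.norm_eq_abs, Real.norm_eq_abs, abs_of_pos hs0, div_le_iff₀ hs0]
          exact habs M hM hb s ⟨hs0, hs.2.trans hx.2⟩)
        (left_mem_Icc.2 hy.2.le) (right_mem_Icc.2 hy.2.le)
      rw [Real.norm_eq_abs, Real.norm_eq_abs, abs_of_nonneg (by linarith [hy.2] : 0 ≤ x - y)] at this
      nlinarith [hy.1]
    have ht : Tendsto (fun y => |w x - w y|) (𝓝[>] 0) (𝓝 |w x - 0|) :=
      (tendsto_const_nhds.sub h0).abs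
    rw [sub_zero] at ht
    refine le_of_tendsto ht ?_
    filter_upwards [Ioo_mem_nhdsGT hx.1] with y hy using hle y hy
  obtain ⟨M, hM, hb⟩ : ∃ M : ℝ, 0 ≤ M ∧ ∀ x ∈ Ioc (0 : ℝ) (1 / 2), |w x| ≤ M := by
    have h1 : ∀ᶠ y in 𝓝[>] (0 : ℝ), |w y| < 1 := by
      have := h0.abs
      rw [abs_zero] at this
      exact this.eventually_lt_const one_pos
    obtain ⟨ε, hε, hε1⟩ := mem_nhdsGT_iff_exists_Ioo_subset.1 h1
    obtain ⟨C, hC⟩ := (isCompact_Icc (a := ε) (b := (1 / 2 : ℝ))).exists_bound_of_continuousOn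
      (hwc.mono fun s hs => lt_of_lt_of_le hε hs.1)
    refine ⟨max 1 C, by positivity, fun x hx => ?_⟩
    rcases lt_or_ge x ε with h | h
    · exact (hε1 ⟨hx.1, h⟩ : |w x| < 1).le.trans (le_max_left _ _)
    · exact (hC x ⟨h, hx.2⟩).trans (le_max_right _ _)
  have hiter : ∀ n : ℕ, ∀ x ∈ Ioc (0 : ℝ) (1 / 2), |w x| ≤ M * (1 / 2) ^ n := by
    intro n
    induction n with
    | zero => simpa using hb
    | succ n ih =>
      intro x hx
      have hMn : 0 ≤ M * (1 / 2) ^ n := by positivity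
      calc |w x| ≤ M * (1 / 2) ^ n * x := hlin _ hMn ih x hx
        _ ≤ M * (1 / 2) ^ n * (1 / 2) := by gcongr; exact hx.2
        _ = _ := by ring
  have hzero : ∀ x ∈ Ioc (0 : ℝ) (1 / 2), w x = 0 := by
    intro x hx
    have ht : Tendsto (fun n : ℕ => M * (1 / 2 : ℝ) ^ n) atTop (𝓝 (M * 0)) :=
      (tendsto_pow_atTop_nhds_zero_of_lt_one (by norm_num) (by norm_num)).const_mul M
    rw [mul_zero] at ht
    exact abs_nonpos_iff.1 (ge_of_tendsto' ht fun n => hiter n x hx)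
  have hp4 : p (1 / 4) = 0 := by
    have h1 := hw (1 / 4) (by norm_num)
    have h2 : HasDerivAt w 0 (1 / 4) := by
      refine (hasDerivAt_const (1 / 4 : ℝ) (0 : ℝ)).congr_of_eventuallyEq ?_
      filter_upwards [Ioo_mem_nhds (by norm_num : (0 : ℝ) < 1 / 4)
        (by norm_num : (1 / 4 : ℝ) < 1 / 2)] with y hy using hzero y ⟨hy.1, hy.2.le⟩
    have h3 := h1.unique h2
    simpa using h3
  -- The energy `w² + (p / x)²` has derivative `-2 p² / x³ ≤ 0`. It vanishes at `1/4`, hence at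
  -- every later point, which carries `w = 0` from `(0, 1/2]` to the whole half-line.
  have hE : AntitoneOn (fun x => w x ^ 2 + (p x / x) ^ 2) (Ici (1 / 4)) := by
    have hd : ∀ x > 0, HasDerivAt (fun x => w x ^ 2 + (p x / x) ^ 2) (-(2 * p x ^ 2 / x ^ 3)) x := by
      intro x hx
      refine (((hw x hx).pow 2).add (((hp x hx).div (hasDerivAt_id x) hx.ne').pow 2)).congr_deriv ?_
      have hx' : x ≠ 0 := hx.ne'
      simp only [Pi.div_apply, id_eq]
      field_simp
      ring_nf
      field_simp
      ring
    refine antitoneOn_of_hasDerivWithinAt_nonpos (convex_Ici _)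
      (f' := fun x => -(2 * p x ^ 2 / x ^ 3)) ?_ ?_ ?_
    · intro x hx
      exact (hd x (by have : (1 / 4 : ℝ) ≤ x := hx; linarith)).continuousAt.continuousWithinAt
    · intro x hx
      rw [interior_Ici] at hx
      exact (hd x (by have : (1 / 4 : ℝ) < x := hx; linarith)).hasDerivWithinAt
    · intro x hx
      rw [interior_Ici] at hx
      have : (0 : ℝ) < x := by have : (1 / 4 : ℝ) < x := hx; linarith
      rw [neg_nonpos]
      positivity
  intro x hx
  rcases le_total x (1 / 2) with h | h
  · exact hzero x ⟨hx, h⟩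
  · have h1 := hE (mem_Ici.2 le_rfl) (mem_Ici.2 (by linarith : (1 / 4 : ℝ) ≤ x)) (by linarith)
    simp only [hp4, hzero (1 / 4) ⟨by norm_num, by norm_num⟩] at h1
    have h2 : w x ^ 2 ≤ 0 := by nlinarith [sq_nonneg (p x / x)]
    exact pow_eq_zero_iff (two_ne_zero) |>.1 (le_antisymm h2 (sq_nonneg _))

/-! ### Exponential integrals with hyperbolic phases -/

/-- Half of the exponential absorbs the quadratic factor, through `1 + s ≤ (1 + 4 / x) e^{x s / 4}`.
-/
lemma one_add_sq_mul_exp_le {x s : ℝ} (hx : 0 < x) (hs : 0 ≤ s) :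
    (1 + s) ^ 2 * Real.exp (-(x * s)) ≤ (1 + 4 / x) ^ 2 * Real.exp (-(x / 2 * s)) := by
  have h1 : 1 + s ≤ (1 + 4 / x) * Real.exp (x * s / 4) := by
    have h2 : x * s / 4 + 1 ≤ Real.exp (x * s / 4) := Real.add_one_le_exp _
    have h3 : s = 4 / x * (x * s / 4) := by field_simp
    have h4 : 0 ≤ x * s / 4 := by positivity
    have h5 : 0 < 4 / x := by positivity
    calc 1 + s = 1 + 4 / x * (x * s / 4) := by rw [← h3]
      _ ≤ (1 + 4 / x) * (x * s / 4 + 1) := by nlinarith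
      _ ≤ _ := by gcongr
  calc (1 + s) ^ 2 * Real.exp (-(x * s))
      ≤ ((1 + 4 / x) * Real.exp (x * s / 4)) ^ 2 * Real.exp (-(x * s)) := by gcongr
    _ = (1 + 4 / x) ^ 2 * Real.exp (-(x / 2 * s)) := by
      rw [mul_pow, ← Real.exp_nat_mul, mul_assoc, ← Real.exp_add]
      congr 2
      push_cast
      ring

lemma cosh_le_one_add_sinh {t : ℝ} (ht : 0 ≤ t) : Real.cosh t ≤ 1 + Real.sinh t := by
  have h := Real.cosh_sub_sinh t
  have : Real.exp (-t) ≤ 1 := Real.exp_le_one_iff.2 (by linarith)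
  linarith

lemma sinh_nonneg' {t : ℝ} (ht : 0 ≤ t) : 0 ≤ Real.sinh t := Real.sinh_nonneg_iff.2 ht

/-- This is the common majorant of the half-line hyperbolic integrals in the file and of their
parameter derivatives; `t ≤ sinh t` reduces it to an ordinary exponential. -/
lemma integrableOn_one_add_sinh_sq {c : ℝ} (hc : 0 < c) :
    IntegrableOn (fun t => (1 + Real.sinh t) ^ 2 * Real.exp (-(c * Real.sinh t))) (Ioi 0) := by
  have h := (exp_neg_integrableOn_Ioi 0 (half_pos hc)).const_mul ((1 + 4 / c) ^ 2)
  refine Integrable.mono' h (Continuous.aestronglyMeasurable (by fun_prop)) ?_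
  refine (ae_restrict_iff' measurableSet_Ioi).2 (Eventually.of_forall fun t ht => ?_)
  have ht0 : 0 ≤ t := le_of_lt ht
  rw [Real.norm_eq_abs, abs_of_nonneg (by positivity)]
  refine (one_add_sq_mul_exp_le hc (sinh_nonneg' ht0)).trans ?_
  have : t ≤ Real.sinh t := Real.self_le_sinh_iff.2 ht0
  gcongr
  rw [neg_mul, neg_le_neg_iff]
  gcongr

lemma integrableOn_sinh_of_bound {E : Type*} [NormedAddCommGroup E] {c K : ℝ} (hc : 0 < c)
    {F : ℝ → E} (hF : Continuous F)
    (hb : ∀ t, 0 < t → ‖F t‖ ≤ K * ((1 + Real.sinh t) ^ 2 * Real.exp (-(c * Real.sinh t)))) :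
    IntegrableOn F (Ioi 0) := by
  refine Integrable.mono' ((integrableOn_one_add_sinh_sq hc).const_mul K)
    hF.aestronglyMeasurable ?_
  exact (ae_restrict_iff' measurableSet_Ioi).2 (Eventually.of_forall fun t ht => hb t ht)

lemma tendsto_sinh_bound {c : ℝ} (hc : 0 < c) :
    Tendsto (fun t => (1 + Real.sinh t) ^ 2 * Real.exp (-(c * Real.sinh t))) atTop (𝓝 0) := by
  have h : Tendsto (fun t => (1 + 4 / c) ^ 2 * Real.exp (-(c / 2 * t))) atTop (𝓝 ((1 + 4 / c) ^ 2 * 0)) := by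
    refine Tendsto.const_mul _ (Real.tendsto_exp_neg_atTop_nhds_zero.comp ?_)
    exact tendsto_id.const_mul_atTop (half_pos hc)
  rw [mul_zero] at h
  refine tendsto_of_tendsto_of_tendsto_of_le_of_le' tendsto_const_nhds h
    (Eventually.of_forall fun t => by positivity) ?_
  filter_upwards [eventually_ge_atTop 0] with t ht
  refine (one_add_sq_mul_exp_le hc (sinh_nonneg' ht)).trans ?_
  have : t ≤ Real.sinh t := Real.self_le_sinh_iff.2 ht
  gcongr

/-- `∫₀^∞ e^{-x sinh t} dt`. -/
def sinhIntegral (x : ℝ) : ℝ := ∫ t in Ioi (0 : ℝ), Real.exp (-(x * Real.sinh t))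

def sinhIntegralDeriv (x : ℝ) : ℝ :=
  ∫ t in Ioi (0 : ℝ), -Real.sinh t * Real.exp (-(x * Real.sinh t))

lemma integrableOn_sinh_pow_mul_exp {x : ℝ} (hx : 0 < x) (j : ℕ) (hj : j ≤ 2) :
    IntegrableOn (fun t => Real.sinh t ^ j * Real.exp (-(x * Real.sinh t))) (Ioi 0) := by
  refine integrableOn_sinh_of_bound (K := 1) hx (by fun_prop) (fun t ht => ?_)
  have hs := sinh_nonneg' ht.le
  rw [Real.norm_eq_abs, abs_of_nonneg (by positivity), one_mul]
  gcongr
  calc Real.sinh t ^ j ≤ (1 + Real.sinh t) ^ j := by gcongr; linarith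
    _ ≤ _ := pow_le_pow_right₀ (by linarith) hj

lemma hasDerivAt_integral_sinh_pow {x : ℝ} (hx : 0 < x) (j : ℕ) (hj : j ≤ 1) :
    HasDerivAt (fun x => ∫ t in Ioi (0 : ℝ), Real.sinh t ^ j * Real.exp (-(x * Real.sinh t)))
      (∫ t in Ioi (0 : ℝ), -(Real.sinh t ^ (j + 1) * Real.exp (-(x * Real.sinh t)))) x := by
  refine (hasDerivAt_integral_of_dominated_loc_of_deriv_le
    (F := fun x t => Real.sinh t ^ j * Real.exp (-(x * Real.sinh t)))
    (F' := fun x t => -(Real.sinh t ^ (j + 1) * Real.exp (-(x * Real.sinh t))))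
    (s := Ioi (x / 2)) (x₀ := x)
    (bound := fun t => Real.sinh t ^ (j + 1) * Real.exp (-(x / 2 * Real.sinh t)))
    (Ioi_mem_nhds (by linarith)) (Eventually.of_forall fun y =>
      Continuous.aestronglyMeasurable (by fun_prop))
    (integrableOn_sinh_pow_mul_exp hx j (by omega))
    (Continuous.aestronglyMeasurable (by fun_prop)) ?_
    (integrableOn_sinh_pow_mul_exp (half_pos hx) (j + 1) (by omega)) ?_).2
  · refine (ae_restrict_iff' measurableSet_Ioi).2 (Eventually.of_forall fun t ht y hy => ?_)
    have hs := sinh_nonneg' (le_of_lt ht)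
    rw [norm_neg, Real.norm_eq_abs, abs_of_nonneg (by positivity)]
    gcongr
    exact le_of_lt hy
  · refine Eventually.of_forall fun t y _ => ?_
    have h := (((hasDerivAt_id y).mul_const (Real.sinh t)).neg.exp).const_mul (Real.sinh t ^ j)
    refine h.congr_deriv ?_
    simp only [Pi.neg_apply, id, one_mul]
    ring

lemma hasDerivAt_sinhIntegral {x : ℝ} (hx : 0 < x) :
    HasDerivAt sinhIntegral (sinhIntegralDeriv x) x := by
  have h := hasDerivAt_integral_sinh_pow hx 0 (by norm_num)
  simp only [pow_zero, one_mul, zero_add, pow_one] at h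
  refine h.congr_deriv ?_
  unfold sinhIntegralDeriv
  simp only [neg_mul]

/-- The integrand is the derivative of `-cosh t · e^{-x sinh t}`, so only the boundary value at `t =
0` survives. -/
lemma integral_cosh_sq_sub_sinh {x : ℝ} (hx : 0 < x) :
    ∫ t in Ioi (0 : ℝ), (-Real.sinh t + x * Real.cosh t ^ 2) * Real.exp (-(x * Real.sinh t)) = 1 := by
  have hd : ∀ t : ℝ, HasDerivAt (fun t => -(Real.cosh t * Real.exp (-(x * Real.sinh t))))
      ((-Real.sinh t + x * Real.cosh t ^ 2) * Real.exp (-(x * Real.sinh t))) t := by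
    intro t
    refine ((Real.hasDerivAt_cosh t).mul (((Real.hasDerivAt_sinh t).const_mul x).neg.exp)).neg.congr_deriv ?_
    simp only [Pi.neg_apply]
    ring
  have hbound : ∀ t, 0 ≤ t → |Real.cosh t * Real.exp (-(x * Real.sinh t))| ≤
      (1 + Real.sinh t) ^ 2 * Real.exp (-(x * Real.sinh t)) := by
    intro t ht
    have hs := sinh_nonneg' ht
    have hc := cosh_le_one_add_sinh ht
    rw [abs_of_nonneg (by positivity)]
    gcongr
    nlinarith
  rw [integral_Ioi_of_hasDerivAt_of_tendsto' (m := 0) (fun t _ => hd t)]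
  · simp
  · refine integrableOn_sinh_of_bound (K := 1 + x) hx (by fun_prop) (fun t ht => ?_)
    have hs := sinh_nonneg' ht.le
    have hc := cosh_le_one_add_sinh ht.le
    have hc0 := (Real.cosh_pos t).le
    rw [norm_mul, Real.norm_eq_abs, Real.norm_eq_abs, Real.abs_exp, ← mul_assoc]
    gcongr
    refine (abs_add_le _ _).trans ?_
    rw [abs_neg, abs_of_nonneg hs, abs_of_nonneg (by positivity)]
    have : Real.cosh t ^ 2 ≤ (1 + Real.sinh t) ^ 2 := by gcongr
    nlinarith
  · refine squeeze_zero_norm' ?_ (tendsto_sinh_bound hx)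
    filter_upwards [eventually_ge_atTop 0] with t ht
    rw [norm_neg]
    exact hbound t ht

/-- An inhomogeneous Bessel equation with right side `1`. The right side for `cosIntegral` is `I`,
so `cosIntegral - I * sinhIntegral` solves the homogeneous equation. -/
lemma hasDerivAt_mul_sinhIntegralDeriv {x : ℝ} (hx : 0 < x) :
    HasDerivAt (fun x => x * sinhIntegralDeriv x) (1 - x * sinhIntegral x) x := by
  have h1 : (fun x => x * sinhIntegralDeriv x) = fun x => -(x *
      ∫ t in Ioi (0 : ℝ), Real.sinh t ^ 1 * Real.exp (-(x * Real.sinh t))) := by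
    funext x
    unfold sinhIntegralDeriv
    rw [← mul_neg, ← integral_neg]
    simp only [neg_mul, pow_one]
  rw [h1]
  refine ((hasDerivAt_id x).mul (hasDerivAt_integral_sinh_pow hx 1 le_rfl)).neg.congr_deriv ?_
  have h2 := integral_cosh_sq_sub_sinh hx
  have i0 := integrableOn_sinh_pow_mul_exp hx 0 (by norm_num)
  have i1 := integrableOn_sinh_pow_mul_exp hx 1 (by norm_num)
  have i2 := integrableOn_sinh_pow_mul_exp hx 2 (by norm_num)
  have h3 : (fun t => (-Real.sinh t + x * Real.cosh t ^ 2) * Real.exp (-(x * Real.sinh t))) =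
    fun t => -(Real.sinh t ^ 1 * Real.exp (-(x * Real.sinh t))) +
      (x * (Real.sinh t ^ 0 * Real.exp (-(x * Real.sinh t))) +
       x * (Real.sinh t ^ 2 * Real.exp (-(x * Real.sinh t)))) := by
    funext t
    rw [Real.cosh_sq]
    ring
  have i1n : IntegrableOn (fun t => -(Real.sinh t ^ 1 * Real.exp (-(x * Real.sinh t)))) (Ioi 0) :=
    i1.neg
  have i02 : IntegrableOn (fun t => x * (Real.sinh t ^ 0 * Real.exp (-(x * Real.sinh t))) +
       x * (Real.sinh t ^ 2 * Real.exp (-(x * Real.sinh t)))) (Ioi 0) :=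
    (i0.const_mul x).add (i2.const_mul x)
  rw [h3, integral_add i1n i02,
    integral_add (i0.const_mul x) (i2.const_mul x), integral_const_mul, integral_const_mul,
    integral_neg] at h2
  rw [integral_neg]
  simp only [id, one_mul, pow_zero, sinhIntegral] at h2 ⊢
  linarith

/-- `∫₀^{π/2} e^{i x cos φ} dφ`. -/
def cosIntegral (x : ℝ) : ℂ :=
  ∫ φ in (0 : ℝ)..(Real.pi / 2), Complex.exp (Complex.I * (x * Real.cos φ : ℝ))

lemma hasDerivAt_integral_cos_pow (x : ℝ) (j : ℕ) :
    HasDerivAt (fun x : ℝ => ∫ φ in (0 : ℝ)..(Real.pi / 2),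
        (Complex.I * (Real.cos φ : ℝ)) ^ j * Complex.exp (Complex.I * (x * Real.cos φ : ℝ)))
      (∫ φ in (0 : ℝ)..(Real.pi / 2), (Complex.I * (Real.cos φ : ℝ)) ^ (j + 1) *
        Complex.exp (Complex.I * (x * Real.cos φ : ℝ))) x := by
  refine (intervalIntegral.hasDerivAt_integral_of_dominated_loc_of_deriv_le
    (F := fun (x : ℝ) (φ : ℝ) =>
      (Complex.I * (Real.cos φ : ℝ)) ^ j * Complex.exp (Complex.I * (x * Real.cos φ : ℝ)))
    (F' := fun (x : ℝ) (φ : ℝ) =>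
      (Complex.I * (Real.cos φ : ℝ)) ^ (j + 1) * Complex.exp (Complex.I * (x * Real.cos φ : ℝ)))
    (s := univ) (x₀ := x) (bound := fun _ => 1) univ_mem
    (Eventually.of_forall fun y => Continuous.aestronglyMeasurable (by fun_prop))
    (Continuous.intervalIntegrable (by fun_prop) _ _)
    (Continuous.aestronglyMeasurable (by fun_prop)) ?_ (by simp) ?_).2
  · refine Eventually.of_forall fun φ _ y _ => ?_
    rw [norm_mul, mul_comm Complex.I ((y * Real.cos φ : ℝ) : ℂ), Complex.norm_exp_ofReal_mul_I,
      mul_one, norm_pow, norm_mul, Complex.norm_I, one_mul, Complex.norm_real]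
    exact pow_le_one₀ (norm_nonneg _) (Real.abs_cos_le_one φ)
  · refine Eventually.of_forall fun φ _ y _ => ?_
    have h := ((((hasDerivAt_id y).mul_const (Real.cos φ)).ofReal_comp.const_mul
      Complex.I).cexp).const_mul ((Complex.I * (Real.cos φ : ℝ)) ^ j)
    refine h.congr_deriv ?_
    simp only [id, one_mul]
    ring

def cosIntegralDeriv (x : ℝ) : ℂ :=
  ∫ φ in (0 : ℝ)..(Real.pi / 2), (Complex.I * (Real.cos φ : ℝ)) ^ 1 *
        Complex.exp (Complex.I * (x * Real.cos φ : ℝ))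

lemma hasDerivAt_cosIntegral (x : ℝ) : HasDerivAt cosIntegral (cosIntegralDeriv x) x := by
  have h := hasDerivAt_integral_cos_pow x 0
  simp only [pow_zero, one_mul, zero_add] at h
  exact h

lemma hasDerivAt_mul_cosIntegralDeriv (x : ℝ) :
    HasDerivAt (fun x : ℝ => (x : ℂ) * cosIntegralDeriv x) (Complex.I - x * cosIntegral x) x := by
  refine ((Complex.ofRealCLM.hasDerivAt (x := x)).mul
    (hasDerivAt_integral_cos_pow x 1)).congr_deriv ?_
  -- With `sin² = 1 - cos²` the Bessel operator applied to the integrand is a total `φ`-derivative;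
  -- the inhomogeneity `I` is its boundary value at `φ = π / 2`.
  have hd : ∀ φ : ℝ, HasDerivAt (fun φ : ℝ => Complex.I * (Real.sin φ : ℝ) *
      Complex.exp (Complex.I * (x * Real.cos φ : ℝ)))
      (((Complex.I * (Real.cos φ : ℝ)) ^ 1 + x * (1 + (Complex.I * (Real.cos φ : ℝ)) ^ 2)) *
        Complex.exp (Complex.I * (x * Real.cos φ : ℝ))) φ := by
    intro φ
    have h := ((Real.hasDerivAt_sin φ).ofReal_comp.const_mul Complex.I).mul
      ((((Real.hasDerivAt_cos φ).const_mul x).ofReal_comp.const_mul Complex.I).cexp)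
    refine h.congr_deriv ?_
    have h1 : ((Real.cos φ : ℝ) : ℂ) ^ 2 = 1 - ((Real.sin φ : ℝ) : ℂ) ^ 2 := by
      rw [← Complex.ofReal_pow, Real.cos_sq']; push_cast; ring
    rw [mul_pow _ _ 2, h1, Complex.I_sq]
    push_cast
    linear_combination (-(x : ℂ) * Complex.sin φ ^ 2 *
      Complex.exp (Complex.I * (x * Complex.cos φ))) * Complex.I_sq
  have h2 := intervalIntegral.integral_eq_sub_of_hasDerivAt (a := 0) (b := Real.pi / 2)
    (fun φ _ => hd φ) (Continuous.intervalIntegrable (by fun_prop) _ _)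
  have c0 : Continuous fun φ : ℝ => Complex.exp (Complex.I * (x * Real.cos φ : ℝ)) := by fun_prop
  have c1 : Continuous fun φ : ℝ => (Complex.I * (Real.cos φ : ℝ)) ^ 1 *
    Complex.exp (Complex.I * (x * Real.cos φ : ℝ)) := by fun_prop
  have c2 : Continuous fun φ : ℝ => (Complex.I * (Real.cos φ : ℝ)) ^ 2 *
    Complex.exp (Complex.I * (x * Real.cos φ : ℝ)) := by fun_prop
  have h3 : (fun φ : ℝ => ((Complex.I * (Real.cos φ : ℝ)) ^ 1 +
        x * (1 + (Complex.I * (Real.cos φ : ℝ)) ^ 2)) *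
        Complex.exp (Complex.I * (x * Real.cos φ : ℝ))) = fun φ : ℝ =>
      (Complex.I * (Real.cos φ : ℝ)) ^ 1 * Complex.exp (Complex.I * (x * Real.cos φ : ℝ)) +
      (x * Complex.exp (Complex.I * (x * Real.cos φ : ℝ)) + x * ((Complex.I * (Real.cos φ : ℝ)) ^ 2 *
    Complex.exp (Complex.I * (x * Real.cos φ : ℝ)))) := by
    funext φ; ring
  have c0x : Continuous fun φ : ℝ => x * Complex.exp (Complex.I * (x * Real.cos φ : ℝ)) := by
    fun_prop
  have c2x : Continuous fun φ : ℝ => x * ((Complex.I * (Real.cos φ : ℝ)) ^ 2 *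
    Complex.exp (Complex.I * (x * Real.cos φ : ℝ))) := by fun_prop
  have c02 : Continuous fun φ : ℝ => x * Complex.exp (Complex.I * (x * Real.cos φ : ℝ)) +
    x * ((Complex.I * (Real.cos φ : ℝ)) ^ 2 *
    Complex.exp (Complex.I * (x * Real.cos φ : ℝ))) := by fun_prop
  rw [h3, intervalIntegral.integral_add (c1.intervalIntegrable _ _) (c02.intervalIntegrable _ _),
    intervalIntegral.integral_add (c0x.intervalIntegrable _ _) (c2x.intervalIntegrable _ _),
    intervalIntegral.integral_const_mul,
    intervalIntegral.integral_const_mul] at h2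
  simp only [Real.sin_pi_div_two, Real.cos_pi_div_two, Real.sin_zero, mul_zero, Complex.ofReal_zero,
    Complex.exp_zero, zero_mul, sub_zero, Complex.ofReal_one, mul_one, cosIntegral] at h2 ⊢
  simp only [Complex.ofRealCLM_apply, Complex.ofReal_one, one_mul, Nat.reduceAdd]
  linear_combination h2


/-! ### Logarithmic behaviour of `sinhIntegral` at the origin, and the integral representation of
the Hankel function. -/

lemma integrableOn_abs_log_mul_exp_neg :
    IntegrableOn (fun s : ℝ => (|Real.log s| + s) * Real.exp (-s)) (Ioi 0) := by
  have h1 := Real.GammaIntegral_convergent (s := 1 / 2) (by norm_num)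
  have h2 := Real.GammaIntegral_convergent (s := 3 / 2) (by norm_num)
  have h3 := Real.GammaIntegral_convergent (s := 2) (by norm_num)
  refine Integrable.mono' ((h1.const_mul 2).add ((h2.const_mul 2).add h3)) ?_ ?_
  · exact Measurable.aestronglyMeasurable (by fun_prop)
  · refine (ae_restrict_iff' measurableSet_Ioi).2 (Eventually.of_forall fun s hs => ?_)
    have hs0 : (0 : ℝ) < s := hs
    rw [norm_mul, Real.norm_eq_abs, Real.norm_eq_abs, Real.abs_exp, abs_of_nonneg (by positivity)]
    have h4 : Real.log s ≤ s ^ (1 / 2 : ℝ) / (1 / 2) :=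
      Real.log_le_rpow_div hs0.le (by norm_num)
    have h5 : Real.log s⁻¹ ≤ s⁻¹ ^ (1 / 2 : ℝ) / (1 / 2) :=
      Real.log_le_rpow_div (by positivity) (by norm_num)
    rw [Real.log_inv, Real.inv_rpow hs0.le, ← Real.rpow_neg hs0.le] at h5
    have h6 : 0 ≤ s ^ (1 / 2 : ℝ) := by positivity
    have h7 : 0 ≤ s ^ (-(1 / 2) : ℝ) := by positivity
    have h8 : |Real.log s| ≤ 2 * s ^ (-(1 / 2) : ℝ) + 2 * s ^ (1 / 2 : ℝ) := by
      rw [abs_le]; constructor <;> linarith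
    simp only [Pi.add_apply]
    norm_num at h8 ⊢
    nlinarith [Real.exp_pos (-s)]

/-- Both sides are `Γ'(1)`: the left one by differentiating Euler's integral under the integral
sign. -/
lemma integral_log_mul_exp_neg :
    ∫ s in Ioi (0 : ℝ), Real.log s * Real.exp (-s) = -Real.eulerMascheroniConstant := by
  have h1 := Complex.hasDerivAt_GammaIntegral (s := 1) (by simp)
  have h2 : HasDerivAt Complex.Gamma
      (∫ t : ℝ in Ioi 0, (t : ℂ) ^ ((1 : ℂ) - 1) * (Real.log t * Real.exp (-t))) 1 := by
    refine h1.congr_of_eventuallyEq ?_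
    have : IsOpen {s : ℂ | 0 < s.re} := Complex.continuous_re.isOpen_preimage _ isOpen_Ioi
    filter_upwards [this.mem_nhds (by simp : (1 : ℂ) ∈ {s : ℂ | 0 < s.re})] with a ha
    exact Complex.Gamma_eq_integral ha
  have h3 := h2.unique Complex.hasDerivAt_Gamma_one
  have h4 : (∫ t : ℝ in Ioi 0, (t : ℂ) ^ ((1 : ℂ) - 1) * (Real.log t * Real.exp (-t))) =
      ((∫ s in Ioi (0 : ℝ), Real.log s * Real.exp (-s) : ℝ) : ℂ) := by
    rw [← integral_complex_ofReal]
    congr 1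
    funext t
    simp
  rw [h4] at h3
  exact_mod_cast h3

/-- Adding `log (x / 2)` cancels the divergence as `x → 0`: the right side tends to `log s`. -/
lemma arsinh_div_add_log {x s : ℝ} (hx : 0 < x) (hs : 0 < s) :
    Real.arsinh (s / x) + Real.log (x / 2) = Real.log ((s + √(s ^ 2 + x ^ 2)) / 2) := by
  have h1 : √(1 + (s / x) ^ 2) = √(s ^ 2 + x ^ 2) / x := by
    rw [show 1 + (s / x) ^ 2 = (s ^ 2 + x ^ 2) / x ^ 2 by field_simp; ring,
      Real.sqrt_div (by positivity), Real.sqrt_sq hx.le]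
  rw [Real.arsinh, ← Real.log_mul (by positivity) (by positivity), h1]
  congr 1
  field_simp

lemma arsinh_le_self {y : ℝ} (hy : 0 ≤ y) : Real.arsinh y ≤ y := by
  have := Real.self_le_sinh_iff.2 (Real.arsinh_nonneg_iff.2 hy)
  rwa [Real.sinh_arsinh] at this

lemma integrableOn_mul_exp_neg : IntegrableOn (fun s : ℝ => s * Real.exp (-s)) (Ioi 0) := by
  have h := Real.GammaIntegral_convergent (s := 2) (by norm_num)
  norm_num at h
  simpa only [mul_comm] using h

lemma continuous_arsinh_mul_exp (x : ℝ) :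
    Continuous fun s => Real.arsinh (s / x) * Real.exp (-s) :=
  (Real.continuous_arsinh.comp (continuous_id.div_const x)).mul (by fun_prop)

/-- Integration by parts in `t` followed by the substitution `s = x sinh t`. The parameter moves out
of the exponential and into the slowly varying factor `arsinh (s / x)`. -/
lemma sinhIntegral_eq_integral_arsinh {x : ℝ} (hx : 0 < x) :
    sinhIntegral x = ∫ s in Ioi (0 : ℝ), Real.arsinh (s / x) * Real.exp (-s) := by
  have hsub : (∫ t in Ioi (0 : ℝ), ((fun s => Real.arsinh (s / x) * Real.exp (-s)) ∘
      fun t => x * Real.sinh t) t * (x * Real.cosh t)) =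
      ∫ s in Ioi (0 : ℝ), Real.arsinh (s / x) * Real.exp (-s) := by
    have h := integral_comp_mul_deriv_Ioi (a := 0) (f := fun t => x * Real.sinh t)
      (f' := fun t => x * Real.cosh t) (g := fun s => Real.arsinh (s / x) * Real.exp (-s))
      (by fun_prop) ?_ ?_ ?_ ?_ ?_
    · simpa using h
    · refine Tendsto.const_mul_atTop hx ?_
      refine tendsto_atTop_mono' _ ?_ tendsto_id
      filter_upwards [eventually_ge_atTop 0] with t ht
      exact Real.self_le_sinh_iff.2 ht
    · exact fun t _ => ((Real.hasDerivAt_sinh t).const_mul x).hasDerivWithinAt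
    · exact (continuous_arsinh_mul_exp x).continuousOn
    · have h1 : IntegrableOn (fun s => Real.arsinh (s / x) * Real.exp (-s)) (Ici 0) := by
        rw [integrableOn_Ici_iff_integrableOn_Ioi]
        refine Integrable.mono' (integrableOn_mul_exp_neg.const_mul x⁻¹)
          (continuous_arsinh_mul_exp x).aestronglyMeasurable ?_
        refine (ae_restrict_iff' measurableSet_Ioi).2 (Eventually.of_forall fun s hs => ?_)
        have hs0 : (0 : ℝ) < s := hs
        have h2 : 0 ≤ s / x := by positivity
        rw [norm_mul, Real.norm_eq_abs, Real.norm_eq_abs, Real.abs_exp,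
          abs_of_nonneg (Real.arsinh_nonneg_iff.2 h2), ← mul_assoc]
        gcongr
        rw [inv_mul_eq_div]
        exact arsinh_le_self h2
      refine h1.mono_set ?_
      rintro _ ⟨t, ht, rfl⟩
      exact mul_nonneg hx.le (sinh_nonneg' ht)
    · rw [integrableOn_Ici_iff_integrableOn_Ioi]
      simp only [Function.comp, mul_div_cancel_left₀ _ hx.ne', Real.arsinh_sinh]
      refine integrableOn_sinh_of_bound (K := x) hx (by fun_prop) (fun t ht => ?_)
      have hs := sinh_nonneg' ht.le
      have hc := cosh_le_one_add_sinh ht.le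
      have h5 : t ≤ Real.sinh t := Real.self_le_sinh_iff.2 ht.le
      rw [Real.norm_eq_abs, abs_of_nonneg (by positivity)]
      calc t * Real.exp (-(x * Real.sinh t)) * (x * Real.cosh t)
          = x * ((t * Real.cosh t) * Real.exp (-(x * Real.sinh t))) := by ring
        _ ≤ _ := by gcongr; nlinarith [Real.cosh_pos t]
  rw [← hsub]
  simp only [Function.comp, mul_div_cancel_left₀ _ hx.ne', Real.arsinh_sinh]
  have hd : ∀ t : ℝ, HasDerivAt (fun t => -(t * Real.exp (-(x * Real.sinh t))))
      (t * Real.exp (-(x * Real.sinh t)) * (x * Real.cosh t) - Real.exp (-(x * Real.sinh t))) t := by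
    intro t
    refine ((hasDerivAt_id t).mul (((Real.hasDerivAt_sinh t).const_mul x).neg.exp)).neg.congr_deriv ?_
    simp only [Pi.neg_apply, id]
    ring
  have i1 : IntegrableOn (fun t => t * Real.exp (-(x * Real.sinh t)) * (x * Real.cosh t)) (Ioi 0) := by
    refine integrableOn_sinh_of_bound (K := x) hx (by fun_prop) (fun t ht => ?_)
    have hs := sinh_nonneg' ht.le
    have hc := cosh_le_one_add_sinh ht.le
    have h5 : t ≤ Real.sinh t := Real.self_le_sinh_iff.2 ht.le
    rw [Real.norm_eq_abs, abs_of_nonneg (by positivity)]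
    calc t * Real.exp (-(x * Real.sinh t)) * (x * Real.cosh t)
        = x * ((t * Real.cosh t) * Real.exp (-(x * Real.sinh t))) := by ring
      _ ≤ _ := by gcongr; nlinarith [Real.cosh_pos t]
  have i0 : IntegrableOn (fun t => Real.exp (-(x * Real.sinh t))) (Ioi 0) := by
    simpa using integrableOn_sinh_pow_mul_exp hx 0 (by norm_num)
  have h := integral_Ioi_of_hasDerivAt_of_tendsto' (a := 0) (m := 0) (fun t _ => hd t)
    (i1.sub i0) ?_
  · rw [integral_sub i1 i0] at h
    simp only [zero_mul, neg_zero, sub_zero] at h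
    unfold sinhIntegral
    linarith
  · refine squeeze_zero_norm' ?_ (tendsto_sinh_bound hx)
    filter_upwards [eventually_ge_atTop 0] with t ht
    have hs := sinh_nonneg' ht
    have h5 : t ≤ Real.sinh t := Real.self_le_sinh_iff.2 ht
    rw [norm_neg, Real.norm_eq_abs, abs_of_nonneg (by positivity)]
    gcongr
    nlinarith

/-- Dominated convergence: once the logarithm is absorbed into the integral, the integrand tends to
`log s · e^{-s}`, whose integral is minus Euler's constant. This is the constant appearing in
`besselY0`. -/
lemma tendsto_sinhIntegral_add_log :
    Tendsto (fun x => sinhIntegral x + Real.log (x / 2)) (𝓝[>] 0)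
      (𝓝 (-Real.eulerMascheroniConstant)) := by
  have hexp : IntegrableOn (fun s : ℝ => Real.exp (-s)) (Ioi 0) := by
    simpa using exp_neg_integrableOn_Ioi 0 one_pos
  have heq : ∀ x : ℝ, 0 < x → sinhIntegral x + Real.log (x / 2) =
      ∫ s in Ioi (0 : ℝ), Real.log ((s + √(s ^ 2 + x ^ 2)) / 2) * Real.exp (-s) := by
    intro x hx
    have i1 : IntegrableOn (fun s => Real.arsinh (s / x) * Real.exp (-s)) (Ioi 0) := by
      refine Integrable.mono' (integrableOn_mul_exp_neg.const_mul x⁻¹)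
        (continuous_arsinh_mul_exp x).aestronglyMeasurable ?_
      refine (ae_restrict_iff' measurableSet_Ioi).2 (Eventually.of_forall fun s hs => ?_)
      have hs0 : (0 : ℝ) < s := hs
      have h2 : 0 ≤ s / x := by positivity
      rw [norm_mul, Real.norm_eq_abs, Real.norm_eq_abs, Real.abs_exp,
        abs_of_nonneg (Real.arsinh_nonneg_iff.2 h2), ← mul_assoc]
      gcongr
      rw [inv_mul_eq_div]
      exact arsinh_le_self h2
    rw [sinhIntegral_eq_integral_arsinh hx]
    have h1 : Real.log (x / 2) = ∫ s in Ioi (0 : ℝ), Real.log (x / 2) * Real.exp (-s) := by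
      rw [integral_const_mul, integral_exp_neg_Ioi_zero, mul_one]
    conv_lhs => rw [h1]
    rw [← integral_add i1 (hexp.const_mul _)]
    refine setIntegral_congr_fun measurableSet_Ioi fun s hs => ?_
    rw [← add_mul, arsinh_div_add_log hx hs]
  have hev : (fun x => ∫ s in Ioi (0 : ℝ), Real.log ((s + √(s ^ 2 + x ^ 2)) / 2) * Real.exp (-s))
      =ᶠ[𝓝[>] 0] fun x => sinhIntegral x + Real.log (x / 2) := by
    filter_upwards [self_mem_nhdsWithin] with x hx using (heq x hx).symm
  rw [← integral_log_mul_exp_neg]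
  refine Tendsto.congr' hev ?_
  refine tendsto_integral_filter_of_dominated_convergence
    (fun s : ℝ => (|Real.log s| + s) * Real.exp (-s)) ?_ ?_ integrableOn_abs_log_mul_exp_neg ?_
  · exact Eventually.of_forall fun x => Measurable.aestronglyMeasurable (by fun_prop)
  · filter_upwards [Ioc_mem_nhdsGT (one_pos : (0 : ℝ) < 1)] with x hx
    refine (ae_restrict_iff' measurableSet_Ioi).2 (Eventually.of_forall fun s hs => ?_)
    have hs0 : (0 : ℝ) < s := hs
    rw [norm_mul, Real.norm_eq_abs, Real.norm_eq_abs, Real.abs_exp]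
    gcongr
    have h1 : s ≤ √(s ^ 2 + x ^ 2) := Real.le_sqrt_of_sq_le (by nlinarith [sq_nonneg x])
    have h2 : √(s ^ 2 + x ^ 2) ≤ s + x := by
      rw [Real.sqrt_le_left (by linarith [hx.1])]
      nlinarith [hx.1]
    have h3 : Real.log s ≤ Real.log ((s + √(s ^ 2 + x ^ 2)) / 2) :=
      Real.log_le_log hs0 (by linarith)
    have h4 : Real.log ((s + √(s ^ 2 + x ^ 2)) / 2) ≤ Real.log (s + 1) :=
      Real.log_le_log (by positivity) (by linarith [hx.2])
    have h5 : Real.log (s + 1) ≤ s := by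
      have := Real.log_le_sub_one_of_pos (by linarith : 0 < s + 1)
      linarith
    rw [abs_le]
    constructor
    · linarith [neg_abs_le (Real.log s)]
    · linarith [abs_nonneg (Real.log s)]
  · refine (ae_restrict_iff' measurableSet_Ioi).2 (Eventually.of_forall fun s hs => ?_)
    have hs0 : (0 : ℝ) < s := hs
    refine Tendsto.mul_const _ ?_
    have hc : ContinuousAt (fun x : ℝ => Real.log ((s + √(s ^ 2 + x ^ 2)) / 2)) 0 := by
      refine ContinuousAt.log (by fun_prop) ?_
      positivity
    have h6 := hc.tendsto
    simp only [ne_eq, OfNat.ofNat_ne_zero, not_false_eq_true, zero_pow, add_zero,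
      Real.sqrt_sq hs0.le, add_self_div_two] at h6
    exact h6.mono_left nhdsWithin_le_nhds

/-- The Poisson and Mehler-Sonine integral representation of `H₀⁽¹⁾`. -/
theorem hankelH0_eq_integral {x : ℝ} (hx : 0 < x) :
    hankelH0 x = 2 / Real.pi * (cosIntegral x - Complex.I * sinhIntegral x) := by
  set b : ℝ → ℝ := fun x => 2 / Real.pi * (Real.log (x / 2) + Real.eulerMascheroniConstant) with hb
  have hJ : ∀ x : ℝ, HasDerivAt besselJ0 (x / 2 * besselSeriesDeriv (x ^ 2 / 4)) x := by
    intro x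
    have h := (hasDerivAt_besselSeries (x ^ 2 / 4)).comp x (((hasDerivAt_pow 2 x)).div_const 4)
    rw [funext besselJ0_eq]
    refine h.congr_deriv ?_
    norm_num
    ring
  have hY : ∀ x > 0, HasDerivAt besselY0 ((2 / Real.pi * besselSeries (x ^ 2 / 4)
      + x * b x * (x / 2 * besselSeriesDeriv (x ^ 2 / 4))
      - 2 / Real.pi * (2 * (x ^ 2 / 4 * besselHarmonicSeriesDeriv (x ^ 2 / 4)))) / x) x := by
    intro x hx
    have hq := ((hasDerivAt_pow 2 x)).div_const 4
    have h1 := (hasDerivAt_besselSeries (x ^ 2 / 4)).comp x hq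
    have h2 := (hasDerivAt_besselHarmonicSeries (x ^ 2 / 4)).comp x hq
    have h3 := (((((hasDerivAt_id x).div_const 2).log (by simp [hx.ne'])).add_const
      Real.eulerMascheroniConstant).const_mul (2 / Real.pi)).mul h1
    have h4 := h3.sub (h2.const_mul (2 / Real.pi))
    rw [funext besselY0_eq]
    refine h4.congr_deriv ?_
    have := Real.pi_ne_zero
    simp only [hb, id, Function.comp]
    field_simp
    norm_num
    ring
  have hpJ : ∀ x : ℝ, HasDerivAt (fun x => 2 * (x ^ 2 / 4 * besselSeriesDeriv (x ^ 2 / 4)))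
      (-(x * besselJ0 x)) x := by
    intro x
    have hq := ((hasDerivAt_pow 2 x)).div_const 4
    have h := ((hasDerivAt_mul_besselSeriesDeriv (x ^ 2 / 4)).comp x hq).const_mul 2
    refine h.congr_deriv ?_
    rw [besselJ0_eq]
    norm_num
    ring
  have hpY : ∀ x > 0, HasDerivAt (fun x => 2 / Real.pi * besselSeries (x ^ 2 / 4)
      + b x * (2 * (x ^ 2 / 4 * besselSeriesDeriv (x ^ 2 / 4)))
      - 2 / Real.pi * (2 * (x ^ 2 / 4 * besselHarmonicSeriesDeriv (x ^ 2 / 4))))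
      (-(x * besselY0 x)) x := by
    intro x hx
    have hq := ((hasDerivAt_pow 2 x)).div_const 4
    have h1 := (hasDerivAt_besselSeries (x ^ 2 / 4)).comp x hq
    have h2 := ((hasDerivAt_mul_besselHarmonicSeriesDeriv (x ^ 2 / 4)).comp x hq).const_mul 2
    have h3 := (((((hasDerivAt_id x).div_const 2).log (by simp [hx.ne'])).add_const
      Real.eulerMascheroniConstant).const_mul (2 / Real.pi)).mul (hpJ x)
    have h4 := ((h1.const_mul (2 / Real.pi)).add h3).sub (h2.const_mul (2 / Real.pi))
    refine h4.congr_deriv ?_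
    rw [besselY0_eq, besselJ0_eq]
    have := Real.pi_ne_zero
    simp only [id]
    field_simp
    norm_num
    ring
  -- `W` is the difference of the two sides and `P = x W'`, so that `(W, P)` satisfies the
  -- first-order system of `bessel_unique`.
  set W : ℝ → ℂ := fun x => 2 / Real.pi * (cosIntegral x - Complex.I * sinhIntegral x)
    - (besselJ0 x + Complex.I * besselY0 x) with hW
  set P : ℝ → ℂ := fun x => 2 / Real.pi * (x * cosIntegralDeriv x
      - Complex.I * (x * sinhIntegralDeriv x : ℝ))
    - ((2 * (x ^ 2 / 4 * besselSeriesDeriv (x ^ 2 / 4)) : ℝ)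
      + Complex.I * (2 / Real.pi * besselSeries (x ^ 2 / 4)
      + b x * (2 * (x ^ 2 / 4 * besselSeriesDeriv (x ^ 2 / 4)))
      - 2 / Real.pi * (2 * (x ^ 2 / 4 * besselHarmonicSeriesDeriv (x ^ 2 / 4))) : ℝ)) with hP
  have hWd : ∀ x > 0, HasDerivAt W (P x / x) x := by
    intro x hx
    have h := (((hasDerivAt_cosIntegral x).sub
      ((hasDerivAt_sinhIntegral hx).ofReal_comp.const_mul Complex.I)).const_mul
      (2 / Real.pi : ℂ)).sub ((hJ x).ofReal_comp.add ((hY x hx).ofReal_comp.const_mul Complex.I))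
    refine h.congr_deriv ?_
    have hx' : (x : ℂ) ≠ 0 := by exact_mod_cast hx.ne'
    simp only [hP]
    push_cast
    field_simp
    ring
  have hPd : ∀ x > 0, HasDerivAt P (-(x * W x)) x := by
    intro x hx
    have h := (((hasDerivAt_mul_cosIntegralDeriv x).sub
      ((hasDerivAt_mul_sinhIntegralDeriv hx).ofReal_comp.const_mul Complex.I)).const_mul
      (2 / Real.pi : ℂ)).sub ((hpJ x).ofReal_comp.add ((hpY x hx).ofReal_comp.const_mul Complex.I))
    refine h.congr_deriv ?_
    simp only [hW]
    push_cast
    ring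
  have hW0 : Tendsto W (𝓝[>] 0) (𝓝 0) := by
    have hJ0 : besselSeries 0 = 1 := by
      unfold besselSeries
      rw [tsum_eq_single 0 (fun n hn => by simp [hn])]
      simp [besselCoeff]
    have hT0 : besselHarmonicSeries 0 = 0 := by
      unfold besselHarmonicSeries
      rw [tsum_eq_single 0 (fun n hn => by simp [hn])]
      simp [besselHarmonicCoeff]
    have t1 : Tendsto cosIntegral (𝓝[>] 0) (𝓝 (Real.pi / 2)) := by
      have h := (hasDerivAt_cosIntegral 0).continuousAt.tendsto
      have h0 : cosIntegral 0 = Real.pi / 2 := by simp [cosIntegral]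
      rw [h0] at h
      exact h.mono_left nhdsWithin_le_nhds
    have t2 : Tendsto besselJ0 (𝓝[>] 0) (𝓝 1) := by
      have h := (hJ 0).continuousAt.tendsto
      rw [besselJ0_eq] at h
      norm_num [hJ0] at h
      exact h.mono_left nhdsWithin_le_nhds
    have t3 : Tendsto (fun x : ℝ => besselHarmonicSeries (x ^ 2 / 4)) (𝓝[>] 0) (𝓝 0) := by
      have hc : ContinuousAt (fun x : ℝ => besselHarmonicSeries (x ^ 2 / 4)) 0 :=
        ContinuousAt.comp (f := fun x : ℝ => x ^ 2 / 4)
          (hasDerivAt_besselHarmonicSeries _).continuousAt (by fun_prop)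
      have h := hc.tendsto
      norm_num [hT0] at h
      exact h.mono_left nhdsWithin_le_nhds
    -- Since `J₀` has value `1` and derivative `0` at the origin, `J₀ - 1 = o(x)`, which beats the
    -- logarithm.
    have t4 : Tendsto (fun x : ℝ => (Real.log (x / 2) + Real.eulerMascheroniConstant) *
        (besselJ0 x - 1)) (𝓝[>] 0) (𝓝 0) := by
      have hd : Tendsto (fun x : ℝ => x⁻¹ * (besselJ0 x - 1)) (𝓝[>] 0) (𝓝 0) := by
        have h := (hJ 0).tendsto_slope_zero_right
        rw [besselJ0_eq] at h
        norm_num [hJ0] at h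
        exact h
      have hl : Tendsto (fun x : ℝ => Real.log x * x) (𝓝[>] 0) (𝓝 0) := by
        simpa using tendsto_log_mul_rpow_nhdsGT_zero (r := 1) one_pos
      have hx0 : Tendsto (fun x : ℝ => x) (𝓝[>] 0) (𝓝 0) := nhdsWithin_le_nhds
      have h2 := (hl.add (hx0.const_mul (Real.eulerMascheroniConstant - Real.log 2))).mul hd
      simp only [mul_zero, add_zero] at h2
      refine h2.congr' ?_
      filter_upwards [self_mem_nhdsWithin] with x hx
      have hx1 : x ≠ 0 := (ne_of_gt hx)
      rw [Real.log_div hx1 two_ne_zero]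
      field_simp
      ring
    have t5 := tendsto_sinhIntegral_add_log
    have t6 : Tendsto (fun x => sinhIntegral x + (Real.log (x / 2) + Real.eulerMascheroniConstant)
        + (Real.log (x / 2) + Real.eulerMascheroniConstant) * (besselJ0 x - 1)
        - besselHarmonicSeries (x ^ 2 / 4)) (𝓝[>] 0) (𝓝 0) := by
      have h := ((t5.add_const Real.eulerMascheroniConstant).add t4).sub t3
      simp only [neg_add_cancel, add_zero, sub_zero] at h
      refine h.congr fun x => ?_
      ring
    have t7 := ((t1.const_mul (2 / Real.pi : ℂ)).sub
      ((Complex.continuous_ofReal.tendsto _).comp t2)).sub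
      (((Complex.continuous_ofReal.tendsto _).comp t6).const_mul (Complex.I * (2 / Real.pi)))
    have hpi : (Real.pi : ℂ) ≠ 0 := by exact_mod_cast Real.pi_ne_zero
    have h0 : (2 / Real.pi : ℂ) * (Real.pi / 2) - ((1 : ℝ) : ℂ) -
        Complex.I * (2 / Real.pi) * ((0 : ℝ) : ℂ) = 0 := by
      field_simp
      simp
    rw [h0] at t7
    refine t7.congr fun x => ?_
    simp only [hW, Function.comp, besselY0_eq, besselJ0_eq]
    push_cast
    ring
  have hre := bessel_unique (w := fun x => (W x).re) (p := fun x => (P x).re)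
    (fun x hx => (Complex.reCLM.hasFDerivAt.comp_hasDerivAt x (hWd x hx)).congr_deriv (by
      simp [Complex.div_ofReal_re]))
    (fun x hx => (Complex.reCLM.hasFDerivAt.comp_hasDerivAt x (hPd x hx)).congr_deriv (by simp))
    ((Complex.continuous_re.tendsto' 0 0 (by simp)).comp hW0) x hx
  have him := bessel_unique (w := fun x => (W x).im) (p := fun x => (P x).im)
    (fun x hx => (Complex.imCLM.hasFDerivAt.comp_hasDerivAt x (hWd x hx)).congr_deriv (by
      simp [Complex.div_ofReal_im]))
    (fun x hx => (Complex.imCLM.hasFDerivAt.comp_hasDerivAt x (hPd x hx)).congr_deriv (by simp))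
    ((Complex.continuous_im.tendsto' 0 0 (by simp)).comp hW0) x hx
  have hWx : W x = 0 := Complex.ext hre him
  rw [hankelH0]
  exact (sub_eq_zero.1 hWx).symm


/-! ### Rotation invariance of plane-wave superpositions -/

lemma one_add_sq_le_cosh (t : ℝ) : 1 + t ^ 2 / 2 ≤ Real.cosh t := by
  have h1 : Real.cosh t = 1 + 2 * Real.sinh (t / 2) ^ 2 := by
    have h := Real.cosh_two_mul (t / 2)
    rw [Real.cosh_sq, mul_div_cancel₀ t two_ne_zero] at h
    linarith
  have h2 : (t / 2) ^ 2 ≤ Real.sinh (t / 2) ^ 2 := by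
    rcases le_total 0 (t / 2) with h | h
    · exact pow_le_pow_left₀ h (Real.self_le_sinh_iff.2 h) 2
    · have := Real.sinh_le_self_iff.2 h
      nlinarith
  rw [h1]
  nlinarith

lemma integrable_cosh_mul_exp {c : ℝ} (hc : 0 < c) :
    Integrable fun t => (1 + Real.cosh t) ^ 2 * Real.exp (-(c * Real.cosh t)) := by
  have h := (integrable_exp_neg_mul_sq (b := c / 4) (by positivity)).const_mul ((1 + 4 / c) ^ 2)
  refine Integrable.mono' h (Continuous.aestronglyMeasurable (by fun_prop)) ?_
  refine Eventually.of_forall fun t => ?_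
  have hct := (Real.cosh_pos t).le
  rw [Real.norm_eq_abs, abs_of_nonneg (by positivity)]
  refine (one_add_sq_mul_exp_le hc hct).trans ?_
  have := one_add_sq_le_cosh t
  gcongr
  nlinarith

lemma integrable_of_cosh_bound {E : Type*} [NormedAddCommGroup E] {c K : ℝ} (hc : 0 < c)
    {F : ℝ → E} (hF : Continuous F)
    (hb : ∀ t, ‖F t‖ ≤ K * ((1 + Real.cosh t) ^ 2 * Real.exp (-(c * Real.cosh t)))) :
    Integrable F :=
  Integrable.mono' ((integrable_cosh_mul_exp hc).const_mul K) hF.aestronglyMeasurable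
    (Eventually.of_forall hb)

lemma abs_sinh_le_cosh (t : ℝ) : |Real.sinh t| ≤ Real.cosh t := by
  rw [Real.abs_sinh]
  exact (Real.sinh_lt_cosh _).le.trans (Real.cosh_abs t).le

/-- This is `-ρ cosh (t - iθ)`, the exponent of the `K₀` integral on the line shifted by `-iθ`. -/
def macdonaldPhase (ρ θ t : ℝ) : ℂ :=
  -(ρ : ℂ) * (Real.cos θ * Real.cosh t - Complex.I * (Real.sin θ * Real.sinh t))

lemma macdonaldPhase_re (ρ θ t : ℝ) :
    (macdonaldPhase ρ θ t).re = -(ρ * Real.cos θ * Real.cosh t) := by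
  unfold macdonaldPhase
  simp only [neg_mul, Complex.neg_re, Complex.mul_re, Complex.sub_re, Complex.sub_im,
    Complex.ofReal_re, Complex.ofReal_im, Complex.I_re, Complex.I_im, Complex.mul_im]
  ring

/-- A contour shift carried out by differentiation in `θ`: the integrand depends on `t - iθ` only,
so its `θ`-derivative is the `t`-derivative of `-i` times itself. The integral of that derivative
vanishes because the integrand decays at both ends while `cos θ > 0`. -/
lemma integral_macdonaldPhase_eq {ρ θ : ℝ} (hρ : 0 < ρ)
    (hθ : θ ∈ Ioo (-(Real.pi / 2)) (Real.pi / 2)) :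
    ∫ t : ℝ, Complex.exp (macdonaldPhase ρ θ t) =
      ∫ t : ℝ, Complex.exp (macdonaldPhase ρ 0 t) := by
  set F' : ℝ → ℝ → ℂ := fun θ t => (ρ : ℂ) * (Real.sin θ * Real.cosh t
    + Complex.I * (Real.cos θ * Real.sinh t)) * Complex.exp (macdonaldPhase ρ θ t) with hF'
  have hF'c : ∀ θ, Continuous (F' θ) := fun θ => by
    simp only [hF', macdonaldPhase]; fun_prop
  have hFc : ∀ θ, Continuous fun t => Complex.exp (macdonaldPhase ρ θ t) := fun θ => by
    simp only [macdonaldPhase]; fun_prop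
  have hF'b : ∀ θ c t, c ≤ Real.cos θ → ‖F' θ t‖ ≤
      (2 * ρ) * ((1 + Real.cosh t) ^ 2 * Real.exp (-(ρ * c * Real.cosh t))) := by
    intro θ c t hc
    have hct := Real.cosh_pos t
    rw [hF', norm_mul, norm_mul, Complex.norm_exp, macdonaldPhase_re, Complex.norm_real,
      Real.norm_eq_abs, abs_of_pos hρ, mul_comm 2 ρ, mul_assoc ρ 2, mul_assoc ρ, ← mul_assoc 2]
    have h1 : ‖(Real.sin θ * Real.cosh t + Complex.I * (Real.cos θ * Real.sinh t) : ℂ)‖ ≤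
        2 * (1 + Real.cosh t) ^ 2 := by
      refine (norm_add_le _ _).trans ?_
      rw [norm_mul, norm_mul, norm_mul, Complex.norm_I, Complex.norm_real, Complex.norm_real,
        Complex.norm_real, Complex.norm_real, Real.norm_eq_abs, Real.norm_eq_abs, Real.norm_eq_abs,
        Real.norm_eq_abs, abs_of_pos hct]
      have a1 := Real.abs_sin_le_one θ
      have a2 := Real.abs_cos_le_one θ
      have a3 := abs_sinh_le_cosh t
      have a4 : |Real.sin θ| * Real.cosh t ≤ 1 * Real.cosh t := by gcongr
      have a5 : |Real.cos θ| * |Real.sinh t| ≤ 1 * Real.cosh t := by gcongr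
      nlinarith
    gcongr
  have hFb : ∀ θ t, ‖Complex.exp (macdonaldPhase ρ θ t)‖ ≤
      1 * ((1 + Real.cosh t) ^ 2 * Real.exp (-(ρ * Real.cos θ * Real.cosh t))) := by
    intro θ t
    have hct := Real.cosh_pos t
    rw [Complex.norm_exp, macdonaldPhase_re, one_mul]
    exact le_mul_of_one_le_left (Real.exp_pos _).le (by nlinarith)
  have hzero : ∀ θ ∈ Ioo (-(Real.pi / 2)) (Real.pi / 2), ∫ t, F' θ t = 0 := by
    intro θ hθ
    have hcos := Real.cos_pos_of_mem_Ioo hθ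
    have hd : ∀ t : ℝ, HasDerivAt (fun t : ℝ => -Complex.I * Complex.exp (macdonaldPhase ρ θ t))
        (F' θ t) t := by
      intro t
      have h := ((((Real.hasDerivAt_cosh t).ofReal_comp.const_mul (Real.cos θ : ℂ)).sub
        (((Real.hasDerivAt_sinh t).ofReal_comp.const_mul (Real.sin θ : ℂ)).const_mul
          Complex.I)).const_mul (-(ρ : ℂ))).cexp.const_mul (-Complex.I)
      refine h.congr_deriv ?_
      simp only [hF', macdonaldPhase]
      linear_combination (-(ρ : ℂ) * Real.sin θ * Real.cosh t * Complex.exp (-(ρ : ℂ) *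
        (Real.cos θ * Real.cosh t - Complex.I * (Real.sin θ * Real.sinh t)))) * Complex.I_sq
    have hlim : ∀ l : Filter ℝ, Tendsto (fun t : ℝ => t ^ 2) l atTop →
        Tendsto (fun t : ℝ => -Complex.I * Complex.exp (macdonaldPhase ρ θ t)) l (𝓝 0) := by
      intro l hl
      refine squeeze_zero_norm (a := fun t => Real.exp (-(ρ * Real.cos θ / 2 * t ^ 2)))
        (fun t => ?_) ?_
      · rw [norm_mul, norm_neg, Complex.norm_I, one_mul, Complex.norm_exp, macdonaldPhase_re]
        have := one_add_sq_le_cosh t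
        have h0 : 0 < ρ * Real.cos θ := by positivity
        refine Real.exp_le_exp.2 ?_
        nlinarith
      · exact Real.tendsto_exp_neg_atTop_nhds_zero.comp (hl.const_mul_atTop (by positivity))
    have hb := integral_of_hasDerivAt_of_tendsto hd
      (integrable_of_cosh_bound (c := ρ * Real.cos θ) (by positivity) (hF'c θ)
        (fun t => hF'b θ _ t le_rfl)) (hlim atBot ?_) (hlim atTop ?_)
    · simpa using hb
    · simpa [Function.comp_def] using
        (tendsto_pow_atTop (α := ℝ) two_ne_zero).comp tendsto_neg_atBot_atTop
    · exact tendsto_pow_atTop two_ne_zero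
  have hderiv : ∀ θ ∈ Ioo (-(Real.pi / 2)) (Real.pi / 2),
      HasDerivAt (fun θ => ∫ t : ℝ, Complex.exp (macdonaldPhase ρ θ t)) 0 θ := by
    intro θ hθ
    have hcos := Real.cos_pos_of_mem_Ioo hθ
    rw [← hzero θ hθ]
    refine (hasDerivAt_integral_of_dominated_loc_of_deriv_le
      (s := {θ' | Real.cos θ / 2 < Real.cos θ'})
      (F' := F')
      (bound := fun t => (2 * ρ) * ((1 + Real.cosh t) ^ 2 *
        Real.exp (-(ρ * (Real.cos θ / 2) * Real.cosh t)))) ?_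
      (Eventually.of_forall fun θ' => (hFc θ').aestronglyMeasurable)
      (integrable_of_cosh_bound (c := ρ * Real.cos θ) (by positivity) (hFc θ) (hFb θ))
      (hF'c θ).aestronglyMeasurable
      (Eventually.of_forall fun t θ' hθ' => hF'b θ' _ t (le_of_lt hθ'))
      ((integrable_cosh_mul_exp (by positivity)).const_mul _)
      (Eventually.of_forall fun t θ' _ => ?_)).2
    · exact (isOpen_lt continuous_const Real.continuous_cos).mem_nhds (half_lt_self hcos)
    · have h := ((((Real.hasDerivAt_cos θ').ofReal_comp.mul_const (Real.cosh t : ℂ)).sub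
        (((Real.hasDerivAt_sin θ').ofReal_comp.mul_const (Real.sinh t : ℂ)).const_mul
          Complex.I)).const_mul (-(ρ : ℂ))).cexp
      refine h.congr_deriv ?_
      simp only [hF', macdonaldPhase, Pi.sub_apply]
      push_cast
      ring
  have h0 : (0 : ℝ) ∈ Ioo (-(Real.pi / 2)) (Real.pi / 2) := by
    constructor <;> linarith [Real.pi_pos]
  exact (convex_Ioo (-(Real.pi / 2)) (Real.pi / 2)).is_const_of_fderivWithin_eq_zero (𝕜 := ℝ)
    (f := fun θ => ∫ t : ℝ, Complex.exp (macdonaldPhase ρ θ t))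
    (fun θ hθ => (hderiv θ hθ).differentiableAt.differentiableWithinAt) (fun θ hθ => by
      have := ((hderiv θ hθ).hasFDerivAt.hasFDerivWithinAt (s := Ioo _ _)).fderivWithin
        ((isOpen_Ioo).uniqueDiffWithinAt hθ)
      rw [this]
      ext; simp) hθ h0

/-- Integrand obtained by pairing the two evanescent branches `ξ = ±k cosh t` of the plane-wave
integral, for a point at distance `ρ / k` and polar angle `θ`. -/
def sommerfeldTail (ρ θ t : ℝ) : ℝ :=
  Real.cos (ρ * Real.sin θ * Real.cosh t) * Real.exp (-(ρ * Real.cos θ * Real.sinh t))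

/-- The `θ`-derivative of the integrand is the `t`-derivative of `sin (ρ sin θ cosh t) e^{-ρ cos θ
sinh t}`; the boundary term at `t = 0` remains. -/
lemma hasDerivAt_integral_sommerfeldTail {ρ θ : ℝ} (hρ : 0 < ρ)
    (hθ : θ ∈ Ioo (-(Real.pi / 2)) (Real.pi / 2)) :
    HasDerivAt (fun θ => ∫ t in Ioi (0 : ℝ), sommerfeldTail ρ θ t) (-Real.sin (ρ * Real.sin θ)) θ := by
  set F' : ℝ → ℝ → ℝ := fun θ t =>
    (ρ * Real.sin θ * Real.sinh t * Real.cos (ρ * Real.sin θ * Real.cosh t)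
      - ρ * Real.cos θ * Real.cosh t * Real.sin (ρ * Real.sin θ * Real.cosh t))
      * Real.exp (-(ρ * Real.cos θ * Real.sinh t)) with hF'
  have hF'c : ∀ θ, Continuous (F' θ) := fun θ => by simp only [hF']; fun_prop
  have hFc : ∀ θ, Continuous (sommerfeldTail ρ θ) := fun θ => by
    unfold sommerfeldTail; fun_prop
  have hF'b : ∀ θ c t, 0 < t → c ≤ Real.cos θ → ‖F' θ t‖ ≤
      (2 * ρ) * ((1 + Real.sinh t) ^ 2 * Real.exp (-(ρ * c * Real.sinh t))) := by
    intro θ c t ht hc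
    have hs := sinh_nonneg' ht.le
    have hch := cosh_le_one_add_sinh ht.le
    have hcp := (Real.cosh_pos t)
    rw [hF', norm_mul, Real.norm_eq_abs, Real.norm_eq_abs, Real.abs_exp, ← mul_assoc]
    have h1 : |ρ * Real.sin θ * Real.sinh t * Real.cos (ρ * Real.sin θ * Real.cosh t)
      - ρ * Real.cos θ * Real.cosh t * Real.sin (ρ * Real.sin θ * Real.cosh t)| ≤
        2 * ρ * (1 + Real.sinh t) ^ 2 := by
      refine (abs_sub _ _).trans ?_
      rw [abs_mul, abs_mul, abs_mul, abs_mul, abs_mul, abs_mul, abs_of_pos hρ, abs_of_nonneg hs,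
        abs_of_pos hcp]
      have a1 : ρ * |Real.sin θ| * Real.sinh t * |Real.cos (ρ * Real.sin θ * Real.cosh t)| ≤
          ρ * 1 * Real.sinh t * 1 := by
        gcongr
        · exact Real.abs_sin_le_one θ
        · exact Real.abs_cos_le_one _
      have a2 : ρ * |Real.cos θ| * Real.cosh t * |Real.sin (ρ * Real.sin θ * Real.cosh t)| ≤
          ρ * 1 * (1 + Real.sinh t) * 1 := by
        gcongr
        · exact Real.abs_cos_le_one θ
        · exact Real.abs_sin_le_one _
      have a3 : Real.sinh t + (1 + Real.sinh t) ≤ 2 * (1 + Real.sinh t) ^ 2 := by nlinarith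
      nlinarith
    gcongr
  have hFb : ∀ θ t, 0 < t → ‖sommerfeldTail ρ θ t‖ ≤
      1 * ((1 + Real.sinh t) ^ 2 * Real.exp (-(ρ * Real.cos θ * Real.sinh t))) := by
    intro θ t ht
    have hs := sinh_nonneg' ht.le
    unfold sommerfeldTail
    rw [norm_mul, Real.norm_eq_abs, Real.norm_eq_abs, Real.abs_exp, one_mul]
    gcongr
    refine (Real.abs_cos_le_one _).trans ?_
    nlinarith
  have hcos := Real.cos_pos_of_mem_Ioo hθ
  have hval : ∫ t in Ioi (0 : ℝ), F' θ t = -Real.sin (ρ * Real.sin θ) := by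
    have hd : ∀ t : ℝ, HasDerivAt (fun t : ℝ => Real.sin (ρ * Real.sin θ * Real.cosh t) *
        Real.exp (-(ρ * Real.cos θ * Real.sinh t))) (F' θ t) t := by
      intro t
      have h := ((Real.hasDerivAt_cosh t).const_mul (ρ * Real.sin θ)).sin.mul
        ((Real.hasDerivAt_sinh t).const_mul (ρ * Real.cos θ)).neg.exp
      refine h.congr_deriv ?_
      simp only [hF', Pi.neg_apply]
      ring
    rw [integral_Ioi_of_hasDerivAt_of_tendsto' (m := 0) (fun t _ => hd t)
      (integrableOn_sinh_of_bound (c := ρ * Real.cos θ) (by positivity) (hF'c θ)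
        (fun t ht => hF'b θ _ t ht le_rfl))]
    · simp
    · refine squeeze_zero_norm' ?_ (tendsto_sinh_bound (c := ρ * Real.cos θ) (by positivity))
      filter_upwards [eventually_ge_atTop 0] with t ht
      have hs := sinh_nonneg' ht
      rw [norm_mul, Real.norm_eq_abs, Real.norm_eq_abs, Real.abs_exp]
      gcongr
      refine (Real.abs_sin_le_one _).trans ?_
      nlinarith
  rw [← hval]
  refine (hasDerivAt_integral_of_dominated_loc_of_deriv_le
    (s := {θ' | Real.cos θ / 2 < Real.cos θ'}) (F := fun θ t => sommerfeldTail ρ θ t)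
    (F' := F')
    (bound := fun t => (2 * ρ) * ((1 + Real.sinh t) ^ 2 *
      Real.exp (-(ρ * (Real.cos θ / 2) * Real.sinh t)))) ?_
    (Eventually.of_forall fun θ' => (hFc θ').aestronglyMeasurable)
    (integrableOn_sinh_of_bound (c := ρ * Real.cos θ) (by positivity) (hFc θ) (hFb θ))
    (hF'c θ).aestronglyMeasurable
    ((ae_restrict_iff' measurableSet_Ioi).2
      (Eventually.of_forall fun t ht θ' hθ' => hF'b θ' _ t ht (le_of_lt hθ')))
    ((integrableOn_one_add_sinh_sq (by positivity)).const_mul _)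
    (Eventually.of_forall fun t θ' _ => ?_)).2
  · exact (isOpen_lt continuous_const Real.continuous_cos).mem_nhds (half_lt_self hcos)
  · have h := (((Real.hasDerivAt_sin θ').const_mul ρ).mul_const (Real.cosh t)).cos.mul
      (((Real.hasDerivAt_cos θ').const_mul ρ).mul_const (Real.sinh t)).neg.exp
    refine h.congr_deriv ?_
    simp only [hF', Pi.neg_apply]
    ring

/-- After the change of variable `u = φ - θ` only the endpoints depend on `θ`. Their contribution is
exactly opposite to that of `-2i` times the evanescent tail. -/
lemma hasDerivAt_integral_cos_sub (ρ θ : ℝ) :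
    HasDerivAt (fun θ => ∫ φ in (-(Real.pi / 2))..(Real.pi / 2),
      Complex.exp (Complex.I * (ρ * Real.cos (φ - θ) : ℝ)))
      (-2 * Complex.I * (Real.sin (ρ * Real.sin θ) : ℝ)) θ := by
  set g : ℝ → ℂ := fun u => Complex.exp (Complex.I * (ρ * Real.cos u : ℝ)) with hg
  have hgc : Continuous g := by simp only [hg]; fun_prop
  have h1 : (fun θ => ∫ φ in (-(Real.pi / 2))..(Real.pi / 2),
      Complex.exp (Complex.I * (ρ * Real.cos (φ - θ) : ℝ))) =
      fun θ => (∫ u in (0 : ℝ)..(Real.pi / 2 - θ), g u) - ∫ u in (0 : ℝ)..(-(Real.pi / 2) - θ), g u := by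
    funext θ
    rw [intervalIntegral.integral_interval_sub_left (hgc.intervalIntegrable _ _)
      (hgc.intervalIntegrable _ _)]
    exact intervalIntegral.integral_comp_sub_right g θ
  rw [h1]
  have h2 : ∀ u, HasDerivAt (fun v => ∫ u in (0 : ℝ)..v, g u) (g u) u := fun u =>
    intervalIntegral.integral_hasDerivAt_right (hgc.intervalIntegrable _ _)
      (hgc.stronglyMeasurableAtFilter _ _) hgc.continuousAt
  have h3 := ((h2 (Real.pi / 2 - θ)).scomp θ ((hasDerivAt_id θ).const_sub (Real.pi / 2))).sub
    ((h2 (-(Real.pi / 2) - θ)).scomp θ ((hasDerivAt_id θ).const_sub (-(Real.pi / 2))))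
  refine h3.congr_deriv ?_
  have e1 : Real.cos (Real.pi / 2 - θ) = Real.sin θ := Real.cos_pi_div_two_sub θ
  have e2 : Real.cos (-(Real.pi / 2) - θ) = -Real.sin θ := by
    rw [← Real.cos_neg, neg_sub, sub_neg_eq_add, Real.cos_add_pi_div_two]
  simp only [hg, e1, e2, neg_smul, one_smul]
  rw [Complex.ofReal_sin, Complex.sin]
  push_cast
  have e3 : Complex.exp (Complex.I * (↑ρ * -Complex.sin ↑θ)) =
    Complex.exp (-(↑ρ * Complex.sin ↑θ) * Complex.I) := by congr 1; ring
  have e4 : Complex.exp (Complex.I * (↑ρ * Complex.sin ↑θ)) =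
    Complex.exp ((↑ρ * Complex.sin ↑θ) * Complex.I) := by congr 1; ring
  rw [e3, e4]
  linear_combination (Complex.exp (-(↑ρ * Complex.sin ↑θ) * Complex.I) -
    Complex.exp ((↑ρ * Complex.sin ↑θ) * Complex.I)) * Complex.I_sq

/-- The expression is constant in `θ`, because the propagating and evanescent derivatives cancel,
and at `θ = 0` it is the Poisson and Mehler-Sonine formula. -/
lemma sommerfeld_eq_hankelH0 {ρ θ : ℝ} (hρ : 0 < ρ)
    (hθ : θ ∈ Ioo (-(Real.pi / 2)) (Real.pi / 2)) :
    (∫ φ in (-(Real.pi / 2))..(Real.pi / 2), Complex.exp (Complex.I * (ρ * Real.cos (φ - θ) : ℝ)))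
      - 2 * Complex.I * (∫ t in Ioi (0 : ℝ), sommerfeldTail ρ θ t : ℝ) = Real.pi * hankelH0 ρ := by
  have hderiv : ∀ θ ∈ Ioo (-(Real.pi / 2)) (Real.pi / 2), HasDerivAt (fun θ =>
      (∫ φ in (-(Real.pi / 2))..(Real.pi / 2), Complex.exp (Complex.I * (ρ * Real.cos (φ - θ) : ℝ)))
      - 2 * Complex.I * (∫ t in Ioi (0 : ℝ), sommerfeldTail ρ θ t : ℝ)) 0 θ := by
    intro θ hθ
    have h := (hasDerivAt_integral_cos_sub ρ θ).sub
      ((hasDerivAt_integral_sommerfeldTail hρ hθ).ofReal_comp.const_mul (2 * Complex.I))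
    refine h.congr_deriv ?_
    push_cast
    ring
  have h0 : (0 : ℝ) ∈ Ioo (-(Real.pi / 2)) (Real.pi / 2) := by
    constructor <;> linarith [Real.pi_pos]
  have hconst := (convex_Ioo (-(Real.pi / 2)) (Real.pi / 2)).is_const_of_fderivWithin_eq_zero (𝕜 := ℝ)
    (f := fun θ => (∫ φ in (-(Real.pi / 2))..(Real.pi / 2),
        Complex.exp (Complex.I * (ρ * Real.cos (φ - θ) : ℝ)))
      - 2 * Complex.I * (∫ t in Ioi (0 : ℝ), sommerfeldTail ρ θ t : ℝ))
    (fun θ hθ => (hderiv θ hθ).differentiableAt.differentiableWithinAt) (fun θ hθ => by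
      have := ((hderiv θ hθ).hasFDerivAt.hasFDerivWithinAt (s := Ioo _ _)).fderivWithin
        ((isOpen_Ioo).uniqueDiffWithinAt hθ)
      rw [this]
      ext; simp) hθ h0
  rw [hconst, hankelH0_eq_integral hρ]
  have hpi : (Real.pi : ℂ) ≠ 0 := by exact_mod_cast Real.pi_ne_zero
  have e1 : (∫ t in Ioi (0 : ℝ), sommerfeldTail ρ 0 t) = sinhIntegral ρ := by
    simp [sommerfeldTail, sinhIntegral]
  have e2 : (∫ φ in (-(Real.pi / 2))..(Real.pi / 2),
      Complex.exp (Complex.I * (ρ * Real.cos (φ - 0) : ℝ))) = 2 * cosIntegral ρ := by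
    simp only [sub_zero, cosIntegral]
    have hc : Continuous fun φ : ℝ => Complex.exp (Complex.I * (ρ * Real.cos φ : ℝ)) := by fun_prop
    rw [← intervalIntegral.integral_add_adjacent_intervals (b := 0)
      (hc.intervalIntegrable _ _) (hc.intervalIntegrable _ _)]
    have h := intervalIntegral.integral_comp_neg (a := 0) (b := Real.pi / 2)
      (fun φ : ℝ => Complex.exp (Complex.I * (ρ * Real.cos φ : ℝ)))
    simp only [Real.cos_neg, neg_zero] at h
    rw [← h]
    ring
  rw [e1, e2]
  field_simp


/-! ### Spectral densities -/

/-- The exponent `√(ξ² - k²)` with the outgoing branch `-i √(k² - ξ²)` for `|ξ| < k`. -/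
def decay (k ξ : ℝ) : ℂ := (√(ξ ^ 2 - k ^ 2) : ℝ) - Complex.I * (√(k ^ 2 - ξ ^ 2) : ℝ)

def decayI (k ξ : ℝ) : ℝ := √(ξ ^ 2 + k ^ 2)

/-- The bounded fundamental solution `e^{-ζ a} / (2 ζ)` of `g'' = ζ² g` at distance `a`. -/
def profile (a : ℝ) (ζ : ℂ) : ℂ := Complex.exp (-(ζ * a)) / (2 * ζ)

/-- At `a = 0` each profile decays only like `1 / (2|ξ|)`; the subtraction removes this leading term
and makes the density integrable up to and including `a = 0`. -/
def profileDiff (k a ξ : ℝ) : ℂ := profile a (decay k ξ) - profile a (decayI k ξ)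

lemma decay_of_lt {k ξ : ℝ} (h : |ξ| < k) : decay k ξ = -Complex.I * (√(k ^ 2 - ξ ^ 2) : ℝ) := by
  have : ξ ^ 2 - k ^ 2 ≤ 0 := by
    have := sq_lt_sq' (by linarith [neg_abs_le ξ]) ((le_abs_self ξ).trans_lt h)
    linarith
  simp [decay, Real.sqrt_eq_zero_of_nonpos this]

lemma decay_of_gt {k ξ : ℝ} (hk : 0 < k) (h : k < |ξ|) : decay k ξ = (√(ξ ^ 2 - k ^ 2) : ℝ) := by
  have : k ^ 2 - ξ ^ 2 ≤ 0 := by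
    have h1 := sq_lt_sq' (by linarith [abs_nonneg ξ]) h
    rw [sq_abs] at h1
    linarith
  simp [decay, Real.sqrt_eq_zero_of_nonpos this]

lemma sq_lt_sq_of_abs_lt {k ξ : ℝ} (h : |ξ| < k) : ξ ^ 2 < k ^ 2 :=
  sq_lt_sq' (by linarith [neg_abs_le ξ]) ((le_abs_self ξ).trans_lt h)

lemma sq_lt_sq_of_lt_abs {k ξ : ℝ} (hk : 0 < k) (h : k < |ξ|) : k ^ 2 < ξ ^ 2 := by
  have h1 := sq_lt_sq' (by linarith [abs_nonneg ξ]) h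
  rwa [sq_abs] at h1

lemma decay_sq (k ξ : ℝ) : decay k ξ ^ 2 = ((ξ ^ 2 - k ^ 2 : ℝ) : ℂ) := by
  rcases le_total (ξ ^ 2) (k ^ 2) with h | h
  · have h1 : √(ξ ^ 2 - k ^ 2) = 0 := Real.sqrt_eq_zero_of_nonpos (by linarith)
    rw [decay, h1, Complex.ofReal_zero, zero_sub, neg_sq, mul_pow, Complex.I_sq,
      ← Complex.ofReal_pow, Real.sq_sqrt (by linarith)]
    push_cast; ring
  · have h1 : √(k ^ 2 - ξ ^ 2) = 0 := Real.sqrt_eq_zero_of_nonpos (by linarith)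
    rw [decay, h1, Complex.ofReal_zero, mul_zero, sub_zero,
      ← Complex.ofReal_pow, Real.sq_sqrt (by linarith)]

lemma norm_decay_sq (k ξ : ℝ) : ‖decay k ξ‖ ^ 2 = |ξ ^ 2 - k ^ 2| := by
  rw [← norm_pow, decay_sq, Complex.norm_real, Real.norm_eq_abs]

lemma norm_decay (k ξ : ℝ) : ‖decay k ξ‖ = √|ξ ^ 2 - k ^ 2| := by
  rw [← norm_decay_sq, Real.sqrt_sq (norm_nonneg _)]

lemma decay_re_nonneg (k ξ : ℝ) : 0 ≤ (decay k ξ).re := by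
  simp [decay]

lemma decay_ne_zero {k ξ : ℝ} (h : |ξ| ≠ k) (hk : 0 < k) : decay k ξ ≠ 0 := by
  intro h0
  have h1 := decay_sq k ξ
  rw [h0] at h1
  have h2 : ξ ^ 2 - k ^ 2 = 0 := by
    have : ((ξ ^ 2 - k ^ 2 : ℝ) : ℂ) = 0 := by rw [← h1]; simp
    exact_mod_cast this
  apply h
  have h3 : |ξ| ^ 2 = k ^ 2 := by rw [sq_abs]; linarith
  exact (pow_left_inj₀ (abs_nonneg ξ) hk.le two_ne_zero).1 h3

lemma continuous_decay (k : ℝ) : Continuous (decay k) := by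
  unfold decay; fun_prop

lemma continuous_decayI (k : ℝ) : Continuous (decayI k) := by
  unfold decayI; fun_prop

lemma decayI_pos {k : ℝ} (hk : 0 < k) (ξ : ℝ) : 0 < decayI k ξ := by
  unfold decayI; positivity

lemma decayI_sq (k ξ : ℝ) : decayI k ξ ^ 2 = ξ ^ 2 + k ^ 2 :=
  Real.sq_sqrt (by positivity)

lemma le_decayI (k ξ : ℝ) : k ≤ decayI k ξ :=
  Real.le_sqrt_of_sq_le (by nlinarith [sq_nonneg ξ])

lemma abs_le_decayI (k ξ : ℝ) : |ξ| ≤ decayI k ξ := by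
  refine Real.le_sqrt_of_sq_le ?_
  rw [sq_abs]
  nlinarith [sq_nonneg k]

lemma measurable_profile_decay (k a : ℝ) : Measurable fun ξ => profile a (decay k ξ) := by
  have := (continuous_decay k).measurable
  unfold profile
  fun_prop

lemma continuous_profile_decayI {k : ℝ} (hk : 0 < k) (a : ℝ) :
    Continuous fun ξ => profile a (decayI k ξ) := by
  have := continuous_decayI k
  unfold profile
  refine Continuous.div (by fun_prop) (by fun_prop) (fun ξ => ?_)
  have := decayI_pos hk ξ
  simp [this.ne']

lemma measurable_profileDiff {k : ℝ} (hk : 0 < k) (a : ℝ) : Measurable (profileDiff k a) :=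
  (measurable_profile_decay k a).sub (continuous_profile_decayI hk a).measurable

lemma norm_profile_le {a : ℝ} (ha : 0 ≤ a) {ζ : ℂ} (hζ : 0 ≤ ζ.re) :
    ‖profile a ζ‖ ≤ 1 / (2 * ‖ζ‖) := by
  unfold profile
  rw [norm_div, norm_mul, Complex.norm_exp]
  have h : Real.exp (-(ζ * a)).re ≤ 1 := by
    rw [Real.exp_le_one_iff]
    simp only [Complex.neg_re, Complex.mul_re, Complex.ofReal_re, Complex.ofReal_im]
    have := mul_nonneg hζ ha
    linarith
  simp only [Complex.norm_ofNat]
  gcongr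

/-- The bound has to be independent of `a`. For `|ξ| < k` each profile is estimated separately. For
`|ξ| > k`, with the real exponents `c < s`, the difference is at most its value `(s - c) / (2 c s)`
at `a = 0`, and `s² - c² = 2 k²` supplies the gain. -/
lemma norm_profileDiff_le {k a ξ : ℝ} (hk : 0 < k) (ha : 0 ≤ a) (h : |ξ| ≠ k) :
    ‖profileDiff k a ξ‖ ≤ 2 * k ^ 2 / (‖decay k ξ‖ * (ξ ^ 2 + k ^ 2)) := by
  have hs := decayI_pos hk ξ
  have hks := le_decayI k ξ
  have hs2 := decayI_sq k ξ
  rw [← hs2]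
  have hd : 0 < ‖decay k ξ‖ := norm_pos_iff.2 (decay_ne_zero h hk)
  rcases lt_or_gt_of_ne h with h | h
  · have h1 := norm_profile_le ha (decay_re_nonneg k ξ)
    have h2 : ‖profile a (decayI k ξ)‖ ≤ 1 / (2 * decayI k ξ) := by
      have := norm_profile_le ha (ζ := (decayI k ξ : ℂ)) (by simpa using hs.le)
      rwa [Complex.norm_real, Real.norm_eq_abs, abs_of_pos hs] at this
    have h3 : ‖decay k ξ‖ ≤ k := by
      have := norm_decay_sq k ξ
      have h5 := sq_lt_sq_of_abs_lt h
      rw [abs_of_nonpos (by linarith)] at this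
      nlinarith [sq_nonneg ξ, norm_nonneg (decay k ξ)]
    have h4 : decayI k ξ ^ 2 ≤ 2 * k ^ 2 := by
      have h5 := sq_lt_sq_of_abs_lt h
      linarith
    have h6 : 1 / (2 * decayI k ξ) ≤ 1 / (2 * ‖decay k ξ‖) := by gcongr; linarith
    calc ‖profileDiff k a ξ‖ ≤ 1 / (2 * ‖decay k ξ‖) + 1 / (2 * ‖decay k ξ‖) :=
          (norm_sub_le _ _).trans (by linarith)
      _ = 1 / ‖decay k ξ‖ := by field_simp; norm_num
      _ ≤ _ := by
        rw [div_le_div_iff₀ hd (by positivity)]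
        nlinarith
  · have h1 := sq_lt_sq_of_lt_abs hk h
    set c := √(ξ ^ 2 - k ^ 2) with hc
    have hcp : 0 < c := Real.sqrt_pos.2 (by linarith)
    have hc2 : c ^ 2 = ξ ^ 2 - k ^ 2 := Real.sq_sqrt (by linarith)
    set s := decayI k ξ with hsdef
    have hdc : decay k ξ = (c : ℂ) := decay_of_gt hk h
    have hcs : c < s := by nlinarith
    have hval : profileDiff k a ξ =
        ((Real.exp (-(c * a)) / (2 * c) - Real.exp (-(s * a)) / (2 * s) : ℝ) : ℂ) := by
      unfold profileDiff profile
      rw [hdc]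
      push_cast
      rfl
    rw [hval, hdc, Complex.norm_real, Complex.norm_real, Real.norm_eq_abs, Real.norm_eq_abs,
      abs_of_pos hcp]
    have hE : Real.exp (-(s * a)) ≤ Real.exp (-(c * a)) := by gcongr
    have hpos : 0 ≤ Real.exp (-(c * a)) / (2 * c) - Real.exp (-(s * a)) / (2 * s) := by
      rw [sub_nonneg]
      gcongr
    rw [abs_of_nonneg hpos]
    have hE2 : Real.exp (-(c * a)) * (1 - a * (s - c)) ≤ Real.exp (-(s * a)) := by
      have : Real.exp (-(s * a)) = Real.exp (-(c * a)) * Real.exp (-(a * (s - c))) := by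
        rw [← Real.exp_add]; congr 1; ring
      rw [this]
      gcongr
      have := Real.add_one_le_exp (-(a * (s - c)))
      linarith
    have hE3 : Real.exp (-(c * a)) * (1 + a * c) ≤ 1 := by
      have h5 := Real.add_one_le_exp (c * a)
      have h6 : Real.exp (-(c * a)) * Real.exp (c * a) = 1 := by
        rw [← Real.exp_add]; simp
      have : 0 < Real.exp (-(c * a)) := Real.exp_pos _
      nlinarith
    -- Combining the two convexity bounds gives `s e^{-ca} - c e^{-sa} ≤ (s - c) e^{-ca} (1 + a c) ≤
    -- s - c`.
    have hstep : Real.exp (-(c * a)) / (2 * c) - Real.exp (-(s * a)) / (2 * s) ≤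
        (s - c) / (2 * c * s) := by
      have e1 : Real.exp (-(c * a)) / (2 * c) - Real.exp (-(s * a)) / (2 * s) =
        (s * Real.exp (-(c * a)) - c * Real.exp (-(s * a))) / (2 * c * s) := by
        field_simp
      rw [e1]
      refine div_le_div_of_nonneg_right ?_ (by positivity)
      nlinarith [mul_le_mul_of_nonneg_left hE2 hcp.le,
        mul_le_mul_of_nonneg_left hE3 (by linarith : 0 ≤ s - c)]
    refine hstep.trans ?_
    rw [div_le_div_iff₀ (by positivity) (by positivity)]
    have h7 : (s - c) * (s + c) = 2 * k ^ 2 := by nlinarith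
    have h8 : (s - c) * s ≤ 2 * k ^ 2 := by nlinarith
    calc (s - c) * (c * s ^ 2) = ((s - c) * s) * (c * s) := by ring
      _ ≤ (2 * k ^ 2) * (c * s) := by gcongr
      _ ≤ _ := by nlinarith [mul_pos (mul_pos hcp hs) (pow_pos hk 2)]

/-! ### Integrability of the densities -/

lemma integrable_inv_sq_add_sq {k : ℝ} (hk : 0 < k) : Integrable fun ξ : ℝ => (ξ ^ 2 + k ^ 2)⁻¹ := by
  refine Integrable.mono' (integrable_inv_one_add_sq.const_mul (1 + 1 / k ^ 2))
    (Measurable.aestronglyMeasurable (by fun_prop)) (Eventually.of_forall fun ξ => ?_)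
  rw [Real.norm_eq_abs, abs_of_nonneg (by positivity), ← div_eq_mul_inv,
    inv_le_iff_one_le_mul₀ (by positivity)]
  rw [div_mul_eq_mul_div, le_div_iff₀ (by positivity)]
  have h1 : k ^ 2 * (1 / k ^ 2) = 1 := by field_simp
  have h2 : 0 ≤ ξ ^ 2 * (1 / k ^ 2) := by positivity
  nlinarith

lemma integrable_indicator_abs_rpow (c : ℝ) :
    Integrable ((Icc (c - 1) (c + 1)).indicator fun ξ : ℝ => (√|ξ - c|)⁻¹) := by
  rw [integrable_indicator_iff measurableSet_Icc]
  have h0 : IntervalIntegrable (fun u : ℝ => (√|u|)⁻¹) volume 0 1 := by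
    have h := intervalIntegral.intervalIntegrable_rpow' (a := 0) (b := 1) (r := -(1 / 2))
      (by norm_num)
    refine h.congr ?_
    intro u hu
    rw [uIoc_of_le zero_le_one] at hu
    simp only
    rw [abs_of_pos hu.1, Real.sqrt_eq_rpow, Real.rpow_neg hu.1.le]
  have h1 : IntervalIntegrable (fun u : ℝ => (√|u|)⁻¹) volume (-1) 0 := by
    have := (IntervalIntegrable.iff_comp_neg (f := fun u : ℝ => (√|u|)⁻¹) (a := 0) (b := 1)).1 h0
    simpa using this.symm
  have h2 := (h1.trans h0).comp_sub_right c
  rw [intervalIntegrable_iff_integrableOn_Icc_of_le (by linarith)] at h2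
  rw [show c - 1 = -1 + c by ring, show c + 1 = 1 + c by ring]
  exact h2

/-- Majorant of `profileDiff` uniform in `a ≥ 0`. Its singularities at `±k` are of inverse square
root type, hence integrable. -/
def profileBound (k ξ : ℝ) : ℝ := 2 * k ^ 2 / (‖decay k ξ‖ * (ξ ^ 2 + k ^ 2))

lemma inv_sqrt_abs_le (u c : ℝ) :
    (√|u - c|)⁻¹ ≤ 1 + (Icc (c - 1) (c + 1)).indicator (fun ξ : ℝ => (√|ξ - c|)⁻¹) u := by
  by_cases h : u ∈ Icc (c - 1) (c + 1)
  · rw [indicator_of_mem h]; linarith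
  · rw [indicator_of_notMem h, add_zero]
    refine inv_le_one_of_one_le₀ ?_
    rw [Real.one_le_sqrt]
    by_contra! h1
    rw [abs_lt] at h1
    exact h ⟨by linarith, by linarith⟩

/-- In `|ξ² - k²| = |ξ - k| |ξ + k|` the factor belonging to the farther of the two points `±k` is
at least `k`, so only one singular factor remains. -/
lemma inv_norm_decay_le {k : ℝ} (hk : 0 < k) (ξ : ℝ) :
    ‖decay k ξ‖⁻¹ ≤ (√k)⁻¹ * ((√|ξ - k|)⁻¹ + (√|ξ - -k|)⁻¹) := by
  have h1 : ‖decay k ξ‖ = √|ξ - k| * √|ξ - -k| := by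
    rw [norm_decay, ← Real.sqrt_mul (abs_nonneg _), ← abs_mul]
    congr 2; ring
  rw [h1, mul_inv]
  have hA : 0 ≤ (√|ξ - k|)⁻¹ := by positivity
  have hB : 0 ≤ (√|ξ - -k|)⁻¹ := by positivity
  have hkk : 0 ≤ (√k)⁻¹ := by positivity
  have hle : ∀ x : ℝ, k ≤ x → (√x)⁻¹ ≤ (√k)⁻¹ := fun x hx => by
    gcongr
  rcases le_total 0 ξ with h | h
  · have : (√|ξ - -k|)⁻¹ ≤ (√k)⁻¹ := hle _ (by rw [abs_of_nonneg (by linarith)]; linarith)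
    nlinarith [mul_le_mul_of_nonneg_left this hA, mul_nonneg hkk hB]
  · have : (√|ξ - k|)⁻¹ ≤ (√k)⁻¹ := hle _ (by rw [abs_of_nonpos (by linarith)]; linarith)
    nlinarith [mul_le_mul_of_nonneg_left this hB, mul_nonneg hkk hA]

lemma integrable_profileBound {k : ℝ} (hk : 0 < k) : Integrable (profileBound k) := by
  have hi := integrable_inv_sq_add_sq hk
  have h1 := integrable_indicator_abs_rpow k
  have h2 := integrable_indicator_abs_rpow (-k)
  refine Integrable.mono' (((hi.const_mul (2 * k ^ 2)).add (h1.add h2)).const_mul (2 * (√k)⁻¹)) ?_ ?_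
  · have := (continuous_decay k).measurable
    unfold profileBound
    exact Measurable.aestronglyMeasurable (by fun_prop)
  · refine Eventually.of_forall fun ξ => ?_
    have hb := inv_norm_decay_le hk ξ
    have b1 := inv_sqrt_abs_le ξ k
    have b2 := inv_sqrt_abs_le ξ (-k)
    simp only [Pi.add_apply]
    set i1 := (Icc (k - 1) (k + 1)).indicator (fun ξ : ℝ => (√|ξ - k|)⁻¹) ξ with hi1
    set i2 := (Icc (-k - 1) (-k + 1)).indicator (fun ξ : ℝ => (√|ξ - -k|)⁻¹) ξ with hi2
    have p1 : 0 ≤ i1 := indicator_nonneg (fun _ _ => by positivity) _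
    have p2 : 0 ≤ i2 := indicator_nonneg (fun _ _ => by positivity) _
    have hle1 : 2 * k ^ 2 * (ξ ^ 2 + k ^ 2)⁻¹ ≤ 2 := by
      rw [← div_eq_mul_inv, div_le_iff₀ (by positivity)]
      nlinarith [sq_nonneg ξ]
    have hpos : 0 ≤ 2 * k ^ 2 * (ξ ^ 2 + k ^ 2)⁻¹ := by positivity
    have hkk : 0 ≤ (√k)⁻¹ := by positivity
    unfold profileBound
    rw [Real.norm_eq_abs, abs_of_nonneg (by positivity)]
    calc 2 * k ^ 2 / (‖decay k ξ‖ * (ξ ^ 2 + k ^ 2))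
        = (2 * k ^ 2 * (ξ ^ 2 + k ^ 2)⁻¹) * ‖decay k ξ‖⁻¹ := by
          rw [div_eq_mul_inv, mul_inv]; ring
      _ ≤ (2 * k ^ 2 * (ξ ^ 2 + k ^ 2)⁻¹) * ((√k)⁻¹ * ((1 + i1) + (1 + i2))) := by
          gcongr
          exact hb.trans (mul_le_mul_of_nonneg_left (by linarith) hkk)
      _ = (√k)⁻¹ * (2 * (2 * k ^ 2 * (ξ ^ 2 + k ^ 2)⁻¹) +
          (2 * k ^ 2 * (ξ ^ 2 + k ^ 2)⁻¹) * (i1 + i2)) := by ring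
      _ ≤ (√k)⁻¹ * (2 * (2 * k ^ 2 * (ξ ^ 2 + k ^ 2)⁻¹) + 2 * (i1 + i2)) := by gcongr
      _ = _ := by ring

lemma ae_abs_ne (k : ℝ) : ∀ᵐ ξ : ℝ, |ξ| ≠ k := by
  have h : ({k, -k} : Set ℝ)ᶜ ∈ ae (volume : Measure ℝ) :=
    compl_mem_ae_iff.2 ((Set.toFinite _).measure_zero _)
  filter_upwards [h] with ξ hξ h1
  apply hξ
  rcases eq_or_eq_neg_of_abs_eq h1 with h2 | h2 <;> simp [h2]

lemma integrable_profileDiff {k a : ℝ} (hk : 0 < k) (ha : 0 ≤ a) :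
    Integrable (profileDiff k a) := by
  refine Integrable.mono' (integrable_profileBound hk) (measurable_profileDiff hk a).aestronglyMeasurable ?_
  filter_upwards [ae_abs_ne k] with ξ hξ using norm_profileDiff_le hk ha hξ

lemma norm_profile_decayI {k a ξ : ℝ} (hk : 0 < k) :
    ‖profile a (decayI k ξ)‖ = Real.exp (-(decayI k ξ * a)) / (2 * decayI k ξ) := by
  have hs := decayI_pos hk ξ
  unfold profile
  rw [norm_div, Complex.norm_exp, norm_mul, Complex.norm_real, Real.norm_eq_abs, abs_of_pos hs]
  simp [← Complex.ofReal_mul, ← Complex.ofReal_neg]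

lemma integrable_profile_decayI {k a : ℝ} (hk : 0 < k) (ha : 0 < a) :
    Integrable fun ξ => profile a (decayI k ξ) := by
  refine Integrable.mono' ((integrable_inv_sq_add_sq hk).const_mul (1 / (2 * a)))
    (continuous_profile_decayI hk a).aestronglyMeasurable (Eventually.of_forall fun ξ => ?_)
  have hs := decayI_pos hk ξ
  rw [norm_profile_decayI hk, ← decayI_sq]
  have h1 : Real.exp (-(decayI k ξ * a)) ≤ 1 / (decayI k ξ * a) := by
    rw [Real.exp_neg, ← one_div]
    gcongr
    linarith [Real.add_one_le_exp (decayI k ξ * a)]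
  calc Real.exp (-(decayI k ξ * a)) / (2 * decayI k ξ)
      ≤ 1 / (decayI k ξ * a) / (2 * decayI k ξ) := by gcongr
    _ = _ := by field_simp

lemma integrable_profile_decay {k a : ℝ} (hk : 0 < k) (ha : 0 < a) :
    Integrable fun ξ => profile a (decay k ξ) := by
  have h := (integrable_profileDiff hk ha.le).add (integrable_profile_decayI hk ha)
  refine h.congr (Eventually.of_forall fun ξ => ?_)
  simp [profileDiff]

lemma integrable_mul_exp_I {g : ℝ → ℂ} (hg : Integrable g) (z : ℝ) :
    Integrable fun ξ : ℝ => g ξ * Complex.exp (Complex.I * (ξ * z : ℝ)) := by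
  refine hg.mul_bdd (c := 1) (Continuous.aestronglyMeasurable (by fun_prop)) ?_
  refine Eventually.of_forall fun ξ => ?_
  rw [mul_comm, Complex.norm_exp_ofReal_mul_I]

/-! ### Derivatives of the densities -/

/-- Both exponents satisfy `ζ' = ξ / ζ`, because `ζ²` differs from `ξ²` by a constant; one formula
therefore serves `decay` and `decayI`. -/
lemma hasDerivAt_profile_comp {a ξ : ℝ} {ζ : ℝ → ℂ} (h0 : ζ ξ ≠ 0)
    (hζ : HasDerivAt ζ (ξ / ζ ξ) ξ) :
    HasDerivAt (fun ξ => profile a (ζ ξ))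
      (-(ξ * (Complex.exp (-(ζ ξ * a)) * (1 + a * ζ ξ)) / (2 * ζ ξ ^ 3))) ξ := by
  have h := ((hζ.mul_const (a : ℂ)).neg.cexp).div (hζ.const_mul 2) (by simpa using h0)
  refine h.congr_deriv ?_
  simp only [Pi.neg_apply]
  field_simp
  ring

lemma hasDerivAt_decayI {k : ℝ} (hk : 0 < k) (ξ : ℝ) :
    HasDerivAt (fun ξ => (decayI k ξ : ℂ)) (ξ / (decayI k ξ : ℂ)) ξ := by
  have h := (((hasDerivAt_pow 2 ξ).add_const (k ^ 2)).sqrt (by positivity)).ofReal_comp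
  refine h.congr_deriv ?_
  unfold decayI
  push_cast
  have h1 : ((√(ξ ^ 2 + k ^ 2) : ℝ) : ℂ) ≠ 0 := by
    exact_mod_cast (decayI_pos hk ξ).ne'
  field_simp

lemma hasDerivAt_decay {k ξ : ℝ} (hk : 0 < k) (h : |ξ| ≠ k) :
    HasDerivAt (decay k) (ξ / decay k ξ) ξ := by
  have hne : ξ ^ 2 - k ^ 2 ≠ 0 := by
    rcases lt_or_gt_of_ne h with h | h
    · exact (sub_neg.2 (sq_lt_sq_of_abs_lt h)).ne
    · exact (sub_pos.2 (sq_lt_sq_of_lt_abs hk h)).ne'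
  have hne' : k ^ 2 - ξ ^ 2 ≠ 0 := by intro h0; apply hne; linarith
  have hd := (((hasDerivAt_pow 2 ξ).sub_const (k ^ 2)).sqrt hne).ofReal_comp.sub
    ((((hasDerivAt_pow 2 ξ).const_sub (k ^ 2)).sqrt hne').ofReal_comp.const_mul Complex.I)
  refine hd.congr_deriv ?_
  rcases lt_or_gt_of_ne h with h | h
  · have h1 := sq_lt_sq_of_abs_lt h
    have h2 : √(ξ ^ 2 - k ^ 2) = 0 := Real.sqrt_eq_zero_of_nonpos (by linarith)
    have h3 : ((√(k ^ 2 - ξ ^ 2) : ℝ) : ℂ) ≠ 0 := by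
      exact_mod_cast (Real.sqrt_pos.2 (by linarith)).ne'
    rw [decay_of_lt h, h2]
    push_cast
    field_simp
    simp
    linear_combination (ξ : ℂ) * Complex.I_sq
  · have h1 := sq_lt_sq_of_lt_abs hk h
    have h2 : √(k ^ 2 - ξ ^ 2) = 0 := Real.sqrt_eq_zero_of_nonpos (by linarith)
    have h3 : ((√(ξ ^ 2 - k ^ 2) : ℝ) : ℂ) ≠ 0 := by
      exact_mod_cast (Real.sqrt_pos.2 (by linarith)).ne'
    rw [decay_of_gt hk h, h2]
    push_cast
    field_simp
    simp

lemma exp_neg_mul_one_add_le {c a : ℝ} : Real.exp (-(c * a)) * (1 + a * c) ≤ 1 := by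
  have h5 := Real.add_one_le_exp (c * a)
  have h6 : Real.exp (-(c * a)) * Real.exp (c * a) = 1 := by
    rw [← Real.exp_add]; simp
  have : 0 < Real.exp (-(c * a)) := Real.exp_pos _
  nlinarith

lemma norm_exp_decay_mul_le {k a ξ : ℝ} (hk : 0 < k) (ha : 0 ≤ a) (h : |ξ| ≠ k) :
    ‖Complex.exp (-(decay k ξ * a)) * (1 + a * decay k ξ)‖ ≤ 1 + a * k := by
  rcases lt_or_gt_of_ne h with h | h
  · have h1 := sq_lt_sq_of_abs_lt h
    rw [norm_mul, Complex.norm_exp, decay_of_lt h]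
    have h2 : (-(-Complex.I * (√(k ^ 2 - ξ ^ 2) : ℝ) * (a : ℂ))).re = 0 := by simp
    rw [h2, Real.exp_zero, one_mul]
    refine (norm_add_le _ _).trans ?_
    rw [norm_one, norm_mul, norm_mul, norm_neg, Complex.norm_I, one_mul, Complex.norm_real,
      Complex.norm_real, Real.norm_eq_abs, Real.norm_eq_abs, abs_of_nonneg ha,
      abs_of_nonneg (Real.sqrt_nonneg _)]
    gcongr
    rw [Real.sqrt_le_left hk.le]
    nlinarith [sq_nonneg ξ]
  · rw [decay_of_gt hk h]
    have e : Complex.exp (-((√(ξ ^ 2 - k ^ 2) : ℝ) * (a : ℂ))) * (1 + a * (√(ξ ^ 2 - k ^ 2) : ℝ)) =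
      ((Real.exp (-(√(ξ ^ 2 - k ^ 2) * a)) * (1 + a * √(ξ ^ 2 - k ^ 2)) : ℝ) : ℂ) := by
      push_cast; rfl
    rw [e, Complex.norm_real, Real.norm_eq_abs, abs_of_nonneg (by positivity)]
    refine exp_neg_mul_one_add_le.trans ?_
    nlinarith [mul_nonneg ha hk.le]

lemma norm_exp_decayI_mul_le {k a ξ : ℝ} (hk : 0 < k) (ha : 0 ≤ a) :
    ‖Complex.exp (-(decayI k ξ * a)) * (1 + a * decayI k ξ)‖ ≤ 1 + a * k := by
  have hs := decayI_pos hk ξ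
  have e : Complex.exp (-(decayI k ξ * a)) * (1 + a * decayI k ξ) =
      ((Real.exp (-(decayI k ξ * a)) * (1 + a * decayI k ξ) : ℝ) : ℂ) := by
    push_cast; rfl
  rw [e, Complex.norm_real, Real.norm_eq_abs, abs_of_nonneg (by positivity)]
  refine exp_neg_mul_one_add_le.trans ?_
  nlinarith [mul_nonneg ha hk.le]

/-- The constant is the value of `(|ξ| - k) / (|ξ| + k)` at `|ξ| = k + δ`, its worst case at
distance `δ` or more from `±k`. -/
lemma norm_decay_sq_ge {k δ ξ : ℝ} (hk : 0 < k) (hδ : 0 < δ) (h : δ ≤ |(|ξ| - k)|) :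
    δ / (2 * k + δ) * (ξ ^ 2 + k ^ 2) ≤ ‖decay k ξ‖ ^ 2 := by
  rw [norm_decay_sq]
  have h1 : |ξ ^ 2 - k ^ 2| = |(|ξ| - k)| * (|ξ| + k) := by
    calc |ξ ^ 2 - k ^ 2| = |(|ξ| - k) * (|ξ| + k)| := by
          congr 1
          nlinarith [sq_abs ξ]
      _ = _ := by rw [abs_mul, abs_of_nonneg (by positivity : 0 ≤ |ξ| + k)]
  rw [h1, div_mul_eq_mul_div, div_le_iff₀ (by positivity)]
  have hx := abs_nonneg ξ
  have h2 : ξ ^ 2 + k ^ 2 ≤ (|ξ| + k) * (|ξ| + k) := by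
    have := sq_abs ξ
    nlinarith
  have h3 : δ * (|ξ| + k) ≤ |(|ξ| - k)| * (2 * k + δ) := by
    rcases le_total k |ξ| with h4 | h4
    · rw [abs_of_nonneg (by linarith : 0 ≤ |ξ| - k)] at h ⊢
      nlinarith
    · rw [abs_of_nonpos (by linarith : |ξ| - k ≤ 0)] at h ⊢
      nlinarith
  calc δ * (ξ ^ 2 + k ^ 2) ≤ δ * ((|ξ| + k) * (|ξ| + k)) := by gcongr
    _ = (δ * (|ξ| + k)) * (|ξ| + k) := by ring
    _ ≤ (|(|ξ| - k)| * (2 * k + δ)) * (|ξ| + k) := by gcongr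
    _ = _ := by ring

lemma norm_profile_deriv_le {k a ξ c : ℝ} {ζ : ℂ} (hk : 0 < k) (hc : 0 < c)
    (hζ : c ^ 2 * (ξ ^ 2 + k ^ 2) ≤ ‖ζ‖ ^ 2)
    (he : ‖Complex.exp (-(ζ * a)) * (1 + a * ζ)‖ ≤ 1 + a * k) :
    ‖-(ξ * (Complex.exp (-(ζ * a)) * (1 + a * ζ)) / (2 * ζ ^ 3))‖ ≤
      (1 + a * k) / (2 * c ^ 3) * (ξ ^ 2 + k ^ 2)⁻¹ := by
  have hs := decayI_pos hk ξ
  have hs2 := decayI_sq k ξ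
  rw [← hs2, ← mul_pow] at hζ
  have h1 : c * decayI k ξ ≤ ‖ζ‖ := (pow_le_pow_iff_left₀ (by positivity) (norm_nonneg _) two_ne_zero).1 hζ
  have h2 := abs_le_decayI k ξ
  have h3 : 0 ≤ 1 + a * k := (norm_nonneg _).trans he
  rw [norm_neg, norm_div, norm_mul (ξ : ℂ), norm_mul 2 (ζ ^ 3), norm_pow, Complex.norm_real,
    Real.norm_eq_abs, ← hs2]
  simp only [Complex.norm_ofNat]
  calc |ξ| * ‖Complex.exp (-(ζ * a)) * (1 + a * ζ)‖ / (2 * ‖ζ‖ ^ 3)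
      ≤ decayI k ξ * (1 + a * k) / (2 * (c * decayI k ξ) ^ 3) := by gcongr
    _ = _ := by field_simp


/-! ### Plane-wave expansions of the fundamental solutions -/

/-- The Macdonald function `K₀`. -/
def macdonald (x : ℝ) : ℝ := 1 / 2 * ∫ t : ℝ, Real.exp (-(x * Real.cosh t))

lemma exists_polar {a : ℝ} (ha : 0 < a) (z : ℝ) : ∃ θ ∈ Ioo (-(Real.pi / 2)) (Real.pi / 2),
    z = √(z ^ 2 + a ^ 2) * Real.sin θ ∧ a = √(z ^ 2 + a ^ 2) * Real.cos θ := by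
  have h1 : √(z ^ 2 + a ^ 2) = a * √(1 + (z / a) ^ 2) := by
    rw [show z ^ 2 + a ^ 2 = a ^ 2 * (1 + (z / a) ^ 2) by field_simp; ring,
      Real.sqrt_mul (by positivity), Real.sqrt_sq ha.le]
  have h2 : 0 < √(1 + (z / a) ^ 2) := Real.sqrt_pos.2 (by positivity)
  refine ⟨Real.arctan (z / a), ⟨Real.neg_pi_div_two_lt_arctan _, Real.arctan_lt_pi_div_two _⟩, ?_, ?_⟩
  · rw [h1, Real.sin_arctan]; field_simp
  · rw [h1, Real.cos_arctan]; field_simp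

/-- Under `ξ = k sinh t` the exponent becomes `-kr cosh (t - iθ)` with `θ` the polar angle of `(a,
z)`, and the contour shift brings `θ` to `0`. -/
lemma integral_profile_decayI {k a : ℝ} (hk : 0 < k) (ha : 0 < a) (z : ℝ) :
    ∫ ξ, profile a (decayI k ξ) * Complex.exp (Complex.I * (ξ * z : ℝ)) =
      macdonald (k * √(z ^ 2 + a ^ 2)) := by
  obtain ⟨θ, hθ, hz, haθ⟩ := exists_polar ha z
  set r := √(z ^ 2 + a ^ 2) with hr
  have hr0 : 0 < r := Real.sqrt_pos.2 (by positivity)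
  have himg : (fun t => k * Real.sinh t) '' univ = univ := by
    rw [image_univ, range_eq_univ]
    intro x
    exact ⟨Real.arsinh (x / k), by simp only [Real.sinh_arsinh]; field_simp⟩
  have h := integral_image_eq_integral_abs_deriv_smul (s := univ) MeasurableSet.univ
    (f := fun t => k * Real.sinh t) (f' := fun t => k * Real.cosh t)
    (fun t _ => ((Real.hasDerivAt_sinh t).const_mul k).hasDerivWithinAt)
    (fun s _ t _ hst => Real.sinh_injective (mul_left_cancel₀ hk.ne' hst))
    (fun ξ => profile a (decayI k ξ) * Complex.exp (Complex.I * (ξ * z : ℝ)))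
  rw [himg, setIntegral_univ, setIntegral_univ] at h
  rw [h]
  have h2 : ∀ t : ℝ, |k * Real.cosh t| • (profile a (decayI k (k * Real.sinh t)) *
      Complex.exp (Complex.I * (k * Real.sinh t * z : ℝ))) =
      1 / 2 * Complex.exp (macdonaldPhase (k * r) θ t) := by
    intro t
    have hc := Real.cosh_pos t
    have hd : decayI k (k * Real.sinh t) = k * Real.cosh t := by
      unfold decayI
      rw [show (k * Real.sinh t) ^ 2 + k ^ 2 = (k * Real.cosh t) ^ 2 by
        rw [mul_pow, mul_pow, Real.cosh_sq]; ring]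
      exact Real.sqrt_sq (by positivity)
    rw [hd, abs_of_pos (by positivity), profile, Complex.real_smul]
    have hne : ((k * Real.cosh t : ℝ) : ℂ) ≠ 0 := by
      exact_mod_cast (by positivity : k * Real.cosh t ≠ 0)
    rw [div_mul_eq_mul_div, ← Complex.exp_add]
    have e : -(((k * Real.cosh t : ℝ) : ℂ) * a) + Complex.I * ((k * Real.sinh t * z : ℝ) : ℂ) =
        macdonaldPhase (k * r) θ t := by
      rw [macdonaldPhase, haθ, hz]
      push_cast
      ring
    rw [e]
    field_simp
  simp only [h2]
  rw [integral_const_mul, integral_macdonaldPhase_eq (by positivity) hθ, macdonald]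
  push_cast
  congr 1
  rw [← integral_complex_ofReal]
  congr 1
  funext t
  simp [macdonaldPhase]

lemma image_mul_sin {k : ℝ} (hk : 0 < k) :
    (fun t => k * Real.sin t) '' Ioo (-(Real.pi / 2)) (Real.pi / 2) = Ioo (-k) k := by
  ext x
  constructor
  · rintro ⟨t, ht, rfl⟩
    have h1 := Real.cos_pos_of_mem_Ioo ht
    have h2 := Real.sin_sq_add_cos_sq t
    have h3 : Real.sin t < 1 := by nlinarith
    have h4 : -1 < Real.sin t := by nlinarith
    constructor <;> nlinarith
  · intro hx
    have h1 : x / k < 1 := by rw [div_lt_one hk]; exact hx.2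
    have h2 : -1 < x / k := by rw [lt_div_iff₀ hk]; linarith [hx.1]
    refine ⟨Real.arcsin (x / k), ⟨Real.neg_pi_div_two_lt_arcsin.2 h2,
      Real.arcsin_lt_pi_div_two.2 h1⟩, ?_⟩
    simp only [Real.sin_arcsin h2.le h1.le]
    field_simp

lemma image_mul_cosh {k : ℝ} (hk : 0 < k) :
    (fun t => k * Real.cosh t) '' Ioi 0 = Ioi k := by
  ext x
  constructor
  · rintro ⟨t, ht, rfl⟩
    have h1 : 1 < Real.cosh t := Real.one_lt_cosh.2 (ne_of_gt ht)
    simp only [mem_Ioi]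
    nlinarith
  · intro hx
    have h1 : 1 < x / k := by rw [lt_div_iff₀ hk]; simpa using hx
    refine ⟨Real.arcosh (x / k), Real.arcosh_pos h1, ?_⟩
    simp only [Real.cosh_arcosh h1.le]
    field_simp

/-- The substitution is `ξ = k sin t` on the propagating range, where it gives a plane wave in
direction `t - θ`, and `ξ = ±k cosh t` on the two evanescent ranges, whose sum is `sommerfeldTail`.
-/
lemma integral_profile_decay {k a : ℝ} (hk : 0 < k) (ha : 0 < a) (z : ℝ) :
    ∫ ξ, profile a (decay k ξ) * Complex.exp (Complex.I * (ξ * z : ℝ)) =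
      Complex.I * Real.pi / 2 * hankelH0 (k * √(z ^ 2 + a ^ 2)) := by
  obtain ⟨θ, hθ, hz, haθ⟩ := exists_polar ha z
  set r := √(z ^ 2 + a ^ 2) with hr
  have hr0 : 0 < r := Real.sqrt_pos.2 (by positivity)
  set g : ℝ → ℂ := fun ξ => profile a (decay k ξ) * Complex.exp (Complex.I * (ξ * z : ℝ)) with hg
  have hgi : Integrable g := integrable_mul_exp_I (integrable_profile_decay hk ha) z
  have hsplit : ∫ ξ, g ξ = (∫ ξ in Ioo (-k) k, g ξ) + ∫ ξ in Ioi k, (g ξ + g (-ξ)) := by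
    rw [← intervalIntegral.integral_Iic_add_Ioi (b := -k) hgi.integrableOn hgi.integrableOn,
      ← Ioc_union_Ioi_eq_Ioi (by linarith : -k ≤ k),
      setIntegral_union (by
        rw [Set.disjoint_left]
        exact fun x hx hx' => absurd hx.2 (not_le.2 hx')) measurableSet_Ioi
        hgi.integrableOn hgi.integrableOn, integral_Ioc_eq_integral_Ioo,
      integral_add hgi.integrableOn hgi.comp_neg.integrableOn]
    have h := integral_comp_neg_Ioi k g
    rw [h]
    ring
  have hmid : ∫ ξ in Ioo (-k) k, g ξ = Complex.I / 2 * ∫ φ in (-(Real.pi / 2))..(Real.pi / 2),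
      Complex.exp (Complex.I * ((k * r) * Real.cos (φ - θ) : ℝ)) := by
    rw [← image_mul_sin hk, integral_image_eq_integral_abs_deriv_smul measurableSet_Ioo
      (f' := fun t => k * Real.cos t)
      (fun t _ => ((Real.hasDerivAt_sin t).const_mul k).hasDerivWithinAt)
      (fun s hs t ht hst => Real.injOn_sin (Ioo_subset_Icc_self hs) (Ioo_subset_Icc_self ht)
        (mul_left_cancel₀ hk.ne' hst)),
      intervalIntegral.integral_of_le (by linarith [Real.pi_pos]), integral_Ioc_eq_integral_Ioo,
      ← integral_const_mul]
    refine setIntegral_congr_fun measurableSet_Ioo fun t ht => ?_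
    have hc := Real.cos_pos_of_mem_Ioo ht
    have hmem : k * Real.sin t ∈ Ioo (-k) k := by
      rw [← image_mul_sin hk]; exact ⟨t, ht, rfl⟩
    have hd : decay k (k * Real.sin t) = -Complex.I * (k * Real.cos t : ℝ) := by
      rw [decay_of_lt (abs_lt.2 hmem), show k ^ 2 - (k * Real.sin t) ^ 2 = (k * Real.cos t) ^ 2 by
        rw [mul_pow, mul_pow, Real.cos_sq']; ring, Real.sqrt_sq (by positivity)]
    have hne : ((k * Real.cos t : ℝ) : ℂ) ≠ 0 := by
      exact_mod_cast (by positivity : k * Real.cos t ≠ 0)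
    simp only [hg]
    rw [hd, abs_of_pos (by positivity), profile, Complex.real_smul, div_mul_eq_mul_div,
      ← Complex.exp_add]
    have e : -(-Complex.I * ((k * Real.cos t : ℝ) : ℂ) * a) +
        Complex.I * ((k * Real.sin t * z : ℝ) : ℂ) =
        Complex.I * ((k * r) * Real.cos (t - θ) : ℝ) := by
      rw [Real.cos_sub, haθ, hz]
      push_cast
      ring
    rw [e, mul_div_assoc']
    rw [div_eq_iff (mul_ne_zero two_ne_zero (mul_ne_zero (neg_ne_zero.2 Complex.I_ne_zero) hne))]
    linear_combination (((k * Real.cos t : ℝ) : ℂ) *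
      Complex.exp (Complex.I * ((k * r) * Real.cos (t - θ) : ℝ))) * Complex.I_sq
  have htail : ∫ ξ in Ioi k, (g ξ + g (-ξ)) = (∫ t in Ioi (0 : ℝ), sommerfeldTail (k * r) θ t : ℝ) := by
    rw [← image_mul_cosh hk, integral_image_eq_integral_abs_deriv_smul measurableSet_Ioi
      (f' := fun t => k * Real.sinh t)
      (fun t _ => ((Real.hasDerivAt_cosh t).const_mul k).hasDerivWithinAt)
      (fun s hs t ht hst => Real.cosh_injOn (le_of_lt hs : (0 : ℝ) ≤ s) (le_of_lt ht : (0 : ℝ) ≤ t)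
        (mul_left_cancel₀ hk.ne' hst)), ← integral_complex_ofReal]
    refine setIntegral_congr_fun measurableSet_Ioi fun t ht => ?_
    have hs : 0 < Real.sinh t := Real.sinh_pos_iff.2 ht
    have hmem : k < |k * Real.cosh t| := by
      have : k * Real.cosh t ∈ Ioi k := by rw [← image_mul_cosh hk]; exact ⟨t, ht, rfl⟩
      exact lt_of_lt_of_le this (le_abs_self _)
    have hsq : √((k * Real.cosh t) ^ 2 - k ^ 2) = k * Real.sinh t := by
      rw [show (k * Real.cosh t) ^ 2 - k ^ 2 = (k * Real.sinh t) ^ 2 by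
        rw [mul_pow, mul_pow, Real.cosh_sq]; ring, Real.sqrt_sq (by positivity)]
    have hd : decay k (k * Real.cosh t) = (k * Real.sinh t : ℝ) := by
      rw [decay_of_gt hk hmem, hsq]
    have hd' : decay k (-(k * Real.cosh t)) = (k * Real.sinh t : ℝ) := by
      rw [decay_of_gt hk (by rwa [abs_neg]), neg_sq, hsq]
    have hne : ((k * Real.sinh t : ℝ) : ℂ) ≠ 0 := by
      exact_mod_cast (by positivity : k * Real.sinh t ≠ 0)
    simp only [hg]
    rw [hd, hd', abs_of_pos (by positivity), profile, Complex.real_smul, sommerfeldTail]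
    have e1 : ((Real.cos (k * r * Real.sin θ * Real.cosh t) *
        Real.exp (-(k * r * Real.cos θ * Real.sinh t)) : ℝ) : ℂ) =
        Complex.exp (-(((k * Real.sinh t : ℝ) : ℂ) * a)) *
        Complex.cos ((k * Real.cosh t * z : ℝ) : ℂ) := by
      rw [haθ, hz]
      push_cast
      rw [mul_comm]
      congr 2 <;> ring
    rw [e1, Complex.cos]
    have e2 : Complex.I * ((k * Real.cosh t * z : ℝ) : ℂ) =
      ((k * Real.cosh t * z : ℝ) : ℂ) * Complex.I := mul_comm _ _
    have e3 : Complex.I * ((-(k * Real.cosh t) * z : ℝ) : ℂ) =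
      -((k * Real.cosh t * z : ℝ) : ℂ) * Complex.I := by push_cast; ring
    rw [e2, e3]
    field_simp
  rw [hsplit, hmid, htail]
  have h := sommerfeld_eq_hankelH0 (ρ := k * r) (by positivity) hθ
  rw [mul_assoc, mul_div_assoc] at *
  linear_combination (Complex.I / 2) * h +
    ((∫ t in Ioi (0 : ℝ), sommerfeldTail (k * r) θ t : ℝ) : ℂ) * Complex.I_sq

lemma integral_profileDiff {k a : ℝ} (hk : 0 < k) (ha : 0 < a) (z : ℝ) :
    ∫ ξ, profileDiff k a ξ * Complex.exp (Complex.I * (ξ * z : ℝ)) =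
      Complex.I * Real.pi / 2 * hankelH0 (k * √(z ^ 2 + a ^ 2)) - macdonald (k * √(z ^ 2 + a ^ 2)) := by
  rw [← integral_profile_decay hk ha, ← integral_profile_decayI hk ha,
    ← integral_sub (integrable_mul_exp_I (integrable_profile_decay hk ha) z)
      (integrable_mul_exp_I (integrable_profile_decayI hk ha) z)]
  congr 1
  funext ξ
  rw [profileDiff, sub_mul]

/-! ### Continuity, and the plane-wave expansion in the plane `z₂ = 0` -/

/-- Follows from `cosh t ≥ 1`. The exponential decay makes the lattice sum of the screened
potentials absolutely convergent. -/
lemma macdonald_le {x y : ℝ} (hx : 0 < x) (hy : x ≤ y) :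
    macdonald y ≤ Real.exp (-(y - x)) * macdonald x := by
  unfold macdonald
  rw [mul_left_comm]
  have hi : ∀ x : ℝ, 0 < x → Integrable fun t => Real.exp (-(x * Real.cosh t)) := fun x hx =>
    integrable_of_cosh_bound (K := 1) hx (by fun_prop) (fun t => by
      rw [Real.norm_eq_abs, Real.abs_exp, one_mul]
      exact le_mul_of_one_le_left (Real.exp_pos _).le (by nlinarith [Real.cosh_pos t]))
  refine mul_le_mul_of_nonneg_left ?_ (by norm_num : (0 : ℝ) ≤ 1 / 2)
  rw [← integral_const_mul]
  refine integral_mono (hi y (by linarith)) ((hi x hx).const_mul _) fun t => ?_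
  simp only
  rw [← Real.exp_add]
  refine Real.exp_le_exp.2 ?_
  nlinarith [Real.one_le_cosh t]

lemma macdonald_nonneg (x : ℝ) : 0 ≤ macdonald x :=
  mul_nonneg (by norm_num) (integral_nonneg fun t => (Real.exp_pos _).le)

lemma continuousOn_macdonald : ContinuousOn macdonald (Ioi 0) := by
  intro x hx
  refine ContinuousAt.continuousWithinAt ?_
  have hx0 : (0 : ℝ) < x := hx
  refine continuousAt_const.mul ?_
  refine continuousAt_of_dominated (bound := fun t => Real.exp (-(x / 2 * Real.cosh t))) ?_ ?_ ?_ ?_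
  · exact Eventually.of_forall fun y => Continuous.aestronglyMeasurable (by fun_prop)
  · filter_upwards [Ioi_mem_nhds (half_lt_self hx0)] with y hy
    refine Eventually.of_forall fun t => ?_
    have hy' : x / 2 < y := hy
    rw [Real.norm_eq_abs, Real.abs_exp]
    refine Real.exp_le_exp.2 ?_
    nlinarith [Real.cosh_pos t]
  · exact integrable_of_cosh_bound (K := 1) (half_pos hx0) (by fun_prop) (fun t => by
      rw [Real.norm_eq_abs, Real.abs_exp, one_mul]
      exact le_mul_of_one_le_left (Real.exp_pos _).le (by nlinarith [Real.cosh_pos t]))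
  · exact Eventually.of_forall fun t => Continuous.continuousAt (by fun_prop)

lemma continuousOn_hankelH0 : ContinuousOn hankelH0 (Ioi 0) := by
  have h : ContinuousOn (fun x => (2 / Real.pi : ℂ) * (cosIntegral x - Complex.I * sinhIntegral x))
      (Ioi 0) := by
    intro x hx
    refine ContinuousAt.continuousWithinAt ?_
    exact continuousAt_const.mul ((hasDerivAt_cosIntegral x).continuousAt.sub
      (continuousAt_const.mul (hasDerivAt_sinhIntegral hx).ofReal_comp.continuousAt))
  exact h.congr fun x hx => hankelH0_eq_integral hx

/-- Gives access to the line `z.2 = 0`, where the two profiles are not separately integrable, as a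
limit from `z.2 ≠ 0`. -/
lemma continuous_integral_profileDiff {k : ℝ} (hk : 0 < k) :
    Continuous fun z : ℝ × ℝ =>
      ∫ ξ, profileDiff k |z.2| ξ * Complex.exp (Complex.I * (ξ * z.1 : ℝ)) := by
  refine continuous_of_dominated (bound := profileBound k) ?_ ?_ (integrable_profileBound hk) ?_
  · intro z
    exact (integrable_mul_exp_I (integrable_profileDiff hk (abs_nonneg _)) z.1).aestronglyMeasurable
  · intro z
    filter_upwards [ae_abs_ne k] with ξ hξ
    rw [norm_mul, mul_comm Complex.I, Complex.norm_exp_ofReal_mul_I, mul_one]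
    exact norm_profileDiff_le hk (abs_nonneg _) hξ
  · refine Eventually.of_forall fun ξ => ?_
    unfold profileDiff profile
    fun_prop

/-- The difference of the fundamental solutions of `Δ + k²` and `Δ - k²` is a superposition of
plane waves with an integrable density. -/
theorem integral_profileDiff_abs {k : ℝ} (hk : 0 < k) {z₁ z₂ : ℝ} (hz : 0 < z₁ ^ 2 + z₂ ^ 2) :
    ∫ ξ, profileDiff k |z₂| ξ * Complex.exp (Complex.I * (ξ * z₁ : ℝ)) =
      Complex.I * Real.pi / 2 * hankelH0 (k * √(z₁ ^ 2 + z₂ ^ 2))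
        - macdonald (k * √(z₁ ^ 2 + z₂ ^ 2)) := by
  by_cases h0 : z₂ = 0
  · subst h0
    have hpos : 0 < k * √(z₁ ^ 2 + 0 ^ 2) := by
      have := Real.sqrt_pos.2 hz
      positivity
    have c1 : ContinuousAt (fun s : ℝ => k * √(z₁ ^ 2 + s ^ 2)) 0 := by fun_prop
    have t1 : Tendsto (fun s : ℝ => ∫ ξ, profileDiff k |s| ξ *
        Complex.exp (Complex.I * (ξ * z₁ : ℝ))) (𝓝 0) (𝓝 _) :=
      ((continuous_integral_profileDiff hk).comp (Continuous.prodMk_right z₁)).tendsto 0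
    have t2 : Tendsto (fun s : ℝ => Complex.I * Real.pi / 2 * hankelH0 (k * √(z₁ ^ 2 + s ^ 2))
        - macdonald (k * √(z₁ ^ 2 + s ^ 2))) (𝓝 0)
        (𝓝 (Complex.I * Real.pi / 2 * hankelH0 (k * √(z₁ ^ 2 + 0 ^ 2))
        - macdonald (k * √(z₁ ^ 2 + 0 ^ 2)))) := by
      have h1 : ContinuousAt (fun s : ℝ => hankelH0 (k * √(z₁ ^ 2 + s ^ 2))) 0 :=
        ContinuousAt.comp (f := fun s : ℝ => k * √(z₁ ^ 2 + s ^ 2))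
          (continuousOn_hankelH0.continuousAt (Ioi_mem_nhds hpos)) c1
      have h2 : ContinuousAt (fun s : ℝ => macdonald (k * √(z₁ ^ 2 + s ^ 2))) 0 :=
        ContinuousAt.comp (f := fun s : ℝ => k * √(z₁ ^ 2 + s ^ 2))
          (continuousOn_macdonald.continuousAt (Ioi_mem_nhds hpos)) c1
      exact ((continuousAt_const.mul h1).sub
        (Complex.continuous_ofReal.continuousAt.comp h2)).tendsto
    refine tendsto_nhds_unique (t1.mono_left (nhdsWithin_le_nhds (s := {0}ᶜ)))
      ((t2.mono_left nhdsWithin_le_nhds).congr' ?_)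
    filter_upwards [self_mem_nhdsWithin] with s hs
    rw [integral_profileDiff hk (abs_pos.2 hs), sq_abs]
  · rw [integral_profileDiff hk (abs_pos.2 h0), sq_abs]


/-! ### Pointwise Poisson summation under a Dini condition -/

def stepIndex (y : ℝ) : ℤ := ⌊y + 1 / 2⌋

lemma measurable_comp_stepIndex {E : Type*} [MeasurableSpace E] (c : ℤ → E) :
    Measurable fun y => c (stepIndex y) := by
  have h : Measurable stepIndex := Int.measurable_floor.comp (measurable_id.add_const _)
  exact (measurable_from_top (f := c)).comp h

lemma stepIndex_of_mem {y : ℝ} {m : ℤ} (hy : y ∈ Ico (-(1 / 2) + (m : ℝ)) (-(1 / 2) + m + 1)) :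
    stepIndex y = m := by
  rw [stepIndex, Int.floor_eq_iff]
  constructor <;> linarith [hy.1, hy.2]

lemma abs_sub_stepIndex_le (y : ℝ) : |y - stepIndex y| ≤ 1 / 2 := by
  have h1 := Int.floor_le (y + 1 / 2)
  have h2 := Int.lt_floor_add_one (y + 1 / 2)
  rw [stepIndex, abs_le]
  constructor <;> linarith

lemma iUnion_Ico_half : (⋃ m : ℤ, Ico (-(1 / 2) + (m : ℝ)) (-(1 / 2) + m + 1)) = univ := by
  refine eq_univ_of_forall fun y => mem_iUnion.2 ⟨⌊y + 1 / 2⌋, ?_⟩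
  have h1 := Int.floor_le (y + 1 / 2)
  have h2 := Int.lt_floor_add_one (y + 1 / 2)
  constructor <;> linarith

lemma integrable_comp_stepIndex {c : ℤ → ℂ} (hc : Summable fun m => ‖c m‖) :
    Integrable fun y => c (stepIndex y) := by
  rw [← integrableOn_univ, ← iUnion_Ico_half]
  have hcongr : ∀ m : ℤ, ∀ y ∈ Ico (-(1 / 2) + (m : ℝ)) (-(1 / 2) + m + 1),
      c (stepIndex y) = c m := fun m y hy => by rw [stepIndex_of_mem hy]
  refine integrableOn_iUnion_of_summable_integral_norm (fun m => ?_) ?_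
  · refine (integrableOn_congr_fun (hcongr m) measurableSet_Ico).2 ?_
    exact integrableOn_const (by simp)
  · refine hc.congr fun m => ?_
    rw [setIntegral_congr_fun measurableSet_Ico (g := fun _ => ‖c m‖)
      (fun y hy => by simp only [hcongr m y hy])]
    simp

/-- The character `y ↦ e^{-2πi n y}`. -/
def intChar (n : ℤ) (y : ℝ) : ℂ := Complex.exp (((-(2 * Real.pi * n * y) : ℝ) : ℂ) * Complex.I)

lemma norm_intChar (n : ℤ) (y : ℝ) : ‖intChar n y‖ = 1 := Complex.norm_exp_ofReal_mul_I _

lemma continuous_intChar (n : ℤ) : Continuous (intChar n) := by unfold intChar; fun_prop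

lemma intChar_succ (n : ℤ) (y : ℝ) : intChar (n + 1) y = intChar n y * intChar 1 y := by
  unfold intChar
  rw [← Complex.exp_add]
  congr 1
  push_cast
  ring

lemma integrable_mul_intChar {g : ℝ → ℂ} (hg : Integrable g) (n : ℤ) :
    Integrable fun y => g y * intChar n y :=
  hg.mul_bdd (c := 1) (continuous_intChar n).aestronglyMeasurable
    (Eventually.of_forall fun y => (norm_intChar n y).le)

lemma integral_intChar (n : ℤ) (x : ℝ) :
    ∫ y in x..(x + 1), intChar n y = if n = 0 then 1 else 0 := by
  split_ifs with h
  · subst h; simp [intChar]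
  · have hc : (-(2 * Real.pi * n * Complex.I) : ℂ) ≠ 0 := by
      simp [Real.pi_ne_zero, h]
    have e : ∀ y : ℝ, intChar n y = Complex.exp (-(2 * Real.pi * n * Complex.I) * y) := by
      intro y
      unfold intChar
      congr 1
      push_cast
      ring
    simp only [e]
    rw [integral_exp_mul_complex hc]
    have : Complex.exp (-(2 * Real.pi * n * Complex.I) * ((x + 1 : ℝ) : ℂ)) =
        Complex.exp (-(2 * Real.pi * n * Complex.I) * (x : ℂ)) := by
      rw [Complex.exp_eq_exp_iff_exists_int]
      exact ⟨-n, by push_cast; ring⟩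
    rw [this, sub_self, zero_div]

/-- On each unit interval around an integer the step function is constant and the character runs
through whole periods, so only `n = 0` survives. The step function thus satisfies Poisson's formula
term by term. -/
lemma integral_step_mul_intChar {c : ℤ → ℂ} (hc : Summable fun m => ‖c m‖) (n : ℤ) :
    ∫ y, c (stepIndex y) * intChar n y = if n = 0 then ∑' m, c m else 0 := by
  have hi := integrable_mul_intChar (integrable_comp_stepIndex hc) n
  have h := hi.hasSum_intervalIntegral (-(1 / 2))
  have hterm : ∀ m : ℤ, ∫ y in (-(1 / 2) + (m : ℝ))..(-(1 / 2) + m + 1),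
      c (stepIndex y) * intChar n y = c m * if n = 0 then 1 else 0 := by
    intro m
    rw [← integral_intChar n (-(1 / 2) + m), ← intervalIntegral.integral_const_mul,
      intervalIntegral.integral_of_le (by linarith), intervalIntegral.integral_of_le (by linarith),
      ← integral_Ico_eq_integral_Ioc, ← integral_Ico_eq_integral_Ioc]
    refine setIntegral_congr_fun measurableSet_Ico fun y hy => ?_
    simp only [stepIndex_of_mem hy]
  simp only [hterm] at h
  rw [← h.tsum_eq]
  split_ifs <;> simp

lemma sum_Icc_sub_succ (f : ℤ → ℂ) {a b : ℤ} (h : a ≤ b) :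
    ∑ n ∈ Finset.Icc a b, (f n - f (n + 1)) = f a - f (b + 1) := by
  induction b, h using Int.leInduction with
  | base => simp
  | succ b hb ih =>
    have : Finset.Icc a (b + 1) = insert (b + 1) (Finset.Icc a b) := by
      ext x; simp only [Finset.mem_Icc, Finset.mem_insert]; omega
    rw [this, Finset.sum_insert (by simp), ih]
    ring

/-- Jordan's inequality for `2 |sin (π t)|`; it shows that `1 - intChar 1` vanishes only to first
order at the integers. -/
lemma four_mul_abs_le_norm_one_sub {t : ℝ} (ht : |t| ≤ 1 / 2) : 4 * |t| ≤ ‖1 - intChar 1 t‖ := by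
  have h1 : ‖1 - intChar 1 t‖ = |2 * Real.sin (Real.pi * t)| := by
    unfold intChar
    rw [norm_sub_rev, mul_comm, Complex.norm_exp_I_mul_ofReal_sub_one, Real.norm_eq_abs]
    rw [show (-(2 * Real.pi * ((1 : ℤ) : ℝ) * t)) / 2 = -(Real.pi * t) by push_cast; ring,
      Real.sin_neg, mul_neg, abs_neg]
  rw [h1]
  have h2 := Real.mul_abs_le_abs_sin (x := Real.pi * t) (by
    rw [abs_mul, abs_of_pos Real.pi_pos]; nlinarith [Real.pi_pos])
  rw [abs_mul, abs_of_pos Real.pi_pos] at h2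
  rw [abs_mul, abs_two]
  have h3 : 2 / Real.pi * (Real.pi * |t|) = 2 * |t| := by field_simp
  linarith

lemma intChar_sub_int (y : ℝ) (m : ℤ) : intChar 1 (y - m) = intChar 1 y := by
  unfold intChar
  rw [Complex.exp_eq_exp_iff_exists_int]
  exact ⟨m, by push_cast; ring⟩

lemma summable_inv_one_add_sq : Summable fun m : ℤ => (1 + (m : ℝ) ^ 2)⁻¹ := by
  have h : Summable fun m : ℤ => ((m : ℝ) ^ 2)⁻¹ := by
    simpa using Real.summable_one_div_int_pow.2 (one_lt_two)
  refine (summable_of_ne_finset_zero (s := {0})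
    (f := fun m : ℤ => if m = 0 then (1 : ℝ) else 0) (by simp +contextual)).add h |>.of_nonneg_of_le
    (fun m => by positivity) (fun m => ?_)
  by_cases hm : m = 0
  · simp [hm]
  · have : (0 : ℝ) < (m : ℝ) ^ 2 := by positivity
    simp only [hm, if_false, zero_add]
    gcongr
    linarith

lemma tendsto_integral_mul_intChar {q : ℝ → ℂ} {l : Filter ℤ}
    (hl : Tendsto (fun n : ℤ => (n : ℝ)) l (cocompact ℝ)) :
    Tendsto (fun n : ℤ => ∫ y, q y * intChar n y) l (𝓝 0) := by
  refine ((Real.tendsto_integral_exp_smul_cocompact q).comp hl).congr fun n => ?_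
  refine integral_congr_ae (Eventually.of_forall fun y => ?_)
  simp only [Circle.smul_def, Real.fourierChar_apply, intChar, smul_eq_mul]
  rw [mul_comm]
  congr 3
  push_cast
  ring

/-- Write `G` as a step function with the same integer samples plus `q(y) (1 - e^{-2πiy})`. The
Lipschitz condition at the integers makes `q` integrable. The step function yields the right side at
`n = 0` and nothing otherwise, while the remainder has the transform `q̂(n) - q̂(n + 1)`. Its sum
over `{-M, …, N}` telescopes to `q̂(-M) - q̂(N + 1)`, which vanishes in the limit by the
Riemann-Lebesgue lemma, with `M` and `N` independent. -/
lemma hasSum_conditional_integral_intChar {G : ℝ → ℂ} (hG : Integrable G) {C δ : ℝ} (hδ : 0 < δ)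
    (hC : ∀ m : ℤ, ‖G m‖ ≤ C * (1 + (m : ℝ) ^ 2)⁻¹)
    (hlip : ∀ (m : ℤ) (t : ℝ), |t| ≤ δ → ‖G (m + t) - G m‖ ≤ C * (1 + (m : ℝ) ^ 2)⁻¹ * |t|) :
    HasSum (fun n : ℤ => ∫ y, G y * intChar n y) (∑' m : ℤ, G m)
      (SummationFilter.conditional ℤ) := by
  have hC0 : 0 ≤ C := by simpa using (norm_nonneg _).trans (hC 0)
  have hcs : Summable fun m : ℤ => ‖G m‖ :=
    Summable.of_nonneg_of_le (fun _ => norm_nonneg _) hC (summable_inv_one_add_sq.mul_left C)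
  set b : ℤ → ℝ := fun m => (1 + (m : ℝ) ^ 2)⁻¹ with hb
  have hbi : Integrable fun y => b (stepIndex y) := by
    have h := (integrable_comp_stepIndex (c := fun m => ((b m : ℝ) : ℂ))
      (summable_inv_one_add_sq.congr fun m => by
        rw [Complex.norm_real, Real.norm_eq_abs, abs_of_nonneg]
        simp only [hb]; positivity)).re
    simpa using h
  set q : ℝ → ℂ := fun y => (G y - G (stepIndex y)) / (1 - intChar 1 y) with hq
  have hden : ∀ y, 4 * |y - stepIndex y| ≤ ‖1 - intChar 1 y‖ := fun y => by
    have := four_mul_abs_le_norm_one_sub (abs_sub_stepIndex_le y)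
    rwa [intChar_sub_int] at this
  have hqi : Integrable q := by
    refine Integrable.mono' ((hbi.const_mul (C / 4)).add
      ((hG.norm.add (hbi.const_mul C)).const_mul (1 / (4 * δ)))) ?_ ?_
    · refine (hG.aestronglyMeasurable.sub (measurable_comp_stepIndex
        (fun m : ℤ => G m)).aestronglyMeasurable).mul
        (Measurable.aestronglyMeasurable (?_ : Measurable fun y => (1 - intChar 1 y)⁻¹))
      exact (measurable_const.sub (continuous_intChar 1).measurable).inv
    · refine Eventually.of_forall fun y => ?_
      set m := stepIndex y with hm
      have hbm : 0 ≤ b m := by simp only [hb]; positivity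
      simp only [Pi.add_apply, hq, ← hm]
      rw [norm_div]
      rcases le_total |y - m| δ with h | h
      · have h1 := hlip m (y - m) h
        rw [add_sub_cancel] at h1
        have h2 : ‖G y - G m‖ / ‖1 - intChar 1 y‖ ≤ C / 4 * b m := by
          rcases eq_or_ne ‖1 - intChar 1 y‖ 0 with h3 | h3
          · rw [h3, div_zero]; positivity
          · rw [div_le_iff₀ (lt_of_le_of_ne (norm_nonneg _) h3.symm)]
            calc ‖G y - G m‖ ≤ C * b m * |y - m| := h1
              _ = C / 4 * b m * (4 * |y - m|) := by ring
              _ ≤ _ := by gcongr; exact hden y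
        refine h2.trans (le_add_of_nonneg_right ?_)
        positivity
      · have h1 : ‖G y - G m‖ ≤ ‖G y‖ + C * b m := (norm_sub_le _ _).trans (by gcongr; exact hC m)
        have h2 : 4 * δ ≤ ‖1 - intChar 1 y‖ := le_trans (by gcongr) (hden y)
        have h3 : ‖G y - G m‖ / ‖1 - intChar 1 y‖ ≤ 1 / (4 * δ) * (‖G y‖ + C * b m) := by
          rw [one_div, inv_mul_eq_div]
          gcongr
        refine h3.trans (le_add_of_nonneg_left ?_)
        positivity
  -- Where the denominator vanishes, `y` is an integer and hence its own `stepIndex`, so the value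
  -- `q y = 0` given by division by zero does no harm.
  have hdecomp : ∀ y, G y = G (stepIndex y) + q y * (1 - intChar 1 y) := by
    intro y
    simp only [hq]
    by_cases h : 1 - intChar 1 y = 0
    · have h1 := hden y
      rw [h, norm_zero] at h1
      have h2 : |y - stepIndex y| = 0 := le_antisymm (by linarith) (abs_nonneg _)
      rw [abs_eq_zero, sub_eq_zero] at h2
      rw [h, mul_zero, add_zero, ← h2]
    · rw [div_mul_cancel₀ _ h]; ring
  have hint : ∀ n : ℤ, ∫ y, G y * intChar n y = (if n = 0 then ∑' m : ℤ, G m else 0) +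
      ((∫ y, q y * intChar n y) - ∫ y, q y * intChar (n + 1) y) := by
    intro n
    have hi : Integrable fun y => q y * intChar n y - q y * intChar (n + 1) y :=
      (integrable_mul_intChar hqi n).sub (integrable_mul_intChar hqi (n + 1))
    rw [← integral_step_mul_intChar hcs, ← integral_sub (integrable_mul_intChar hqi n)
      (integrable_mul_intChar hqi (n + 1)), ← integral_add
      (integrable_mul_intChar (integrable_comp_stepIndex hcs) n) hi]
    refine integral_congr_ae (Eventually.of_forall fun y => ?_)
    simp only [intChar_succ]
    conv_lhs => rw [hdecomp y]
    ring
  rw [HasSum, SummationFilter.conditional_filter, tendsto_map'_iff]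
  have hcast1 : Tendsto (fun n : ℤ => (n : ℝ)) atBot (cocompact ℝ) :=
    (tendsto_intCast_atBot_iff.2 tendsto_id).mono_right atBot_le_cocompact
  have hcast2 : Tendsto (fun n : ℤ => ((n + 1 : ℤ) : ℝ)) atTop (cocompact ℝ) :=
    (tendsto_intCast_atTop_atTop.comp (tendsto_atTop_add_const_right _ 1 tendsto_id)).mono_right
      atTop_le_cocompact
  have t1 : Tendsto (fun p : ℤ × ℤ => ∫ y, q y * intChar p.1 y) (atBot ×ˢ atTop) (𝓝 0) :=
    (tendsto_integral_mul_intChar hcast1).comp tendsto_fst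
  have t2' : Tendsto (fun n : ℤ => ∫ y, q y * intChar (n + 1) y) atTop (𝓝 0) := by
    have h := tendsto_integral_mul_intChar (q := q) (l := map (fun n : ℤ => n + 1) atTop)
      (tendsto_map'_iff.2 hcast2)
    exact tendsto_map'_iff.1 h
  have t2 : Tendsto (fun p : ℤ × ℤ => ∫ y, q y * intChar (p.2 + 1) y) (atBot ×ˢ atTop) (𝓝 0) :=
    t2'.comp tendsto_snd
  have t3 := (t1.sub t2).const_add (∑' m : ℤ, G m)
  rw [sub_zero, add_zero] at t3
  refine t3.congr' ?_
  filter_upwards [(eventually_le_atBot (0 : ℤ)).prod_mk (eventually_ge_atTop (0 : ℤ))] with p hp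
  simp only [Function.comp, hint]
  rw [Finset.sum_add_distrib, sum_Icc_sub_succ (fun n => ∫ y, q y * intChar n y) (hp.1.trans hp.2),
    Finset.sum_ite_eq', if_pos (Finset.mem_Icc.2 hp)]

/-- Poisson summation for the lattice `α + (2π/Λ)ℤ`, with conditional convergence. -/
theorem hasSum_conditional_integral_exp {g : ℝ → ℂ} (hg : Integrable g) {Λ α C δ : ℝ} (hΛ : 0 < Λ)
    (hδ : 0 < δ) (hC : ∀ m : ℤ, ‖g (alphaMode Λ α m)‖ ≤ C * (1 + (m : ℝ) ^ 2)⁻¹)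
    (hlip : ∀ (m : ℤ) (t : ℝ), |t| ≤ δ → ‖g (alphaMode Λ α m + t) - g (alphaMode Λ α m)‖ ≤
      C * (1 + (m : ℝ) ^ 2)⁻¹ * |t|) :
    HasSum (fun n : ℤ => ∫ ξ, g ξ * Complex.exp (Complex.I * (n * Λ * (α - ξ) : ℝ)))
      (2 * Real.pi / Λ * ∑' m : ℤ, g (alphaMode Λ α m)) (SummationFilter.conditional ℤ) := by
  set w := 2 * Real.pi / Λ with hw
  have hw0 : 0 < w := by positivity
  have hwΛ : w * Λ = 2 * Real.pi := by rw [hw]; field_simp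
  have hGi : Integrable fun y => g (α + w * y) :=
    ((hg.comp_add_left α).comp_mul_left' hw0.ne')
  have h := hasSum_conditional_integral_intChar (G := fun y => g (α + w * y)) (C := C * max 1 w)
    (δ := δ / w) hGi (by positivity) (fun m => ?_) (fun m t ht => ?_)
  · have h2 := h.mul_left (w : ℂ)
    have e : ((2 * Real.pi / Λ : ℂ)) = ((w : ℝ) : ℂ) := by rw [hw]; push_cast; rfl
    rw [e]
    have e2 : ∀ m : ℤ, g (alphaMode Λ α m) = g (α + w * m) := fun m => by rw [alphaMode, ← hw]
    simp only [e2]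
    refine h2.congr_fun fun n => ?_
    have h3 := Measure.integral_comp_mul_left (fun ξ => g (α + ξ) *
      Complex.exp (Complex.I * (n * Λ * (α - (α + ξ)) : ℝ))) w
    rw [integral_add_left_eq_self (fun ξ => g ξ *
      Complex.exp (Complex.I * (n * Λ * (α - ξ) : ℝ))) α] at h3
    rw [abs_of_pos (inv_pos.2 hw0)] at h3
    have h4 : ∀ y : ℝ, intChar n y =
        Complex.exp (Complex.I * (n * Λ * (α - (α + w * y)) : ℝ)) := fun y => by
      unfold intChar
      rw [mul_comm]
      congr 3
      linear_combination ((n : ℝ) * y) * hwΛ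
    simp only [h4]
    rw [h3, Complex.real_smul, ← mul_assoc, ← Complex.ofReal_mul, mul_inv_cancel₀ hw0.ne',
      Complex.ofReal_one, one_mul]
  · refine (hC m).trans ?_
    have := le_max_left 1 w
    have hC0 : 0 ≤ C := by simpa using (norm_nonneg _).trans (hC 0)
    have : C * 1 ≤ C * max 1 w := by gcongr
    rw [mul_one] at this
    gcongr
  · have h1 := hlip m (w * t) (by
      rw [abs_mul, abs_of_pos hw0]
      rwa [le_div_iff₀' hw0] at ht)
    have hC0 : 0 ≤ C := by simpa using (norm_nonneg _).trans (hC 0)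
    rw [abs_mul, abs_of_pos hw0] at h1
    have e1 : α + w * (m + t) = alphaMode Λ α m + w * t := by unfold alphaMode; rw [← hw]; ring
    rw [e1]
    refine h1.trans ?_
    calc C * (1 + (m : ℝ) ^ 2)⁻¹ * (w * |t|) = C * w * (1 + (m : ℝ) ^ 2)⁻¹ * |t| := by ring
      _ ≤ _ := by gcongr; exact le_max_right _ _


/-! ### The lattice sum of the smooth part of the Green's function -/

/-- Since `|α_m| → ∞`, the distance `||α_m| - k|` attains its minimum over `m`, which is positive by
hypothesis. Half of it serves both as the admissible perturbation and as the distance that is left.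
-/
lemma exists_wood_gap {k Λ α : ℝ} (hΛ : 0 < Λ) (hW : ∀ m : ℤ, |alphaMode Λ α m| ≠ k) :
    ∃ δ > 0, ∀ (m : ℤ) (t : ℝ), |t| ≤ δ → δ ≤ |(|alphaMode Λ α m + t| - k)| := by
  have h1 : Tendsto (fun m : ℤ => |(|alphaMode Λ α m| - k)|) cofinite atTop := by
    have hc : Tendsto (fun m : ℤ => ‖(m : ℝ)‖) cofinite atTop :=
      (tendsto_norm_cocompact_atTop (E := ℝ)).comp Int.tendsto_coe_cofinite
    have hc2 : Tendsto (fun m : ℤ => 2 * Real.pi / Λ * ‖(m : ℝ)‖ + (-|α| - |k|)) cofinite atTop :=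
      tendsto_atTop_add_const_right _ _ (hc.const_mul_atTop (by positivity))
    refine tendsto_atTop_mono (fun m => ?_) hc2
    have h2 : 2 * Real.pi / Λ * ‖(m : ℝ)‖ = |2 * Real.pi / Λ * m| := by
      rw [abs_mul, abs_of_pos (show 0 < 2 * Real.pi / Λ by positivity), Real.norm_eq_abs]
    rw [h2]
    have h3 : |2 * Real.pi / Λ * m| ≤ |alphaMode Λ α m| + |α| := by
      have := abs_sub (alphaMode Λ α m) α
      rwa [alphaMode, add_sub_cancel_left] at this
    have h4 := le_abs_self (|alphaMode Λ α m| - k)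
    have h5 := le_abs_self k
    linarith
  obtain ⟨m₀, hm₀⟩ := h1.exists_forall_le
  have hpos : 0 < |(|alphaMode Λ α m₀| - k)| := abs_pos.2 (sub_ne_zero.2 (hW m₀))
  refine ⟨|(|alphaMode Λ α m₀| - k)| / 2, by positivity, fun m t ht => ?_⟩
  have h2 := hm₀ m
  have h3 : |(|alphaMode Λ α m| - k)| ≤ |(|alphaMode Λ α m + t| - k)| + |t| := by
    have h4 := abs_abs_sub_abs_le_abs_sub (alphaMode Λ α m) (alphaMode Λ α m + t)
    rw [sub_add_cancel_left, abs_neg] at h4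
    have h5 := abs_add_le (|alphaMode Λ α m + t| - k)
      (|alphaMode Λ α m| - |alphaMode Λ α m + t|)
    rw [show |alphaMode Λ α m + t| - k + (|alphaMode Λ α m| - |alphaMode Λ α m + t|) =
      |alphaMode Λ α m| - k by ring] at h5
    linarith
  linarith

lemma inv_alphaMode_sq_le {k Λ α δ : ℝ} (hk : 0 < k) (hΛ : 0 < Λ) :
    ∃ A > 0, ∀ (m : ℤ) (t : ℝ), |t| ≤ δ →
      ((alphaMode Λ α m + t) ^ 2 + k ^ 2)⁻¹ ≤ A * (1 + (m : ℝ) ^ 2)⁻¹ := by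
  set w := 2 * Real.pi / Λ with hw
  have hw0 : 0 < w := by positivity
  set B := |α| + |δ| with hB
  refine ⟨(1 + 2 * B ^ 2 / w ^ 2) / k ^ 2 + 2 / w ^ 2, by positivity, fun m t ht => ?_⟩
  set ξ := alphaMode Λ α m + t with hξ
  have h1 : w * m = ξ - (α + t) := by rw [hξ, alphaMode, ← hw]; ring
  have h2 : |α + t| ≤ B := (abs_add_le _ _).trans (by
    rw [hB]; exact add_le_add_right (ht.trans (le_abs_self _)) _)
  have h3 : (w * m) ^ 2 ≤ 2 * ξ ^ 2 + 2 * B ^ 2 := by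
    have h4 : (α + t) ^ 2 ≤ B ^ 2 := by rw [← sq_abs (α + t)]; gcongr
    rw [h1]
    nlinarith [sq_nonneg (ξ + (α + t))]
  have h4 : (m : ℝ) ^ 2 ≤ 2 * B ^ 2 / w ^ 2 + 2 / w ^ 2 * ξ ^ 2 := by
    rw [← mul_le_mul_iff_right₀ (show 0 < w ^ 2 by positivity)]
    have : w ^ 2 * (2 * B ^ 2 / w ^ 2 + 2 / w ^ 2 * ξ ^ 2) = 2 * ξ ^ 2 + 2 * B ^ 2 := by
      field_simp; ring
    rw [this, ← mul_pow]
    exact h3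
  rw [inv_le_iff_one_le_mul₀ (by positivity), mul_right_comm, ← div_eq_mul_inv, one_le_div (by positivity)]
  have h5 : (1 + 2 * B ^ 2 / w ^ 2) / k ^ 2 * k ^ 2 = 1 + 2 * B ^ 2 / w ^ 2 := by field_simp
  have h6 : 0 ≤ (1 + 2 * B ^ 2 / w ^ 2) / k ^ 2 * ξ ^ 2 := by positivity
  have h7 : 0 ≤ 2 / w ^ 2 * k ^ 2 := by positivity
  nlinarith

lemma norm_profileDiff_le_of_gap {k δ : ℝ} (hk : 0 < k) (hδ : 0 < δ) :
    ∃ C > 0, ∀ a ξ : ℝ, 0 ≤ a → δ ≤ |(|ξ| - k)| →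
      ‖profileDiff k a ξ‖ ≤ C * (ξ ^ 2 + k ^ 2)⁻¹ := by
  set d := √(δ / (2 * k + δ) * k ^ 2) with hd
  have hd0 : 0 < d := by positivity
  refine ⟨2 * k ^ 2 / d, by positivity, fun a ξ ha h => ?_⟩
  have hne : |ξ| ≠ k := fun h1 => by rw [h1, sub_self, abs_zero] at h; linarith
  refine (norm_profileDiff_le hk ha hne).trans ?_
  rw [← div_div, div_eq_mul_inv _ (ξ ^ 2 + k ^ 2)]
  gcongr
  refine Real.sqrt_le_iff.2 ⟨norm_nonneg _, le_trans ?_ (norm_decay_sq_ge hk hδ h)⟩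
  gcongr
  nlinarith [sq_nonneg ξ]

lemma abs_ne_of_gap {k δ ξ : ℝ} (hδ : 0 < δ) (h : δ ≤ |(|ξ| - k)|) : |ξ| ≠ k := fun h1 => by
  rw [h1, sub_self, abs_zero] at h
  linarith

/-- Supplies the Lipschitz hypothesis of Poisson summation; the bound has the same quadratic decay
as the samples and so stays summable over the lattice. -/
lemma hasDerivAt_profileDiff_mul_exp {k δ : ℝ} (hk : 0 < k) (hδ : 0 < δ) {a : ℝ} (ha : 0 ≤ a)
    (z : ℝ) : ∃ C > 0, ∀ ξ : ℝ, δ ≤ |(|ξ| - k)| → ∃ D : ℂ,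
      HasDerivAt (fun ξ : ℝ => profileDiff k a ξ * Complex.exp (Complex.I * (ξ * z : ℝ))) D ξ ∧
      ‖D‖ ≤ C * (ξ ^ 2 + k ^ 2)⁻¹ := by
  obtain ⟨C₁, hC₁, hb⟩ := norm_profileDiff_le_of_gap hk hδ
  set c := √(δ / (2 * k + δ)) with hc
  have hc0 : 0 < c := by positivity
  have hcsq : c ^ 2 = δ / (2 * k + δ) := Real.sq_sqrt (by positivity)
  have hc1 : c ^ 2 ≤ 1 := by rw [hcsq, div_le_one (by positivity)]; linarith
  refine ⟨2 * ((1 + a * k) / (2 * c ^ 3)) + C₁ * |z|, by positivity, fun ξ h => ?_⟩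
  have hne := abs_ne_of_gap hδ h
  have d1 := hasDerivAt_profile_comp (a := a) (decay_ne_zero hne hk) (hasDerivAt_decay hk hne)
  have d2 := hasDerivAt_profile_comp (a := a) (ζ := fun ξ => (decayI k ξ : ℂ))
    (by exact_mod_cast (decayI_pos hk ξ).ne') (hasDerivAt_decayI hk ξ)
  have d3 : HasDerivAt (fun ξ : ℝ => Complex.exp (Complex.I * (ξ * z : ℝ)))
      (Complex.exp (Complex.I * (ξ * z : ℝ)) * (Complex.I * z)) ξ := by
    have h1 : HasDerivAt (fun ξ : ℝ => Complex.I * ((ξ * z : ℝ) : ℂ)) (Complex.I * z) ξ := by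
      have := (((hasDerivAt_id ξ).mul_const z).ofReal_comp).const_mul Complex.I
      simpa using this
    exact h1.cexp
  have b1 := norm_profile_deriv_le (a := a) (ξ := ξ) (ζ := decay k ξ) hk hc0 (by rw [hcsq]; exact norm_decay_sq_ge hk hδ h)
    (norm_exp_decay_mul_le hk ha hne)
  have b2 := norm_profile_deriv_le (a := a) (ξ := ξ) (ζ := (decayI k ξ : ℂ)) hk hc0 (by
    rw [Complex.norm_real, Real.norm_eq_abs, sq_abs, decayI_sq]
    exact mul_le_of_le_one_left (by positivity) hc1)
    (norm_exp_decayI_mul_le hk ha)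
  refine ⟨_, (d1.sub d2).mul d3, ?_⟩
  have hexp : ‖Complex.exp (Complex.I * (ξ * z : ℝ))‖ = 1 := by
    rw [mul_comm]; exact Complex.norm_exp_ofReal_mul_I _
  refine (norm_add_le _ _).trans ?_
  rw [norm_mul, norm_mul, norm_mul, hexp, mul_one, one_mul, norm_mul, Complex.norm_I, one_mul,
    Complex.norm_real, Real.norm_eq_abs]
  have b3 := mul_le_mul_of_nonneg_right (hb a ξ ha h) (abs_nonneg z)
  have b4 := (norm_sub_le _ _).trans (add_le_add b1 b2)
  simp only [Pi.sub_apply]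
  change _ + ‖profileDiff k a ξ‖ * |z| ≤ _
  refine (add_le_add b4 b3).trans (le_of_eq ?_)
  ring

/-- The smooth part of the lattice Green's function, summed by the Poisson formula. -/
def regularSum (k Λ α : ℝ) (z : ℝ × ℝ) : ℂ :=
  ∑' m : ℤ, profileDiff k |z.2| (alphaMode Λ α m) *
    Complex.exp (Complex.I * (alphaMode Λ α m * z.1 : ℝ))

lemma norm_exp_I_mul_ofReal (x : ℝ) : ‖Complex.exp (Complex.I * (x : ℂ))‖ = 1 := by
  rw [mul_comm]; exact Complex.norm_exp_ofReal_mul_I _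

lemma norm_profileDiff_alphaMode_le {k Λ α : ℝ} (hk : 0 < k) (hΛ : 0 < Λ)
    (hW : ∀ m : ℤ, |alphaMode Λ α m| ≠ k) : ∃ C > 0, ∀ (a : ℝ) (m : ℤ), 0 ≤ a →
      ‖profileDiff k a (alphaMode Λ α m)‖ ≤ C * (1 + (m : ℝ) ^ 2)⁻¹ := by
  obtain ⟨δ, hδ, hgap⟩ := exists_wood_gap hΛ hW
  obtain ⟨A, hA, hAm⟩ := inv_alphaMode_sq_le (α := α) (δ := δ) hk hΛ
  obtain ⟨C, hC, hb⟩ := norm_profileDiff_le_of_gap hk hδ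
  refine ⟨C * A, by positivity, fun a m ha => ?_⟩
  have h0 := hgap m 0 (by simp [hδ.le])
  have h1 := hAm m 0 (by simp [hδ.le])
  rw [add_zero] at h0 h1
  refine (hb a _ ha h0).trans ?_
  rw [mul_assoc]
  gcongr

lemma hasSum_conditional_integral_profileDiff {k Λ α : ℝ} (hk : 0 < k) (hΛ : 0 < Λ)
    (hW : ∀ m : ℤ, |alphaMode Λ α m| ≠ k) (z : ℝ × ℝ) :
    HasSum (fun n : ℤ => (∫ ξ, profileDiff k |z.2| ξ *
        Complex.exp (Complex.I * (ξ * (z.1 - n * Λ) : ℝ))) *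
        Complex.exp (Complex.I * (n * Λ * α : ℝ)))
      (2 * Real.pi / Λ * regularSum k Λ α z) (SummationFilter.conditional ℤ) := by
  obtain ⟨δ, hδ, hgap⟩ := exists_wood_gap hΛ hW
  obtain ⟨A, hA, hAm⟩ := inv_alphaMode_sq_le (α := α) (δ := δ) hk hΛ
  obtain ⟨C₁, hC₁, hb⟩ := norm_profileDiff_alphaMode_le hk hΛ hW
  obtain ⟨C₂, hC₂, hd⟩ := hasDerivAt_profileDiff_mul_exp hk hδ (abs_nonneg z.2) z.1
  have key := hasSum_conditional_integral_exp
    (g := fun ξ => profileDiff k |z.2| ξ * Complex.exp (Complex.I * (ξ * z.1 : ℝ)))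
    (integrable_mul_exp_I (integrable_profileDiff hk (abs_nonneg z.2)) z.1)
    (Λ := Λ) (α := α) (C := max C₁ (C₂ * A)) (δ := δ) hΛ hδ (fun m => ?_) (fun m t ht => ?_)
  · refine key.congr_fun fun n => ?_
    rw [← integral_mul_const]
    refine integral_congr_ae (Eventually.of_forall fun ξ => ?_)
    simp only [mul_assoc, ← Complex.exp_add]
    congr 2
    push_cast
    ring
  · rw [norm_mul, norm_exp_I_mul_ofReal, mul_one]
    refine (hb _ m (abs_nonneg _)).trans ?_
    gcongr
    exact le_max_left _ _
  -- The mean value inequality on a window around `α_m` that stays at distance `δ` from `±k`.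
  · set s : Set ℝ := Icc (alphaMode Λ α m - δ) (alphaMode Λ α m + δ) with hs
    have hgap' : ∀ ξ ∈ s, |ξ - alphaMode Λ α m| ≤ δ := fun ξ hξ => by
      rw [abs_le]; constructor <;> linarith [hξ.1, hξ.2]
    have hgs : ∀ ξ ∈ s, δ ≤ |(|ξ| - k)| := fun ξ hξ => by
      have := hgap m _ (hgap' ξ hξ)
      rwa [add_sub_cancel] at this
    choose! D hD hDb using hd
    have := (convex_Icc (alphaMode Λ α m - δ) (alphaMode Λ α m + δ)).norm_image_sub_le_of_norm_hasDerivWithin_le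
      (f := fun ξ : ℝ => profileDiff k |z.2| ξ * Complex.exp (Complex.I * (ξ * z.1 : ℝ)))
      (f' := D) (C := C₂ * A * (1 + (m : ℝ) ^ 2)⁻¹) (x := alphaMode Λ α m) (y := alphaMode Λ α m + t)
      (fun ξ hξ => (hD ξ (hgs ξ hξ)).hasDerivWithinAt) (fun ξ hξ => ?_)
      (by constructor <;> linarith) (by rw [abs_le] at ht; constructor <;> linarith [ht.1, ht.2])
    · rw [add_sub_cancel_left, Real.norm_eq_abs] at this
      refine this.trans ?_
      gcongr
      exact le_max_right _ _
    · refine (hDb ξ (hgs ξ hξ)).trans ?_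
      have h1 := hAm m _ (hgap' ξ hξ)
      rw [add_sub_cancel] at h1
      rw [mul_assoc]
      gcongr

lemma summable_regularSum_bound (C : ℝ) : Summable fun m : ℤ => C * (1 + (m : ℝ) ^ 2)⁻¹ :=
  summable_inv_one_add_sq.mul_left C

lemma continuous_profileDiff_left (k ξ : ℝ) : Continuous fun a : ℝ => profileDiff k a ξ := by
  unfold profileDiff profile
  fun_prop

lemma continuous_regularSum {k Λ α : ℝ} (hk : 0 < k) (hΛ : 0 < Λ)
    (hW : ∀ m : ℤ, |alphaMode Λ α m| ≠ k) : Continuous (regularSum k Λ α) := by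
  obtain ⟨C, hC, hb⟩ := norm_profileDiff_alphaMode_le hk hΛ hW
  refine continuous_tsum (fun m => ?_) (summable_regularSum_bound C) fun m z => ?_
  · exact ((continuous_profileDiff_left k _).comp (by fun_prop)).mul (by fun_prop)
  · rw [norm_mul, norm_exp_I_mul_ofReal, mul_one]
    exact hb _ m (abs_nonneg _)

lemma exists_norm_regularSum_le {k Λ α : ℝ} (hk : 0 < k) (hΛ : 0 < Λ)
    (hW : ∀ m : ℤ, |alphaMode Λ α m| ≠ k) : ∃ C, ∀ z, ‖regularSum k Λ α z‖ ≤ C := by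
  obtain ⟨C, hC, hb⟩ := norm_profileDiff_alphaMode_le hk hΛ hW
  refine ⟨_, fun z => tsum_of_norm_bounded (summable_regularSum_bound C).hasSum fun m => ?_⟩
  rw [norm_mul, norm_exp_I_mul_ofReal, mul_one]
  exact hb _ m (abs_nonneg _)


/-! ### The lattice Green's function -/

/-- The `n`-th term of the quasi-periodic sum of the screened potentials `K₀(k|z|)`. -/
def screenedTerm (k Λ α : ℝ) (z : ℝ × ℝ) (n : ℤ) : ℂ :=
  macdonald (k * √((z.1 - n * Λ) ^ 2 + z.2 ^ 2)) * Complex.exp (Complex.I * (n * Λ * α : ℝ))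

/-- The term `n = 0` is left out because it carries the logarithmic singularity at `z = 0`; the
other sources stay away from the strip `|z.1| ≤ Λ - δ`. -/
def screenedTail (k Λ α : ℝ) (z : ℝ × ℝ) : ℂ :=
  ∑' n : ℤ, if n = 0 then 0 else screenedTerm k Λ α z n

/-- The quasi-periodic Green's function near the origin, up to its logarithmic singularity. -/
def latticeRegular (k Λ α : ℝ) (z : ℝ × ℝ) : ℂ :=
  1 / (2 * Real.pi) * screenedTail k Λ α z + 1 / Λ * regularSum k Λ α z

/-- The quasi-periodic Green's function as a function of `z = x - y`. -/
def latticeGreen (k Λ α : ℝ) (z : ℝ × ℝ) : ℂ :=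
  1 / (2 * Real.pi) * (macdonald (k * √(z.1 ^ 2 + z.2 ^ 2)) : ℂ) + latticeRegular k Λ α z

lemma summable_exp_neg_mul_abs {c : ℝ} (hc : 0 < c) (M : ℝ) :
    Summable fun n : ℤ => Real.exp (-(c * (|(n : ℝ)| - 1))) * M := by
  have h : Summable fun n : ℕ => Real.exp (-(c * ((n : ℝ) - 1))) * M := by
    have h1 := Real.summable_exp_nat_mul_iff.2 (neg_lt_zero.2 hc)
    refine (h1.mul_right (Real.exp c * M)).congr fun n => ?_
    rw [← mul_assoc, ← Real.exp_add]
    congr 2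
    ring
  refine Summable.of_nat_of_neg ?_ ?_ <;> simpa using h

lemma norm_screenedTerm (k Λ α : ℝ) (z : ℝ × ℝ) (n : ℤ) :
    ‖screenedTerm k Λ α z n‖ = macdonald (k * √((z.1 - n * Λ) ^ 2 + z.2 ^ 2)) := by
  rw [screenedTerm, norm_mul, norm_exp_I_mul_ofReal, mul_one, Complex.norm_real, Real.norm_eq_abs,
    abs_of_nonneg (macdonald_nonneg _)]

lemma abs_int_mul_sub_le {Λ δ : ℝ} (hΛ : 0 < Λ) {z : ℝ × ℝ} (hz : |z.1| ≤ Λ - δ) (n : ℤ) :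
    Λ * (|(n : ℝ)| - 1) + δ ≤ √((z.1 - n * Λ) ^ 2 + z.2 ^ 2) := by
  have h1 : |z.1 - n * Λ| ≤ √((z.1 - n * Λ) ^ 2 + z.2 ^ 2) :=
    Real.abs_le_sqrt (by linarith [sq_nonneg z.2])
  have h2 : |(n : ℝ) * Λ| - |z.1| ≤ |z.1 - n * Λ| := by
    rw [abs_sub_comm]; exact abs_sub_abs_le_abs_sub _ _
  rw [abs_mul, abs_of_pos hΛ] at h2
  nlinarith

lemma one_le_abs_intCast {n : ℤ} (hn : n ≠ 0) : (1 : ℝ) ≤ |(n : ℝ)| := by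
  exact_mod_cast Int.one_le_abs hn

lemma norm_screenedTerm_le {k Λ α δ : ℝ} (hk : 0 < k) (hΛ : 0 < Λ) (hδ : 0 < δ) {z : ℝ × ℝ}
    (hz : |z.1| ≤ Λ - δ) {n : ℤ} (hn : n ≠ 0) : ‖screenedTerm k Λ α z n‖ ≤
      Real.exp (-(k * Λ * (|(n : ℝ)| - 1))) * macdonald (k * δ) := by
  have h1 := abs_int_mul_sub_le hΛ hz n
  have h2 := one_le_abs_intCast hn
  rw [norm_screenedTerm]
  refine (macdonald_le (x := k * δ) (by positivity) ?_).trans ?_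
  · gcongr
    nlinarith
  · gcongr
    · exact macdonald_nonneg _
    · nlinarith

lemma norm_screenedTail_term_le {k Λ α δ : ℝ} (hk : 0 < k) (hΛ : 0 < Λ) (hδ : 0 < δ) {z : ℝ × ℝ}
    (hz : |z.1| ≤ Λ - δ) (n : ℤ) : ‖if n = 0 then 0 else screenedTerm k Λ α z n‖ ≤
      Real.exp (-(k * Λ * (|(n : ℝ)| - 1))) * macdonald (k * δ) := by
  split_ifs with hn
  · rw [norm_zero]
    exact mul_nonneg (Real.exp_nonneg _) (macdonald_nonneg _)
  · exact norm_screenedTerm_le hk hΛ hδ hz hn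

lemma continuousOn_screenedTail {k Λ α δ : ℝ} (hk : 0 < k) (hΛ : 0 < Λ) (hδ : 0 < δ) :
    ContinuousOn (screenedTail k Λ α) {z | |z.1| ≤ Λ - δ} := by
  refine continuousOn_tsum (fun n => ?_)
    (summable_exp_neg_mul_abs (c := k * Λ) (by positivity) (macdonald (k * δ)))
    fun n z hz => norm_screenedTail_term_le hk hΛ hδ hz n
  split_ifs with hn
  · exact continuousOn_const
  · refine ContinuousOn.mul (Complex.continuous_ofReal.comp_continuousOn
      (continuousOn_macdonald.comp (by fun_prop) fun z hz => ?_)) continuousOn_const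
    have h1 := abs_int_mul_sub_le hΛ hz n
    have h2 := one_le_abs_intCast hn
    refine mul_pos hk (lt_of_lt_of_le ?_ h1)
    nlinarith

lemma exists_norm_screenedTail_le {k Λ α δ : ℝ} (hk : 0 < k) (hΛ : 0 < Λ) (hδ : 0 < δ) :
    ∃ C, ∀ z : ℝ × ℝ, |z.1| ≤ Λ - δ → ‖screenedTail k Λ α z‖ ≤ C :=
  ⟨_, fun _ hz => tsum_of_norm_bounded
    (summable_exp_neg_mul_abs (c := k * Λ) (by positivity) (macdonald (k * δ))).hasSum
    fun n => norm_screenedTail_term_le hk hΛ hδ hz n⟩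

lemma hasSum_screenedTerm {k Λ α : ℝ} (hk : 0 < k) (hΛ : 0 < Λ) {z : ℝ × ℝ} (hz : |z.1| < Λ) :
    HasSum (screenedTerm k Λ α z)
      ((macdonald (k * √(z.1 ^ 2 + z.2 ^ 2)) : ℂ) + screenedTail k Λ α z) := by
  have h1 : Summable fun n : ℤ => if n = 0 then 0 else screenedTerm k Λ α z n :=
    Summable.of_norm_bounded
      (summable_exp_neg_mul_abs (c := k * Λ) (by positivity) (macdonald (k * (Λ - |z.1|))))
      fun n => norm_screenedTail_term_le hk hΛ (sub_pos.2 hz) (by simp) n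
  refine ((hasSum_ite_eq (0 : ℤ) (macdonald (k * √(z.1 ^ 2 + z.2 ^ 2)) : ℂ)).add
    h1.hasSum).congr_fun fun n => ?_
  split_ifs with hn
  · subst hn; simp [screenedTerm]
  · rw [zero_add]

lemma continuousOn_latticeRegular {k Λ α δ : ℝ} (hk : 0 < k) (hΛ : 0 < Λ) (hδ : 0 < δ)
    (hW : ∀ m : ℤ, |alphaMode Λ α m| ≠ k) :
    ContinuousOn (latticeRegular k Λ α) {z | |z.1| ≤ Λ - δ} :=
  (continuousOn_const.mul (continuousOn_screenedTail hk hΛ hδ)).add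
    (continuousOn_const.mul (continuous_regularSum hk hΛ hW).continuousOn)

lemma exists_norm_latticeRegular_le {k Λ α δ : ℝ} (hk : 0 < k) (hΛ : 0 < Λ) (hδ : 0 < δ)
    (hW : ∀ m : ℤ, |alphaMode Λ α m| ≠ k) :
    ∃ C, ∀ z : ℝ × ℝ, |z.1| ≤ Λ - δ → ‖latticeRegular k Λ α z‖ ≤ C := by
  obtain ⟨C₁, h₁⟩ := exists_norm_screenedTail_le (α := α) hk hΛ hδ
  obtain ⟨C₂, h₂⟩ := exists_norm_regularSum_le hk hΛ hW
  refine ⟨‖(1 / (2 * Real.pi) : ℂ)‖ * C₁ + ‖(1 / Λ : ℂ)‖ * C₂, fun z hz => ?_⟩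
  refine (norm_add_le _ _).trans ?_
  rw [norm_mul, norm_mul]
  gcongr
  · exact h₁ z hz
  · exact h₂ z

lemma sq_add_sq_pos_of_ne_zero {z : ℝ × ℝ} (h : z ≠ 0) : 0 < z.1 ^ 2 + z.2 ^ 2 := by
  refine lt_of_le_of_ne (by positivity) fun h0 => h (Prod.ext ?_ ?_)
  · exact pow_eq_zero_iff two_ne_zero |>.1 (by nlinarith [sq_nonneg z.1, sq_nonneg z.2])
  · exact pow_eq_zero_iff two_ne_zero |>.1 (by nlinarith [sq_nonneg z.1, sq_nonneg z.2])

lemma continuousAt_latticeGreen {k Λ α : ℝ} (hk : 0 < k) (hΛ : 0 < Λ)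
    (hW : ∀ m : ℤ, |alphaMode Λ α m| ≠ k) {z : ℝ × ℝ} (hz : |z.1| < Λ) (h0 : z ≠ 0) :
    ContinuousAt (latticeGreen k Λ α) z := by
  refine ContinuousAt.add (continuousAt_const.mul ?_) ?_
  · have hpos := sq_add_sq_pos_of_ne_zero h0
    refine Complex.continuous_ofReal.continuousAt.comp
      (ContinuousAt.comp (g := macdonald) (continuousOn_macdonald.continuousAt
        (Ioi_mem_nhds (mul_pos hk (Real.sqrt_pos.2 hpos)))) ?_)
    fun_prop
  · refine (continuousOn_latticeRegular hk hΛ (δ := (Λ - |z.1|) / 2) (by linarith) hW).continuousAt ?_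
    have : {z' : ℝ × ℝ | |z'.1| < Λ - (Λ - |z.1|) / 2} ∈ 𝓝 z :=
      (isOpen_lt (by fun_prop) continuous_const).mem_nhds (by
        change |z.1| < _; linarith)
    filter_upwards [this] with z' hz'
    exact le_of_lt hz'

lemma norm_sub_shift (x y : Plane) (s : ℝ) :
    ‖x - shift s y‖ = √((x 0 - y 0 - s) ^ 2 + (x 1 - y 1) ^ 2) := by
  rw [EuclideanSpace.norm_eq, Fin.sum_univ_two]
  simp only [shift, PiLp.sub_apply, Real.norm_eq_abs, sq_abs]
  simp [sub_sub]

/-- Each term splits as `(i/4) H₀⁽¹⁾ = (1/2π) (i(π/2) H₀⁽¹⁾ - K₀) + (1/2π) K₀`. The first part is a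
plane-wave integral and is summed conditionally by Poisson's formula; the second converges
absolutely. -/
theorem hasSum_greenTerm {k Λ α : ℝ} (hk : 0 < k) (hΛ : 0 < Λ)
    (hW : ∀ m : ℤ, |alphaMode Λ α m| ≠ k) {x y : Plane} (h : |x 0 - y 0| < Λ) (hxy : x ≠ y) :
    HasSum (greenTerm k Λ α x y) (latticeGreen k Λ α (x 0 - y 0, x 1 - y 1))
      (SummationFilter.conditional ℤ) := by
  set z : ℝ × ℝ := (x 0 - y 0, x 1 - y 1) with hz
  have h1 := (hasSum_conditional_integral_profileDiff hk hΛ hW z).mul_left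
    (1 / (2 * Real.pi) : ℂ)
  have h2 : HasSum (screenedTerm k Λ α z)
      ((macdonald (k * √(z.1 ^ 2 + z.2 ^ 2)) : ℂ) + screenedTail k Λ α z)
      (SummationFilter.conditional ℤ) :=
    (hasSum_screenedTerm hk hΛ h).mono_left SummationFilter.LeAtTop.le_atTop
  have h3 := h1.add (h2.mul_left (1 / (2 * Real.pi) : ℂ))
  -- No translate of `y` meets `x`: for `n ≠ 0` because `|x 0 - y 0| < Λ`, for `n = 0` because `x ≠
  -- y`.
  have hpos : ∀ n : ℤ, 0 < (z.1 - n * Λ) ^ 2 + z.2 ^ 2 := by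
    intro n
    by_contra hn
    have e1 : z.1 - n * Λ = 0 := by nlinarith [sq_nonneg (z.1 - n * Λ), sq_nonneg z.2]
    have e2 : z.2 = 0 := by nlinarith [sq_nonneg (z.1 - n * Λ), sq_nonneg z.2]
    have hn0 : n = 0 := by
      by_contra hn0
      have h4 := one_le_abs_intCast hn0
      have h5 : |z.1| = |(n : ℝ)| * Λ := by
        rw [sub_eq_zero.1 e1, abs_mul, abs_of_pos hΛ]
      have h6 : |z.1| < Λ := h
      nlinarith
    rw [hn0] at e1
    refine hxy ?_
    ext i
    fin_cases i
    · simpa [hz, sub_eq_zero] using e1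
    · simpa [hz, sub_eq_zero] using e2
  have hval : (1 / (2 * Real.pi) : ℂ) * (2 * Real.pi / Λ * regularSum k Λ α z) +
      1 / (2 * Real.pi) * ((macdonald (k * √(z.1 ^ 2 + z.2 ^ 2)) : ℂ) + screenedTail k Λ α z) =
      latticeGreen k Λ α z := by
    rw [latticeGreen, latticeRegular]
    have : (Real.pi : ℂ) ≠ 0 := by exact_mod_cast Real.pi_ne_zero
    field_simp
    ring
  rw [hval] at h3
  refine h3.congr_fun fun n => ?_
  rw [integral_profileDiff_abs hk (hpos n), greenTerm, norm_sub_shift, screenedTerm]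
  have : (Real.pi : ℂ) ≠ 0 := by exact_mod_cast Real.pi_ne_zero
  field_simp
  ring

theorem qpGreen_eq {k Λ α : ℝ} (hk : 0 < k) (hΛ : 0 < Λ)
    (hW : ∀ m : ℤ, |alphaMode Λ α m| ≠ k) {x y : Plane} (h : |x 0 - y 0| < Λ) (hxy : x ≠ y) :
    qpGreen k Λ α x y = latticeGreen k Λ α (x 0 - y 0, x 1 - y 1) :=
  (hasSum_greenTerm hk hΛ hW h hxy).tsum_eq


/-! ### Fourier coefficients of the lattice Green's function -/

lemma hasSum_intervalIntegral_translates {E : Type*} [NormedAddCommGroup E] [NormedSpace ℝ E]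
    {F : ℝ → E} (hF : Integrable F) {Λ : ℝ} (hΛ : 0 < Λ) (c : ℝ) :
    HasSum (fun n : ℤ => ∫ t in c..(c + Λ), F (t - n * Λ)) (∫ t, F t) := by
  have h1 := ((hF.comp_mul_left' hΛ.ne').hasSum_intervalIntegral (c / Λ)).const_smul Λ
  rw [Measure.integral_comp_mul_left, abs_of_pos (inv_pos.2 hΛ), smul_smul,
    mul_inv_cancel₀ hΛ.ne', one_smul] at h1
  rw [← (Equiv.neg ℤ).hasSum_iff] at h1
  refine h1.congr_fun fun n => ?_
  simp only [Function.comp, Equiv.neg_apply]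
  rw [intervalIntegral.integral_comp_mul_left _ hΛ.ne', smul_smul, mul_inv_cancel₀ hΛ.ne',
    one_smul, intervalIntegral.integral_comp_sub_right]
  congr 1
  · push_cast; field_simp; ring
  · push_cast; field_simp; ring

/-- The exponential decay is weakened to `e^{-u} ≤ 1 / (1 + u² / 2)` with `u = k |t|`, which is a
multiple of `1 / (t² + 2 / k²)`; this explains the width `√2 / k`. -/
lemma macdonald_sqrt_le {k s : ℝ} (hk : 0 < k) (hs : s ≠ 0) (t : ℝ) :
    macdonald (k * √(t ^ 2 + s ^ 2)) ≤
      Real.exp (k * |s|) * macdonald (k * |s|) * (2 / k ^ 2) * (t ^ 2 + (√2 / k) ^ 2)⁻¹ := by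
  have hs0 : 0 < |s| := abs_pos.2 hs
  have h1 : |s| ≤ √(t ^ 2 + s ^ 2) := Real.abs_le_sqrt (by nlinarith)
  have h2 : |t| ≤ √(t ^ 2 + s ^ 2) := Real.abs_le_sqrt (by nlinarith)
  refine (macdonald_le (x := k * |s|) (by positivity) (by gcongr)).trans ?_
  have hM := macdonald_nonneg (k * |s|)
  have h3 : Real.exp (-(k * √(t ^ 2 + s ^ 2) - k * |s|)) ≤
      Real.exp (k * |s|) * Real.exp (-(k * |t|)) := by
    rw [← Real.exp_add]
    gcongr
    nlinarith
  have h4 : Real.exp (-(k * |t|)) ≤ 2 / k ^ 2 * (t ^ 2 + (√2 / k) ^ 2)⁻¹ := by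
    have h5 := Real.quadratic_le_exp_of_nonneg (x := k * |t|) (by positivity)
    have h6 : (2 / k ^ 2 * (t ^ 2 + (√2 / k) ^ 2)⁻¹) = (1 + (k * |t|) ^ 2 / 2)⁻¹ := by
      rw [div_pow, Real.sq_sqrt (by norm_num), mul_pow, sq_abs]
      field_simp
      ring
    rw [h6, Real.exp_neg]
    gcongr
    have : 0 ≤ k * |t| := by positivity
    linarith
  calc _ ≤ Real.exp (k * |s|) * Real.exp (-(k * |t|)) * macdonald (k * |s|) := by gcongr
    _ ≤ Real.exp (k * |s|) * (2 / k ^ 2 * (t ^ 2 + (√2 / k) ^ 2)⁻¹) * macdonald (k * |s|) := by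
      gcongr
    _ = _ := by ring

lemma continuous_macdonald_sqrt {k s : ℝ} (hk : 0 < k) (hs : s ≠ 0) :
    Continuous fun t : ℝ => macdonald (k * √(t ^ 2 + s ^ 2)) :=
  continuousOn_macdonald.comp_continuous (by fun_prop) fun t =>
    mul_pos hk (Real.sqrt_pos.2 (by positivity))

lemma integrable_macdonald_sqrt {k s : ℝ} (hk : 0 < k) (hs : s ≠ 0) :
    Integrable fun t : ℝ => macdonald (k * √(t ^ 2 + s ^ 2)) := by
  refine Integrable.mono' ((integrable_inv_sq_add_sq (k := √2 / k) (by positivity)).const_mul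
    (Real.exp (k * |s|) * macdonald (k * |s|) * (2 / k ^ 2)))
    (continuous_macdonald_sqrt hk hs).aestronglyMeasurable (Eventually.of_forall fun t => ?_)
  rw [Real.norm_eq_abs, abs_of_nonneg (macdonald_nonneg _)]
  exact macdonald_sqrt_le hk hs t

/-- Fourier inversion for the screened potential. -/
lemma integral_macdonald_mul_exp {k s : ℝ} (hk : 0 < k) (hs : s ≠ 0) (ξ : ℝ) :
    ∫ t, (macdonald (k * √(t ^ 2 + s ^ 2)) : ℂ) * Complex.exp (Complex.I * (-(ξ * t) : ℝ)) =
      2 * Real.pi * profile |s| (decayI k ξ) := by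
  have hs0 : 0 < |s| := abs_pos.2 hs
  set φ : ℝ → ℂ := fun ξ => profile |s| (decayI k ξ) with hφ
  have hP : ∀ t, ∫ ξ, φ ξ * Complex.exp (Complex.I * (ξ * t : ℝ)) =
      macdonald (k * √(t ^ 2 + s ^ 2)) := fun t => by
    rw [← sq_abs s]; exact integral_profile_decayI hk hs0 t
  have hF : ∀ t, FourierTransform.fourier φ t =
      macdonald (k * √((-(2 * Real.pi) * t) ^ 2 + s ^ 2)) := fun t => by
    rw [Real.fourier_eq', ← hP]
    refine integral_congr_ae (Eventually.of_forall fun v => ?_)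
    simp only [smul_eq_mul, RCLike.inner_apply, conj_trivial]
    rw [mul_comm]
    congr 2
    push_cast
    ring
  have hFi : ∀ t, FourierTransformInv.fourierInv φ t =
      macdonald (k * √((2 * Real.pi * t) ^ 2 + s ^ 2)) := fun t => by
    rw [Real.fourierInv_eq', ← hP]
    refine integral_congr_ae (Eventually.of_forall fun v => ?_)
    simp only [smul_eq_mul, RCLike.inner_apply, conj_trivial]
    rw [mul_comm]
    congr 2
    push_cast
    ring
  have hi : Integrable (FourierTransform.fourier φ) := by
    have h1 : Integrable fun t : ℝ => macdonald (k * √((-(2 * Real.pi) * t) ^ 2 + s ^ 2)) :=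
      (integrable_macdonald_sqrt hk hs).comp_mul_left' (by simp [Real.pi_ne_zero])
    exact h1.ofReal.congr (Eventually.of_forall fun t => (hF t).symm)
  have key := congr_fun (Continuous.fourier_fourierInv_eq (continuous_profile_decayI hk |s|)
    (integrable_profile_decayI hk hs0) hi) ξ
  rw [Real.fourier_eq', ← hφ] at key
  change _ = φ ξ at key
  have h2 := Measure.integral_comp_mul_left (fun t : ℝ => (macdonald (k * √(t ^ 2 + s ^ 2)) : ℂ) *
    Complex.exp (Complex.I * (-(ξ * t) : ℝ))) (2 * Real.pi)
  rw [abs_of_pos (by positivity)] at h2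
  have h3 : ∫ t : ℝ, (macdonald (k * √((2 * Real.pi * t) ^ 2 + s ^ 2)) : ℂ) *
      Complex.exp (Complex.I * (-(ξ * (2 * Real.pi * t)) : ℝ)) = φ ξ := by
    rw [← key]
    refine integral_congr_ae (Eventually.of_forall fun v => ?_)
    simp only [smul_eq_mul, RCLike.inner_apply, conj_trivial, hFi]
    rw [mul_comm]
    congr 2
    push_cast
    ring
  rw [h3, Complex.real_smul] at h2
  change φ ξ = _ at h2
  have : (Real.pi : ℂ) ≠ 0 := by exact_mod_cast Real.pi_ne_zero
  change _ = 2 * (Real.pi : ℂ) * φ ξ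
  rw [h2]
  push_cast
  field_simp

lemma integral_exp_alphaMode {Λ α : ℝ} (hΛ : 0 < Λ) (c : ℝ) (m n : ℤ) :
    ∫ t in c..(c + Λ), Complex.exp (Complex.I * (alphaMode Λ α n * t : ℝ)) *
      Complex.exp (Complex.I * (-(alphaMode Λ α m * t) : ℝ)) = if n = m then (Λ : ℂ) else 0 := by
  have h := intervalIntegral.integral_comp_mul_left (a := c / Λ) (b := c / Λ + 1)
    (fun t : ℝ => Complex.exp (Complex.I * (alphaMode Λ α n * t : ℝ)) *
      Complex.exp (Complex.I * (-(alphaMode Λ α m * t) : ℝ))) hΛ.ne'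
  have e : ∀ t : ℝ, Complex.exp (Complex.I * (alphaMode Λ α n * (Λ * t) : ℝ)) *
      Complex.exp (Complex.I * (-(alphaMode Λ α m * (Λ * t)) : ℝ)) = intChar (m - n) t := by
    intro t
    rw [← Complex.exp_add, intChar]
    congr 1
    unfold alphaMode
    push_cast
    have : (Λ : ℂ) ≠ 0 := by exact_mod_cast hΛ.ne'
    field_simp
    ring
  simp only [e] at h
  rw [integral_intChar, mul_add, mul_one, mul_div_cancel₀ _ hΛ.ne'] at h
  have h2 := congrArg (fun w => Λ • w) h
  simp only [smul_smul, mul_inv_cancel₀ hΛ.ne', one_smul] at h2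
  rw [← h2]
  simp only [sub_eq_zero, eq_comm (a := m)]
  split_ifs <;> simp

lemma integral_regularSum_mul_exp {k Λ α : ℝ} (hk : 0 < k) (hΛ : 0 < Λ)
    (hW : ∀ m : ℤ, |alphaMode Λ α m| ≠ k) (c s : ℝ) (m : ℤ) :
    ∫ t in c..(c + Λ), regularSum k Λ α (t, s) *
      Complex.exp (Complex.I * (-(alphaMode Λ α m * t) : ℝ)) =
      Λ * profileDiff k |s| (alphaMode Λ α m) := by
  obtain ⟨C, hC, hb⟩ := norm_profileDiff_alphaMode_le hk hΛ hW
  have h := intervalIntegral.hasSum_integral_of_dominated_convergence (μ := volume)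
    (a := c) (b := c + Λ)
    (F := fun (n : ℤ) (t : ℝ) => profileDiff k |s| (alphaMode Λ α n) *
      Complex.exp (Complex.I * (alphaMode Λ α n * t : ℝ)) *
      Complex.exp (Complex.I * (-(alphaMode Λ α m * t) : ℝ)))
    (f := fun t => regularSum k Λ α (t, s) *
      Complex.exp (Complex.I * (-(alphaMode Λ α m * t) : ℝ)))
    (fun n _ => C * (1 + (n : ℝ) ^ 2)⁻¹)
    (fun n => Continuous.aestronglyMeasurable (by fun_prop))
    (fun n => Eventually.of_forall fun t _ => by
      rw [norm_mul, norm_mul, norm_exp_I_mul_ofReal, norm_exp_I_mul_ofReal, mul_one, mul_one]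
      exact hb _ n (abs_nonneg _))
    (Eventually.of_forall fun t _ => summable_regularSum_bound C)
    intervalIntegrable_const
    (Eventually.of_forall fun t _ => by
      refine HasSum.mul_right _ (Summable.hasSum ?_)
      refine Summable.of_norm_bounded (summable_regularSum_bound C) fun n => ?_
      rw [norm_mul, norm_exp_I_mul_ofReal, mul_one]
      exact hb _ n (abs_nonneg _))
  have e : ∀ n : ℤ, ∫ t in c..(c + Λ), profileDiff k |s| (alphaMode Λ α n) *
      Complex.exp (Complex.I * (alphaMode Λ α n * t : ℝ)) *
      Complex.exp (Complex.I * (-(alphaMode Λ α m * t) : ℝ)) =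
      if n = m then Λ * profileDiff k |s| (alphaMode Λ α m) else 0 := by
    intro n
    simp only [mul_assoc]
    rw [intervalIntegral.integral_const_mul, integral_exp_alphaMode hΛ]
    split_ifs with h1
    · rw [h1, mul_comm]
    · simp
  simp only [e] at h
  exact h.unique (hasSum_ite_eq m _)

/-- Unfolding: `e^{-iα_m nΛ} = e^{-iαnΛ}`, so multiplying by the conjugate mode turns the `n`-th
term into a translate by `nΛ` of one function. The cell integrals then add up to the Fourier
integral over the whole line. -/
lemma integral_screened_mul_exp {k Λ α : ℝ} (hk : 0 < k) (hΛ : 0 < Λ) {c s : ℝ} (hs : s ≠ 0)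
    (hc : -Λ < c) (hc' : c < 0) (m : ℤ) :
    ∫ t in c..(c + Λ), ((macdonald (k * √(t ^ 2 + s ^ 2)) : ℂ) + screenedTail k Λ α (t, s)) *
      Complex.exp (Complex.I * (-(alphaMode Λ α m * t) : ℝ)) =
      2 * Real.pi * profile |s| (decayI k (alphaMode Λ α m)) := by
  rw [← integral_macdonald_mul_exp hk hs]
  set P : ℝ → ℝ := fun t => macdonald (k * √(t ^ 2 + s ^ 2)) with hP
  have hPi : Integrable P := integrable_macdonald_sqrt hk hs
  have hPc : Continuous P := continuous_macdonald_sqrt hk hs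
  have hQi : Integrable fun t : ℝ => (P t : ℂ) *
      Complex.exp (Complex.I * (-(alphaMode Λ α m * t) : ℝ)) :=
    hPi.ofReal.mul_bdd (c := 1) (Continuous.aestronglyMeasurable (by fun_prop))
      (Eventually.of_forall fun t => (norm_exp_I_mul_ofReal _).le)
  have hle : c ≤ c + Λ := by linarith
  have hterm : ∀ (n : ℤ) (t : ℝ), screenedTerm k Λ α (t, s) n *
      Complex.exp (Complex.I * (-(alphaMode Λ α m * t) : ℝ)) = (P (t - n * Λ) : ℂ) *
      Complex.exp (Complex.I * (-(alphaMode Λ α m * (t - n * Λ)) : ℝ)) := by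
    intro n t
    rw [screenedTerm, mul_assoc, ← Complex.exp_add]
    congr 1
    rw [Complex.exp_eq_exp_iff_exists_int]
    refine ⟨-(n * m), ?_⟩
    unfold alphaMode
    push_cast
    have : (Λ : ℂ) ≠ 0 := by exact_mod_cast hΛ.ne'
    field_simp
    ring
  have h1 := hasSum_integral_of_summable_integral_norm (μ := volume.restrict (Ioc c (c + Λ)))
    (F := fun (n : ℤ) (t : ℝ) => (P (t - n * Λ) : ℂ) *
      Complex.exp (Complex.I * (-(alphaMode Λ α m * (t - n * Λ)) : ℝ)))
    (fun n => (Continuous.integrableOn_Ioc (by fun_prop))) (by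
      have h2 := (hasSum_intervalIntegral_translates hPi hΛ c).summable
      refine h2.congr fun n => ?_
      rw [intervalIntegral.integral_of_le hle]
      refine integral_congr_ae (Eventually.of_forall fun t => ?_)
      simp only [norm_mul, norm_exp_I_mul_ofReal, mul_one, Complex.norm_real, Real.norm_eq_abs]
      exact (abs_of_nonneg (macdonald_nonneg _)).symm)
  have h3 := hasSum_intervalIntegral_translates hQi hΛ c
  simp only [intervalIntegral.integral_of_le hle] at h3
  rw [← h1.unique h3, intervalIntegral.integral_of_le hle, integral_Ioc_eq_integral_Ioo,
    integral_Ioc_eq_integral_Ioo]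
  refine setIntegral_congr_fun measurableSet_Ioo fun t ht => ?_
  have ht' : |t| < Λ := abs_lt.2 ⟨by linarith [ht.1], by linarith [ht.2]⟩
  have h4 := (hasSum_screenedTerm (α := α) (z := (t, s)) hk hΛ ht').mul_right
    (Complex.exp (Complex.I * (-(alphaMode Λ α m * t) : ℝ)))
  simp only [hterm] at h4
  exact h4.tsum_eq.symm

/-- The screened sum contributes the `decayI` profile and the regular sum contributes `profileDiff`,
so the screening cancels and the outgoing profile is left. The conditions on `c` keep the period
interval inside `|t| < Λ`. -/
theorem integral_latticeGreen_mul_exp {k Λ α : ℝ} (hk : 0 < k) (hΛ : 0 < Λ)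
    (hW : ∀ m : ℤ, |alphaMode Λ α m| ≠ k) {c s : ℝ} (hs : s ≠ 0)
    (hc : -Λ < c) (hc' : c < 0) (m : ℤ) :
    ∫ t in c..(c + Λ), latticeGreen k Λ α (t, s) *
      Complex.exp (Complex.I * (-(alphaMode Λ α m * t) : ℝ)) =
      profile |s| (decay k (alphaMode Λ α m)) := by
  have hle : c ≤ c + Λ := by linarith
  set δ := min (-c) (c + Λ) with hδ
  have hδ0 : 0 < δ := lt_min (by linarith) (by linarith)
  have hsub : ∀ t ∈ uIcc c (c + Λ), |t| ≤ Λ - δ := fun t ht => by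
    rw [uIcc_of_le hle] at ht
    have h1 := min_le_left (-c) (c + Λ)
    have h2 := min_le_right (-c) (c + Λ)
    rw [abs_le]
    constructor <;> linarith [ht.1, ht.2]
  have e : ∀ t : ℝ, latticeGreen k Λ α (t, s) *
      Complex.exp (Complex.I * (-(alphaMode Λ α m * t) : ℝ)) =
      1 / (2 * Real.pi) * (((macdonald (k * √(t ^ 2 + s ^ 2)) : ℂ) + screenedTail k Λ α (t, s)) *
        Complex.exp (Complex.I * (-(alphaMode Λ α m * t) : ℝ))) +
      1 / Λ * (regularSum k Λ α (t, s) *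
        Complex.exp (Complex.I * (-(alphaMode Λ α m * t) : ℝ))) := fun t => by
    rw [latticeGreen, latticeRegular]; ring
  simp only [e]
  have i1 : IntervalIntegrable (fun t : ℝ => 1 / (2 * (Real.pi : ℂ)) *
      (((macdonald (k * √(t ^ 2 + s ^ 2)) : ℂ) + screenedTail k Λ α (t, s)) *
        Complex.exp (Complex.I * (-(alphaMode Λ α m * t) : ℝ)))) volume c (c + Λ) := by
    refine ContinuousOn.intervalIntegrable (continuousOn_const.mul (ContinuousOn.mul
      (ContinuousOn.add ?_ ?_) (Continuous.continuousOn (by fun_prop))))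
    · exact (Complex.continuous_ofReal.comp (continuous_macdonald_sqrt hk hs)).continuousOn
    · exact (continuousOn_screenedTail hk hΛ hδ0).comp (Continuous.continuousOn (by fun_prop)) hsub
  have i2 : IntervalIntegrable (fun t : ℝ => 1 / (Λ : ℂ) * (regularSum k Λ α (t, s) *
        Complex.exp (Complex.I * (-(alphaMode Λ α m * t) : ℝ)))) volume c (c + Λ) := by
    refine Continuous.intervalIntegrable (continuous_const.mul (Continuous.mul
      ((continuous_regularSum hk hΛ hW).comp (by fun_prop)) (by fun_prop))) _ _
  rw [intervalIntegral.integral_add i1 i2, intervalIntegral.integral_const_mul,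
    intervalIntegral.integral_const_mul, integral_screened_mul_exp hk hΛ hs hc hc',
    integral_regularSum_mul_exp hk hΛ hW, profileDiff]
  have h1 : (Real.pi : ℂ) ≠ 0 := by exact_mod_cast Real.pi_ne_zero
  have h2 : (Λ : ℂ) ≠ 0 := by exact_mod_cast hΛ.ne'
  field_simp
  ring


/-! ### Potentials of the lattice Green's function -/

/-- A Gaussian bound from `cosh t ≥ 1 + t² / 2`. The true singularity is logarithmic, but `x^{-1/2}`
is enough, since it is locally integrable in one variable. -/
lemma macdonald_le_inv_sqrt {x : ℝ} (hx : 0 < x) : macdonald x ≤ 1 / 2 * √(2 * Real.pi) * (√x)⁻¹ := by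
  have h1 : ∫ t : ℝ, Real.exp (-(x * Real.cosh t)) ≤ ∫ t : ℝ, Real.exp (-(x / 2) * t ^ 2) := by
    refine integral_mono_of_nonneg (Eventually.of_forall fun t => Real.exp_nonneg _)
      (integrable_exp_neg_mul_sq (by positivity)) (Eventually.of_forall fun t => ?_)
    have := one_add_sq_le_cosh t
    simp only
    gcongr
    nlinarith
  rw [integral_gaussian] at h1
  have h2 : √(Real.pi / (x / 2)) = √(2 * Real.pi) * (√x)⁻¹ := by
    rw [← Real.sqrt_inv, ← Real.sqrt_mul (by positivity)]
    congr 1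
    field_simp
  rw [h2] at h1
  rw [macdonald, mul_assoc]
  gcongr

lemma measurable_macdonald : Measurable macdonald := by
  have h : StronglyMeasurable fun x : ℝ => ∫ t : ℝ, Real.exp (-(x * Real.cosh t)) :=
    StronglyMeasurable.integral_prod_right (f := fun x t : ℝ => Real.exp (-(x * Real.cosh t)))
      (Continuous.stronglyMeasurable (by unfold Function.uncurry; fun_prop))
  exact h.measurable.const_mul _

/-- An integrable majorant, up to constants, of the logarithmic singularity. -/
def singularMajorant (t : ℝ) : ℝ :=
  1 + (Icc (0 - 1) (0 + 1)).indicator (fun ξ : ℝ => (√|ξ - 0|)⁻¹) t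

lemma one_le_singularMajorant (t : ℝ) : 1 ≤ singularMajorant t :=
  le_add_of_nonneg_right (indicator_nonneg (fun _ _ => by positivity) _)

lemma norm_latticeGreen_le {k Λ α δ : ℝ} (hk : 0 < k) (hΛ : 0 < Λ) (hδ : 0 < δ)
    (hW : ∀ m : ℤ, |alphaMode Λ α m| ≠ k) :
    ∃ C, 0 ≤ C ∧ ∀ z : ℝ × ℝ, |z.1| ≤ Λ - δ → z.1 ≠ 0 →
      ‖latticeGreen k Λ α z‖ ≤ C * singularMajorant z.1 := by
  obtain ⟨C, hC⟩ := exists_norm_latticeRegular_le (α := α) hk hΛ hδ hW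
  set B := 1 / (2 * Real.pi) * (1 / 2 * √(2 * Real.pi) * (√k)⁻¹) with hB
  have hB0 : 0 ≤ B := by positivity
  refine ⟨B + |C|, by positivity, fun z hz h0 => ?_⟩
  have habs : 0 < |z.1| := abs_pos.2 h0
  have h1 : macdonald (k * √(z.1 ^ 2 + z.2 ^ 2)) ≤
      1 / 2 * √(2 * Real.pi) * (√k)⁻¹ * singularMajorant z.1 := by
    have h2 : k * |z.1| ≤ k * √(z.1 ^ 2 + z.2 ^ 2) := by
      gcongr
      exact Real.abs_le_sqrt (by nlinarith [sq_nonneg z.2])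
    refine (macdonald_le_inv_sqrt (lt_of_lt_of_le (by positivity) h2)).trans ?_
    rw [mul_assoc (1 / 2 * √(2 * Real.pi))]
    refine mul_le_mul_of_nonneg_left ?_ (by positivity)
    calc (√(k * √(z.1 ^ 2 + z.2 ^ 2)))⁻¹ ≤ (√(k * |z.1|))⁻¹ := by gcongr
      _ = (√k)⁻¹ * (√|z.1 - 0|)⁻¹ := by rw [Real.sqrt_mul hk.le, mul_inv, sub_zero]
      _ ≤ _ := by gcongr; exact inv_sqrt_abs_le z.1 0
  have h3 := one_le_singularMajorant z.1
  rw [latticeGreen]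
  refine (norm_add_le _ _).trans ?_
  rw [norm_mul, Complex.norm_real, Real.norm_eq_abs, abs_of_nonneg (macdonald_nonneg _)]
  have h4 : ‖(1 / (2 * Real.pi) : ℂ)‖ = 1 / (2 * Real.pi) := by
    rw [show (1 / (2 * Real.pi) : ℂ) = ((1 / (2 * Real.pi) : ℝ) : ℂ) by push_cast; rfl,
      Complex.norm_real, Real.norm_eq_abs, abs_of_pos (by positivity)]
  rw [h4]
  calc _ ≤ 1 / (2 * Real.pi) * (1 / 2 * √(2 * Real.pi) * (√k)⁻¹ * singularMajorant z.1) +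
        |C| * 1 := by
        rw [mul_one]
        gcongr
        exact (hC z hz).trans (le_abs_self _)
    _ ≤ B * singularMajorant z.1 + |C| * singularMajorant z.1 := by
        rw [hB, mul_assoc (1 / (2 * Real.pi))]
        gcongr
    _ = _ := by ring

/-- The regular part is controlled only for `|z.1| < Λ`. Setting it to zero elsewhere gives a
globally measurable kernel that agrees with `latticeGreen` at all differences of points of the cell.
-/
def cutGreen (k Λ α : ℝ) (z : ℝ × ℝ) : ℂ :=
  1 / (2 * Real.pi) * (macdonald (k * √(z.1 ^ 2 + z.2 ^ 2)) : ℂ) +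
    {z : ℝ × ℝ | |z.1| < Λ}.indicator (latticeRegular k Λ α) z

lemma cutGreen_eq {k Λ α : ℝ} {z : ℝ × ℝ} (hz : |z.1| < Λ) :
    cutGreen k Λ α z = latticeGreen k Λ α z := by
  rw [cutGreen, latticeGreen, indicator_of_mem (show z ∈ {z : ℝ × ℝ | |z.1| < Λ} from hz)]

lemma measurable_cutGreen {k Λ α : ℝ} (hk : 0 < k) (hΛ : 0 < Λ)
    (hW : ∀ m : ℤ, |alphaMode Λ α m| ≠ k) : Measurable (cutGreen k Λ α) := by
  classical
  refine Measurable.add ?_ ?_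
  · exact (Complex.measurable_ofReal.comp (measurable_macdonald.comp (by fun_prop))).const_mul _
  · rw [← piecewise_eq_indicator]
    refine ContinuousOn.measurable_piecewise (fun z hz => ?_) continuousOn_const
      (measurableSet_lt (by fun_prop) measurable_const)
    refine (((continuousOn_latticeRegular (α := α) hk hΛ (δ := (Λ - |z.1|) / 2)
      (by linarith [show |z.1| < Λ from hz]) hW).continuousAt ?_)).continuousWithinAt
    have : {z' : ℝ × ℝ | |z'.1| < Λ - (Λ - |z.1|) / 2} ∈ 𝓝 z :=
      (isOpen_lt (by fun_prop) continuous_const).mem_nhds (by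
        change |z.1| < Λ at hz
        change |z.1| < _; linarith)
    filter_upwards [this] with z' hz'
    exact le_of_lt hz'

/-- The interval `(-Λ/2, Λ/2)` with Lebesgue measure. -/
def cellMeasure (Λ : ℝ) : Measure ℝ := volume.restrict (Ioo (-Λ / 2) (Λ / 2))

instance (Λ : ℝ) : IsFiniteMeasure (cellMeasure Λ) := by
  unfold cellMeasure; infer_instance

lemma ae_cellMeasure (Λ : ℝ) : ∀ᵐ t ∂cellMeasure Λ, t ∈ Ioo (-Λ / 2) (Λ / 2) :=
  ae_restrict_mem measurableSet_Ioo

def latticePotential (k Λ α : ℝ) (F : ℝ × ℝ → ℂ) (p : ℝ × ℝ) : ℂ :=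
  ∫ q, latticeGreen k Λ α (p - q) * F q

lemma latticePotential_kernel_eq {k Λ α δ : ℝ} (hδ : 0 < δ) {F : ℝ × ℝ → ℂ}
    (hF : ∀ q, F q ≠ 0 → |q.1| ≤ Λ / 2 - δ) {p : ℝ × ℝ} (hp : p.1 ∈ Ioo (-Λ / 2) (Λ / 2)) (q : ℝ × ℝ) :
    cutGreen k Λ α (p - q) * F q = latticeGreen k Λ α (p - q) * F q := by
  by_cases h : F q = 0
  · rw [h, mul_zero, mul_zero]
  · have h1 := abs_le.1 (hF q h)
    rw [cutGreen_eq]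
    change |p.1 - q.1| < Λ
    rw [abs_lt]
    constructor <;> linarith [hp.1, hp.2]

lemma aestronglyMeasurable_latticePotential {k Λ α δ : ℝ} (hk : 0 < k) (hΛ : 0 < Λ) (hδ : 0 < δ)
    (hW : ∀ m : ℤ, |alphaMode Λ α m| ≠ k) {F : ℝ × ℝ → ℂ} (hFm : AEStronglyMeasurable F)
    (hF : ∀ q, F q ≠ 0 → |q.1| ≤ Λ / 2 - δ) :
    AEStronglyMeasurable (latticePotential k Λ α F) ((cellMeasure Λ).prod volume) := by
  have h1 : AEStronglyMeasurable (fun z : (ℝ × ℝ) × (ℝ × ℝ) => cutGreen k Λ α (z.1 - z.2) * F z.2)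
      (((cellMeasure Λ).prod volume).prod volume) :=
    ((measurable_cutGreen hk hΛ hW).comp (measurable_fst.sub measurable_snd)).aestronglyMeasurable.mul
      hFm.comp_snd
  refine h1.integral_prod_right'.congr ?_
  filter_upwards [Measure.quasiMeasurePreserving_fst.ae (ae_cellMeasure Λ)] with p hp
  exact integral_congr_ae (Eventually.of_forall fun q => latticePotential_kernel_eq hδ hF hp q)

lemma integrable_singularMajorant_sub {Λ : ℝ} (c : ℝ) :
    Integrable (fun t => singularMajorant (t - c)) (cellMeasure Λ) :=
  (integrable_const 1).add ((integrable_indicator_abs_rpow 0).comp_sub_right c).integrableOn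

lemma exists_integral_singularMajorant_le (Λ : ℝ) :
    ∃ C, ∀ c : ℝ, ∫ t, singularMajorant (t - c) ∂cellMeasure Λ ≤ C := by
  refine ⟨(cellMeasure Λ).real univ + ∫ t, (Icc (0 - 1) (0 + 1)).indicator
    (fun ξ : ℝ => (√|ξ - 0|)⁻¹) t, fun c => ?_⟩
  have hi := (integrable_indicator_abs_rpow 0).comp_sub_right c
  have h2 : ∫ t, singularMajorant (t - c) ∂cellMeasure Λ = (cellMeasure Λ).real univ +
      ∫ t, (Icc (0 - 1) (0 + 1)).indicator (fun ξ : ℝ => (√|ξ - 0|)⁻¹) (t - c) ∂cellMeasure Λ := by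
    unfold singularMajorant
    rw [integral_add (μ := cellMeasure Λ) (integrable_const 1) hi.integrableOn]
    simp
  rw [h2]
  refine add_le_add_right ?_ _
  rw [← integral_sub_right_eq_self (μ := volume) _ c]
  exact setIntegral_le_integral hi (Eventually.of_forall fun t =>
    indicator_nonneg (fun _ _ => by positivity) _)

/-- The majorant of the kernel involves the first coordinate alone and is integrated over `t` first,
uniformly in `q`. This yields Fubini on every horizontal line, even one that crosses the sources. -/
lemma integrable_latticeGreen_mul {k Λ α δ : ℝ} (hk : 0 < k) (hΛ : 0 < Λ) (hδ : 0 < δ)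
    (hW : ∀ m : ℤ, |alphaMode Λ α m| ≠ k) {F : ℝ × ℝ → ℂ} (hFi : Integrable F)
    (hF : ∀ q, F q ≠ 0 → |q.1| ≤ Λ / 2 - δ) (s : ℝ) :
    Integrable (fun z : ℝ × (ℝ × ℝ) => latticeGreen k Λ α ((z.1, s) - z.2) * F z.2)
      ((cellMeasure Λ).prod volume) := by
  have h1 : AEStronglyMeasurable (fun z : ℝ × (ℝ × ℝ) => cutGreen k Λ α ((z.1, s) - z.2) * F z.2)
      ((cellMeasure Λ).prod volume) :=
    ((measurable_cutGreen hk hΛ hW).comp (by fun_prop)).aestronglyMeasurable.mul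
      hFi.aestronglyMeasurable.comp_snd
  have h2 : AEStronglyMeasurable (fun z : ℝ × (ℝ × ℝ) =>
      latticeGreen k Λ α ((z.1, s) - z.2) * F z.2) ((cellMeasure Λ).prod volume) := by
    refine h1.congr ?_
    filter_upwards [Measure.quasiMeasurePreserving_fst.ae (ae_cellMeasure Λ)] with p hp
    exact latticePotential_kernel_eq hδ hF (p := (p.1, s)) hp p.2
  obtain ⟨C, hC0, hC⟩ := norm_latticeGreen_le (α := α) hk hΛ hδ hW
  obtain ⟨I, hI⟩ := exists_integral_singularMajorant_le Λ
  have hb : ∀ q : ℝ × ℝ, ∀ᵐ t ∂cellMeasure Λ, ‖latticeGreen k Λ α ((t, s) - q) * F q‖ ≤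
      C * ‖F q‖ * singularMajorant (t - q.1) := by
    intro q
    have hne : ∀ᵐ t ∂cellMeasure Λ, t ≠ q.1 :=
      ae_restrict_of_ae (Measure.ae_ne volume q.1)
    filter_upwards [ae_cellMeasure Λ, hne] with t ht htq
    by_cases h : F q = 0
    · simp [h]
    · have h3 := abs_le.1 (hF q h)
      rw [norm_mul, mul_right_comm]
      gcongr
      refine hC ((t, s) - q) ?_ (sub_ne_zero.2 htq)
      change |t - q.1| ≤ Λ - δ
      rw [abs_le]
      constructor <;> linarith [ht.1, ht.2]
  have hmaj : ∀ q : ℝ × ℝ, Integrable (fun t => C * ‖F q‖ * singularMajorant (t - q.1))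
      (cellMeasure Λ) := fun q => (integrable_singularMajorant_sub q.1).const_mul _
  refine (integrable_prod_iff' h2).2 ⟨?_, ?_⟩
  · have h4 := h2.prodMk_right
    filter_upwards [h4] with q hq
    exact (hmaj q).mono' hq (hb q)
  · refine Integrable.mono' (hFi.norm.const_mul (C * I)) h2.norm.prod_swap.integral_prod_right'
      (Eventually.of_forall fun q => ?_)
    rw [Real.norm_eq_abs, abs_of_nonneg (integral_nonneg fun _ => norm_nonneg _)]
    refine (integral_mono_of_nonneg (Eventually.of_forall fun _ => norm_nonneg _)
      (hmaj q) (hb q)).trans ?_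
    rw [integral_const_mul]
    calc C * ‖F q‖ * ∫ t, singularMajorant (t - q.1) ∂cellMeasure Λ ≤ C * ‖F q‖ * I := by
          gcongr
          exact hI q.1
      _ = _ := by ring

lemma integral_cellMeasure {Λ : ℝ} (hΛ : 0 < Λ) (g : ℝ → ℂ) :
    ∫ t, g t ∂cellMeasure Λ = ∫ t in (-Λ / 2)..(Λ / 2), g t := by
  rw [cellMeasure, intervalIntegral.integral_of_le (by linarith), integral_Ioc_eq_integral_Ioo]

/-- The `m`-th Fourier mode of the potential of `F`. -/
theorem integral_latticePotential_mul_exp {k Λ α δ : ℝ} (hk : 0 < k) (hΛ : 0 < Λ) (hδ : 0 < δ)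
    (hW : ∀ m : ℤ, |alphaMode Λ α m| ≠ k) {F : ℝ × ℝ → ℂ} (hFi : Integrable F)
    (hF : ∀ q, F q ≠ 0 → |q.1| ≤ Λ / 2 - δ) (s : ℝ) (m : ℤ) :
    ∫ t, latticePotential k Λ α F (t, s) * Complex.exp (Complex.I * (-(alphaMode Λ α m * t) : ℝ))
      ∂cellMeasure Λ =
    ∫ q : ℝ × ℝ, F q * Complex.exp (Complex.I * (-(alphaMode Λ α m * q.1) : ℝ)) *
      profile |s - q.2| (decay k (alphaMode Λ α m)) := by
  have h0 := integrable_latticeGreen_mul hk hΛ hδ hW hFi hF s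
  have h1 : Integrable (fun z : ℝ × (ℝ × ℝ) => latticeGreen k Λ α ((z.1, s) - z.2) * F z.2 *
      Complex.exp (Complex.I * (-(alphaMode Λ α m * z.1) : ℝ))) ((cellMeasure Λ).prod volume) :=
    h0.mul_bdd (c := 1) (Continuous.aestronglyMeasurable (by fun_prop))
      (Eventually.of_forall fun t => (norm_exp_I_mul_ofReal _).le)
  simp only [latticePotential, ← integral_mul_const]
  rw [integral_integral_swap (f := fun (t : ℝ) (q : ℝ × ℝ) => latticeGreen k Λ α ((t, s) - q) * F q *
      Complex.exp (Complex.I * (-(alphaMode Λ α m * t) : ℝ))) h1]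
  have hne : ∀ᵐ q : ℝ × ℝ, q.2 ≠ s :=
    Measure.quasiMeasurePreserving_snd.ae (Measure.ae_ne volume s)
  refine integral_congr_ae ?_
  filter_upwards [hne] with q hq
  by_cases h : F q = 0
  · simp [h]
  · have h3 := abs_le.1 (hF q h)
    have h4 := integral_latticeGreen_mul_exp hk hΛ hW (c := -Λ / 2 - q.1) (s := s - q.2)
      (sub_ne_zero.2 hq.symm) (by linarith) (by linarith) m
    rw [show -Λ / 2 - q.1 + Λ = Λ / 2 - q.1 by ring,
      ← intervalIntegral.integral_comp_sub_right (fun t => latticeGreen k Λ α (t, s - q.2) *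
      Complex.exp (Complex.I * (-(alphaMode Λ α m * t) : ℝ))) q.1,
      ← integral_cellMeasure hΛ] at h4
    rw [← h4, ← integral_const_mul]
    refine integral_congr_ae (Eventually.of_forall fun t => ?_)
    simp only
    have e : Complex.exp (Complex.I * (-(alphaMode Λ α m * t) : ℝ)) =
        Complex.exp (Complex.I * (-(alphaMode Λ α m * q.1) : ℝ)) *
        Complex.exp (Complex.I * (-(alphaMode Λ α m * (t - q.1)) : ℝ)) := by
      rw [← Complex.exp_add]
      congr 1
      push_cast
      ring
    rw [e]
    change latticeGreen k Λ α (t - q.1, s - q.2) * _ * _ = _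
    ring


/-! ### Integrability and continuity of the potential away from its sources. -/

lemma macdonald_anti {x y : ℝ} (hx : 0 < x) (hy : x ≤ y) : macdonald y ≤ macdonald x := by
  refine (macdonald_le hx hy).trans (mul_le_of_le_one_left (macdonald_nonneg _) ?_)
  rw [Real.exp_le_one_iff]
  linarith

lemma norm_latticeGreen_le_of_dist {k Λ α δ r : ℝ} (hk : 0 < k) (hΛ : 0 < Λ) (hδ : 0 < δ)
    (hr : 0 < r) (hW : ∀ m : ℤ, |alphaMode Λ α m| ≠ k) :
    ∃ C, 0 ≤ C ∧ ∀ z : ℝ × ℝ, |z.1| ≤ Λ - δ → r ≤ ‖z‖ → ‖latticeGreen k Λ α z‖ ≤ C := by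
  obtain ⟨C, hC⟩ := exists_norm_latticeRegular_le (α := α) hk hΛ hδ hW
  refine ⟨‖(1 / (2 * Real.pi) : ℂ)‖ * macdonald (k * r) + |C|,
    add_nonneg (mul_nonneg (norm_nonneg _) (macdonald_nonneg _)) (abs_nonneg _), fun z hz hzr => ?_⟩
  have h1 : ‖z‖ ≤ √(z.1 ^ 2 + z.2 ^ 2) := by
    rw [Prod.norm_def]
    exact max_le (Real.abs_le_sqrt (by nlinarith [sq_nonneg z.2]))
      (Real.abs_le_sqrt (by nlinarith [sq_nonneg z.1]))
  rw [latticeGreen]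
  refine (norm_add_le _ _).trans ?_
  rw [norm_mul, Complex.norm_real, Real.norm_eq_abs, abs_of_nonneg (macdonald_nonneg _)]
  gcongr
  · exact macdonald_anti (by positivity) (by gcongr; exact hzr.trans h1)
  · exact (hC z hz).trans (le_abs_self _)

/-- Away from the sources the kernel is uniformly bounded. -/
lemma exists_latticeGreen_bound_near {k Λ α δ : ℝ} (hk : 0 < k) (hΛ : 0 < Λ) (hδ : 0 < δ)
    (hW : ∀ m : ℤ, |alphaMode Λ α m| ≠ k) {K : Set (ℝ × ℝ)} (hK : IsClosed K)
    (hKδ : ∀ q ∈ K, |q.1| ≤ Λ / 2 - δ) {p : ℝ × ℝ} (hp : p.1 ∈ Ioo (-Λ / 2) (Λ / 2)) (hpK : p ∉ K) :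
    ∃ C, 0 ≤ C ∧ ∀ᶠ p' in 𝓝 p, p'.1 ∈ Ioo (-Λ / 2) (Λ / 2) ∧
      ∀ q ∈ K, ‖latticeGreen k Λ α (p' - q)‖ ≤ C := by
  obtain ⟨r, hr, hrK⟩ := Metric.isOpen_iff.1 hK.isOpen_compl p hpK
  obtain ⟨C, hC0, hC⟩ := norm_latticeGreen_le_of_dist (α := α) (r := r / 2) hk hΛ hδ
    (by positivity) hW
  have h1 : ∀ᶠ p' : ℝ × ℝ in 𝓝 p, p'.1 ∈ Ioo (-Λ / 2) (Λ / 2) :=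
    continuous_fst.continuousAt (isOpen_Ioo.mem_nhds hp)
  refine ⟨C, hC0, ?_⟩
  filter_upwards [h1, Metric.ball_mem_nhds p (half_pos hr)] with p' hp' hball
  refine ⟨hp', fun q hq => hC _ ?_ ?_⟩
  · have h2 := abs_le.1 (hKδ q hq)
    change |p'.1 - q.1| ≤ Λ - δ
    rw [abs_le]
    constructor <;> linarith [hp'.1, hp'.2]
  · have h3 : r ≤ dist q p := by
      by_contra! h
      exact hrK (Metric.mem_ball.2 h) hq
    have h4 := dist_triangle q p' p
    rw [Metric.mem_ball] at hball
    rw [← dist_eq_norm, dist_comm]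
    linarith

lemma aestronglyMeasurable_latticeGreen_mul {k Λ α δ : ℝ} (hk : 0 < k) (hΛ : 0 < Λ) (hδ : 0 < δ)
    (hW : ∀ m : ℤ, |alphaMode Λ α m| ≠ k) {F : ℝ × ℝ → ℂ} (hFm : AEStronglyMeasurable F)
    (hF : ∀ q, F q ≠ 0 → |q.1| ≤ Λ / 2 - δ) {p : ℝ × ℝ} (hp : p.1 ∈ Ioo (-Λ / 2) (Λ / 2)) :
    AEStronglyMeasurable fun q => latticeGreen k Λ α (p - q) * F q := by
  have h1 : Measurable fun q : ℝ × ℝ => cutGreen k Λ α (p - q) :=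
    (measurable_cutGreen hk hΛ hW).comp (by fun_prop)
  exact (h1.aestronglyMeasurable.mul hFm).congr
    (Eventually.of_forall fun q => latticePotential_kernel_eq hδ hF hp q)

lemma integrable_latticeGreen_mul_of_notMem {k Λ α δ : ℝ} (hk : 0 < k) (hΛ : 0 < Λ) (hδ : 0 < δ)
    (hW : ∀ m : ℤ, |alphaMode Λ α m| ≠ k) {K : Set (ℝ × ℝ)} (hK : IsClosed K)
    (hKδ : ∀ q ∈ K, |q.1| ≤ Λ / 2 - δ) {F : ℝ × ℝ → ℂ} (hFi : Integrable F)
    (hF : ∀ q, F q ≠ 0 → q ∈ K) {p : ℝ × ℝ} (hp : p.1 ∈ Ioo (-Λ / 2) (Λ / 2)) (hpK : p ∉ K) :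
    Integrable fun q => latticeGreen k Λ α (p - q) * F q := by
  obtain ⟨C, hC0, hC⟩ := exists_latticeGreen_bound_near hk hΛ hδ hW hK hKδ hp hpK
  have h1 := aestronglyMeasurable_latticeGreen_mul hk hΛ hδ hW hFi.aestronglyMeasurable
    (fun q hq => hKδ q (hF q hq)) hp
  refine (hFi.norm.const_mul C).mono' h1 (Eventually.of_forall fun q => ?_)
  rw [norm_mul]
  by_cases h : F q = 0
  · simp [h]
  · gcongr
    exact hC.self_of_nhds.2 q (hF q h)

lemma continuousAt_latticePotential {k Λ α δ : ℝ} (hk : 0 < k) (hΛ : 0 < Λ) (hδ : 0 < δ)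
    (hW : ∀ m : ℤ, |alphaMode Λ α m| ≠ k) {K : Set (ℝ × ℝ)} (hK : IsClosed K)
    (hKδ : ∀ q ∈ K, |q.1| ≤ Λ / 2 - δ) {F : ℝ × ℝ → ℂ} (hFi : Integrable F)
    (hF : ∀ q, F q ≠ 0 → q ∈ K) {p : ℝ × ℝ} (hp : p.1 ∈ Ioo (-Λ / 2) (Λ / 2)) (hpK : p ∉ K) :
    ContinuousAt (latticePotential k Λ α F) p := by
  obtain ⟨C, hC0, hC⟩ := exists_latticeGreen_bound_near hk hΛ hδ hW hK hKδ hp hpK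
  refine continuousAt_of_dominated (bound := fun q => C * ‖F q‖) ?_ ?_ (hFi.norm.const_mul C) ?_
  · filter_upwards [hC] with p' hp'
    exact aestronglyMeasurable_latticeGreen_mul hk hΛ hδ hW hFi.aestronglyMeasurable
      (fun q hq => hKδ q (hF q hq)) hp'.1
  · filter_upwards [hC] with p' hp'
    refine Eventually.of_forall fun q => ?_
    rw [norm_mul]
    by_cases h : F q = 0
    · simp [h]
    · gcongr
      exact hp'.2 q (hF q h)
  · refine Eventually.of_forall fun q => ?_
    by_cases h : F q = 0
    · simp only [h, mul_zero]
      exact continuousAt_const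
    · have h2 := abs_le.1 (hKδ q (hF q h))
      refine ContinuousAt.mul (ContinuousAt.comp (g := latticeGreen k Λ α)
        (continuousAt_latticeGreen hk hΛ hW ?_ ?_) (by fun_prop)) continuousAt_const
      · change |p.1 - q.1| < Λ
        rw [abs_lt]
        constructor <;> linarith [hp.1, hp.2]
      · exact sub_ne_zero.2 fun h3 => hpK (h3 ▸ hF q h)


/-! ### Cartesian coordinates -/

def planeEquiv : Plane ≃ᵐ ℝ × ℝ :=
  (MeasurableEquiv.toLp 2 (Fin 2 → ℝ)).symm.trans MeasurableEquiv.finTwoArrow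

lemma planeEquiv_apply (x : Plane) : planeEquiv x = (x 0, x 1) := rfl

lemma planeEquiv_symm_apply (p : ℝ × ℝ) : planeEquiv.symm p = !₂[p.1, p.2] := by
  rw [MeasurableEquiv.symm_apply_eq]
  simp [planeEquiv_apply]

lemma measurePreserving_planeEquiv : MeasurePreserving planeEquiv :=
  (EuclideanSpace.volume_preserving_symm_measurableEquiv_toLp (Fin 2)).trans
    (volume_preserving_finTwoArrow ℝ)

lemma unitCell_eq_preimage (Λ : ℝ) :
    unitCell Λ = planeEquiv ⁻¹' (Ioo (-Λ / 2) (Λ / 2) ×ˢ univ) := by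
  ext x
  simp [unitCell, planeEquiv_apply]

lemma cellMeasure_prod (Λ : ℝ) : (cellMeasure Λ).prod (volume : Measure ℝ) =
    volume.restrict (Ioo (-Λ / 2) (Λ / 2) ×ˢ univ) := by
  rw [cellMeasure, Measure.volume_eq_prod, ← Measure.prod_restrict, Measure.restrict_univ]

lemma measurePreserving_planeEquiv_cell (Λ : ℝ) :
    MeasurePreserving planeEquiv (volume.restrict (unitCell Λ)) ((cellMeasure Λ).prod volume) := by
  rw [cellMeasure_prod, unitCell_eq_preimage]
  exact measurePreserving_planeEquiv.restrict_preimage (measurableSet_Ioo.prod MeasurableSet.univ)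

lemma continuous_planeEquiv : Continuous planeEquiv := by
  have : (planeEquiv : Plane → ℝ × ℝ) = fun x => (x 0, x 1) := rfl
  rw [this]
  fun_prop

lemma continuous_planeEquiv_symm : Continuous planeEquiv.symm := by
  have : (planeEquiv.symm : ℝ × ℝ → Plane) = fun p => !₂[p.1, p.2] :=
    funext planeEquiv_symm_apply
  rw [this]
  refine (PiLp.continuous_toLp 2 _).comp (continuous_pi fun i => ?_)
  fin_cases i
  · exact continuous_fst
  · exact continuous_snd

/-! ### The weak Helmholtz equation for product test functions -/

lemma fderiv_mul_coord {a b : ℝ → ℂ} (ha : Differentiable ℝ a) (hb : Differentiable ℝ b)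
    (x v : Plane) : fderiv ℝ (fun x : Plane => a (x 0) * b (x 1)) x v =
      v 0 * (deriv a (x 0) * b (x 1)) + v 1 * (a (x 0) * deriv b (x 1)) := by
  have h0 : HasFDerivAt (fun x : Plane => x 0) (EuclideanSpace.proj 0 : Plane →L[ℝ] ℝ) x :=
    (EuclideanSpace.proj 0 : Plane →L[ℝ] ℝ).hasFDerivAt
  have h1 : HasFDerivAt (fun x : Plane => x 1) (EuclideanSpace.proj 1 : Plane →L[ℝ] ℝ) x :=
    (EuclideanSpace.proj 1 : Plane →L[ℝ] ℝ).hasFDerivAt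
  have hA := (ha (x 0)).hasDerivAt.hasFDerivAt.comp x h0
  have hB := (hb (x 1)).hasDerivAt.hasFDerivAt.comp x h1
  have h := (hA.mul hB).fderiv
  change fderiv ℝ (fun x : Plane => a (x 0) * b (x 1)) x = _ at h
  rw [h]
  simp
  ring

lemma laplacian_mul_coord {a b : ℝ → ℂ} (ha : ContDiff ℝ ∞ a) (hb : ContDiff ℝ ∞ b) (x : Plane) :
    Δ (fun x : Plane => a (x 0) * b (x 1)) x =
      deriv (deriv a) (x 0) * b (x 1) + a (x 0) * deriv (deriv b) (x 1) := by
  have ha0 := (contDiff_infty_iff_deriv.1 ha).1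
  have hb0 := (contDiff_infty_iff_deriv.1 hb).1
  have ha1 := (contDiff_infty_iff_deriv.1 (contDiff_infty_iff_deriv.1 ha).2).1
  have hb1 := (contDiff_infty_iff_deriv.1 (contDiff_infty_iff_deriv.1 hb).2).1
  have hφ : ContDiff ℝ ∞ fun x : Plane => a (x 0) * b (x 1) :=
    (ha.comp (EuclideanSpace.proj 0 : Plane →L[ℝ] ℝ).contDiff).mul
      (hb.comp (EuclideanSpace.proj 1 : Plane →L[ℝ] ℝ).contDiff)
  have hd : Differentiable ℝ (fderiv ℝ fun x : Plane => a (x 0) * b (x 1)) :=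
    (hφ.fderiv_right (m := 1) (by norm_cast)).differentiable (by norm_num)
  rw [InnerProductSpace.laplacian_eq_iteratedFDeriv_orthonormalBasis _
    (EuclideanSpace.basisFun (Fin 2) ℝ)]
  have key : ∀ v : Plane, iteratedFDeriv ℝ 2 (fun x : Plane => a (x 0) * b (x 1)) x ![v, v] =
      fderiv ℝ (fun y => fderiv ℝ (fun x : Plane => a (x 0) * b (x 1)) y v) x v := by
    intro v
    rw [iteratedFDeriv_two_apply, fderiv_clm_apply (hd x) (differentiableAt_const v)]
    simp
  simp only [Fin.sum_univ_two, key]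
  have e0 : (fun y : Plane => fderiv ℝ (fun x : Plane => a (x 0) * b (x 1)) y
      (EuclideanSpace.basisFun (Fin 2) ℝ 0)) = fun y => deriv a (y 0) * b (y 1) := by
    funext y; rw [fderiv_mul_coord ha0 hb0]; simp
  have e1 : (fun y : Plane => fderiv ℝ (fun x : Plane => a (x 0) * b (x 1)) y
      (EuclideanSpace.basisFun (Fin 2) ℝ 1)) = fun y => a (y 0) * deriv b (y 1) := by
    funext y; rw [fderiv_mul_coord ha0 hb0]; simp
  rw [e0, e1, fderiv_mul_coord ha1 hb0, fderiv_mul_coord ha0 hb1]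
  simp

lemma hasCompactSupport_mul_coord {a b : ℝ → ℂ} (ha : HasCompactSupport a)
    (hb : HasCompactSupport b) : HasCompactSupport fun x : Plane => a (x 0) * b (x 1) := by
  refine HasCompactSupport.intro (K := planeEquiv.symm '' (tsupport a ×ˢ tsupport b))
    ((ha.prod hb).image continuous_planeEquiv_symm) fun x hx => ?_
  by_contra h
  refine hx ⟨planeEquiv x, ⟨subset_tsupport _ ?_, subset_tsupport _ ?_⟩, by simp⟩
  · exact left_ne_zero_of_mul h
  · exact right_ne_zero_of_mul h

lemma SolvesHelmholtz.integral_product {k : ℝ} {γ u : Plane → ℂ} (h : SolvesHelmholtz k γ u)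
    {a b : ℝ → ℂ} (ha : ContDiff ℝ ∞ a) (hb : ContDiff ℝ ∞ b) (ha' : HasCompactSupport a)
    (hb' : HasCompactSupport b) :
    ∫ p : ℝ × ℝ, u (planeEquiv.symm p) * (deriv (deriv a) p.1 * b p.2 + a p.1 * deriv (deriv b) p.2
      + (k : ℂ) ^ 2 * γ (planeEquiv.symm p) * (a p.1 * b p.2)) = 0 := by
  rw [← h.2 (fun x : Plane => a (x 0) * b (x 1)) ?_ (hasCompactSupport_mul_coord ha' hb'),
    ← measurePreserving_planeEquiv.integral_comp' (g := fun p : ℝ × ℝ => u (planeEquiv.symm p) * _)]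
  · refine integral_congr_ae (Eventually.of_forall fun x => ?_)
    simp only [MeasurableEquiv.symm_apply_apply, laplacian_mul_coord ha hb]
    rfl
  · exact (ha.comp (EuclideanSpace.proj 0 : Plane →L[ℝ] ℝ).contDiff).mul
      (hb.comp (EuclideanSpace.proj 1 : Plane →L[ℝ] ℝ).contDiff)

/-! ### Unfolding periodic functions -/

/-- The function `ρ (t + Λ) - ρ t` vanishes off `[-Λ, Λ]`, and its translates by multiples of `Λ`
telescope to `b - a`. For `a = 0`, `b = 1` it is a periodic partition of unity; for derivatives of
such a step `a = b = 0`, and the integral is zero. -/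
lemma integral_periodic_mul_step {Λ : ℝ} (hΛ : 0 < Λ) {P : ℝ × ℝ → ℂ}
    (hPer : ∀ t s, P (t + Λ, s) = P (t, s)) (hP : Integrable P ((cellMeasure Λ).prod volume))
    {ρ : ℝ → ℂ} (hρ : Continuous ρ) {a b : ℂ} (ha : ∀ t ≤ 0, ρ t = a) (hb : ∀ t, Λ ≤ t → ρ t = b) :
    Integrable (fun p : ℝ × ℝ => P p * (ρ (p.1 + Λ) - ρ p.1)) ∧
    ∫ p : ℝ × ℝ, P p * (ρ (p.1 + Λ) - ρ p.1) =
      (b - a) * ∫ p, P p ∂(cellMeasure Λ).prod volume := by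
  set S : Set (ℝ × ℝ) := Ioo (-Λ / 2) (Λ / 2) ×ˢ univ with hS
  have hSm : MeasurableSet S := measurableSet_Ioo.prod MeasurableSet.univ
  obtain ⟨C, hC⟩ : ∃ C, ∀ t, ‖ρ t‖ ≤ C := by
    obtain ⟨C, hC⟩ := (isCompact_Icc (a := (0 : ℝ)) (b := Λ)).exists_bound_of_continuousOn
      hρ.continuousOn
    refine ⟨C, fun t => ?_⟩
    rcases le_total t 0 with h | h
    · rw [ha t h, ← ha 0 le_rfl]; exact hC 0 ⟨le_rfl, hΛ.le⟩
    · rcases le_total t Λ with h' | h'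
      · exact hC t ⟨h, h'⟩
      · rw [hb t h', ← hb Λ le_rfl]; exact hC Λ ⟨hΛ.le, le_rfl⟩
  have hPerN : ∀ (t s : ℝ), P (t - Λ, s) = P (t, s) := fun t s => by
    rw [← hPer, sub_add_cancel]
  -- the part of the integrand over each of the three cells, moved to the central one
  set Q : ℝ → ℝ × ℝ → ℂ := fun c => S.indicator fun p => P p * (ρ (p.1 + c + Λ) - ρ (p.1 + c))
    with hQ
  have hQi : ∀ c, Integrable (Q c) := fun c => by
    rw [hQ]
    refine (integrable_indicator_iff hSm).2 ?_
    rw [IntegrableOn, ← cellMeasure_prod]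
    refine hP.mul_bdd (c := C + C) (Continuous.aestronglyMeasurable (by fun_prop))
      (Eventually.of_forall fun p => (norm_sub_le _ _).trans (add_le_add (hC _) (hC _)))
  have hQint : ∀ c, ∫ p, Q c p =
      ∫ p, P p * (ρ (p.1 + c + Λ) - ρ (p.1 + c)) ∂(cellMeasure Λ).prod volume := fun c => by
    rw [cellMeasure_prod, ← integral_indicator hSm]
  have hne : ∀ c : ℝ, ∀ᵐ p : ℝ × ℝ, p.1 ≠ c := fun c =>
    Measure.quasiMeasurePreserving_fst.ae (Measure.ae_ne volume c)
  have hsum : (fun p : ℝ × ℝ => P p * (ρ (p.1 + Λ) - ρ p.1)) =ᵐ[volume]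
      fun p => Q 0 p + (Q Λ (p + (-Λ, 0)) + Q (-Λ) (p + (Λ, 0))) := by
    filter_upwards [hne (-Λ / 2), hne (Λ / 2)] with p h1 h2
    obtain ⟨t, s⟩ := p
    have m0 : ((t, s) : ℝ × ℝ) ∈ S ↔ -Λ / 2 < t ∧ t < Λ / 2 := by simp [hS]
    have m1 : ((t, s) + (-Λ, 0) : ℝ × ℝ) ∈ S ↔ Λ / 2 < t ∧ t < 3 * Λ / 2 := by
      simp only [hS, Prod.mk_add_mk, mem_prod, mem_Ioo, mem_univ, and_true]
      constructor <;> rintro ⟨h3, h4⟩ <;> constructor <;> linarith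
    have m2 : ((t, s) + (Λ, 0) : ℝ × ℝ) ∈ S ↔ -3 * Λ / 2 < t ∧ t < -Λ / 2 := by
      simp only [hS, Prod.mk_add_mk, mem_prod, mem_Ioo, mem_univ, and_true]
      constructor <;> rintro ⟨h3, h4⟩ <;> constructor <;> linarith
    have v1 : P ((t, s) + (-Λ, 0)) = P (t, s) := by
      rw [Prod.mk_add_mk, add_zero, ← sub_eq_add_neg]; exact hPerN t s
    have v2 : P ((t, s) + (Λ, 0)) = P (t, s) := by
      rw [Prod.mk_add_mk, add_zero]; exact hPer t s
    simp only [hQ, indicator_apply, m0, m1, m2, v1, v2]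
    simp only [Prod.mk_add_mk, add_zero, neg_add_cancel_right, add_neg_cancel_right]
    simp only at h1 h2
    rcases lt_or_ge t (-Λ / 2) with c1 | c1
    · rw [if_neg (fun h => absurd h.1 (by linarith)), if_neg (fun h => absurd h.1 (by linarith))]
      split_ifs with c2
      · simp
      · have : t ≤ -3 * Λ / 2 := by by_contra! c3; exact c2 ⟨c3, c1⟩
        rw [ha t (by linarith), ha (t + Λ) (by linarith)]; simp
    · have c1' := lt_of_le_of_ne c1 (Ne.symm h1)
      rcases lt_or_ge t (Λ / 2) with c2 | c2
      · rw [if_pos ⟨c1', c2⟩, if_neg (fun h => absurd h.1 (by linarith)),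
          if_neg (fun h => absurd h.2 (by linarith))]
        simp
      · have c2' := lt_of_le_of_ne c2 (Ne.symm h2)
        rw [if_neg (fun h => absurd h.2 (by linarith)), if_neg (c := -3 * Λ / 2 < t ∧ t < -Λ / 2)
          (fun h => absurd h.2 (by linarith))]
        split_ifs with c3
        · simp
        · have : 3 * Λ / 2 ≤ t := by by_contra! c4; exact c3 ⟨c2', c4⟩
          rw [hb t (by linarith), hb (t + Λ) (by linarith)]; simp
  have hi1 : Integrable fun p : ℝ × ℝ => Q Λ (p + (-Λ, 0)) := (hQi Λ).comp_add_right _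
  have hi2 : Integrable fun p : ℝ × ℝ => Q (-Λ) (p + (Λ, 0)) := (hQi (-Λ)).comp_add_right _
  refine ⟨((hQi 0).add (hi1.add hi2)).congr hsum.symm, ?_⟩
  have hb' : ∀ c, Integrable (fun p : ℝ × ℝ => P p * (ρ (p.1 + c + Λ) - ρ (p.1 + c)))
      ((cellMeasure Λ).prod volume) := fun c =>
    hP.mul_bdd (c := C + C) (Continuous.aestronglyMeasurable (by fun_prop))
      (Eventually.of_forall fun p => (norm_sub_le _ _).trans (add_le_add (hC _) (hC _)))
  have hb'' : Integrable (fun p : ℝ × ℝ => P p * (ρ (p.1 + Λ + Λ) - ρ (p.1 + Λ)) +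
      P p * (ρ (p.1 + -Λ + Λ) - ρ (p.1 + -Λ))) ((cellMeasure Λ).prod volume) :=
    (hb' Λ).add (hb' (-Λ))
  have hi12 : Integrable fun p : ℝ × ℝ => Q Λ (p + (-Λ, 0)) + Q (-Λ) (p + (Λ, 0)) := hi1.add hi2
  rw [integral_congr_ae hsum, integral_add (hQi 0) hi12, integral_add hi1 hi2,
    integral_add_right_eq_self (fun p => Q Λ p), integral_add_right_eq_self (fun p => Q (-Λ) p),
    hQint, hQint, hQint, ← integral_add (hb' Λ) (hb' (-Λ)), ← integral_add (hb' 0) hb'', ← integral_const_mul]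
  refine integral_congr_ae ?_
  filter_upwards [Measure.quasiMeasurePreserving_fst.ae (ae_cellMeasure Λ)] with p hp
  simp only [add_zero, neg_add_cancel_right]
  -- The three increments telescope to `ρ (t + 2Λ) - ρ (t - Λ)`, and for `t` in the cell these
  -- values are `b` and `a`.
  rw [hb (p.1 + Λ + Λ) (by linarith [hp.1]), ha (p.1 + -Λ) (by linarith [hp.2])]
  ring


/-! ### The Helmholtz equation for the Fourier modes -/

lemma exists_smooth_step {Λ : ℝ} (hΛ : 0 < Λ) :
    ∃ σ : ℝ → ℂ, ContDiff ℝ ∞ σ ∧ (∀ t ≤ 0, σ t = 0) ∧ ∀ t, Λ ≤ t → σ t = 1 := by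
  refine ⟨fun t => (Real.smoothTransition (t / Λ) : ℂ), ?_, fun t ht => ?_, fun t ht => ?_⟩
  · exact Complex.ofRealCLM.contDiff.comp (Real.smoothTransition.contDiff.comp (by fun_prop))
  · simp only
    rw [Real.smoothTransition.zero_of_nonpos (div_nonpos_of_nonpos_of_nonneg ht hΛ.le)]; simp
  · simp only
    rw [Real.smoothTransition.one_of_one_le ((one_le_div hΛ).2 ht)]; simp

lemma deriv_eq_zero_of_eqOn_Iic {σ : ℝ → ℂ} (hσ : ContDiff ℝ ∞ σ) {c : ℂ} {t₀ : ℝ}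
    (h : ∀ t ≤ t₀, σ t = c) : ∀ t ≤ t₀, deriv σ t = 0 := by
  intro t ht
  have hd := (hσ.differentiable (by norm_num) t).hasDerivAt
  have h2 : HasDerivWithinAt σ 0 (Iic t) t :=
    (hasDerivWithinAt_const t _ c).congr (fun s hs => h s (le_trans hs ht)) (h t ht)
  exact (uniqueDiffWithinAt_Iic t).eq_deriv _ hd.hasDerivWithinAt h2

lemma deriv_eq_zero_of_eqOn_Ici {σ : ℝ → ℂ} (hσ : ContDiff ℝ ∞ σ) {c : ℂ} {t₀ : ℝ}
    (h : ∀ t, t₀ ≤ t → σ t = c) : ∀ t, t₀ ≤ t → deriv σ t = 0 := by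
  intro t ht
  have hd := (hσ.differentiable (by norm_num) t).hasDerivAt
  have h2 : HasDerivWithinAt σ 0 (Ici t) t :=
    (hasDerivWithinAt_const t _ c).congr (fun s hs => h s (le_trans ht hs)) (h t ht)
  exact (uniqueDiffWithinAt_Ici t).eq_deriv _ hd.hasDerivWithinAt h2

/-- The conjugate mode `e^{-iξt}`. -/
def modeExp (ξ t : ℝ) : ℂ := Complex.exp (Complex.I * (-(ξ * t) : ℝ))

lemma norm_modeExp (ξ t : ℝ) : ‖modeExp ξ t‖ = 1 := norm_exp_I_mul_ofReal _

lemma contDiff_modeExp (ξ : ℝ) : ContDiff ℝ ∞ (modeExp ξ) := by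
  unfold modeExp
  exact Complex.contDiff_exp.comp (contDiff_const.mul (Complex.ofRealCLM.contDiff.comp
    (contDiff_const.mul contDiff_id).neg))

lemma hasDerivAt_modeExp (ξ t : ℝ) : HasDerivAt (modeExp ξ) (-(Complex.I * ξ) * modeExp ξ t) t := by
  have h1 : HasDerivAt (fun t : ℝ => Complex.I * ((-(ξ * t) : ℝ) : ℂ)) (-(Complex.I * ξ)) t := by
    have := ((((hasDerivAt_id t).const_mul ξ).neg).ofReal_comp).const_mul Complex.I
    simpa using this
  have := h1.cexp
  rwa [mul_comm] at this

lemma deriv_deriv_mul_modeExp {χ : ℝ → ℂ} (hχ : ContDiff ℝ ∞ χ) (ξ t : ℝ) :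
    deriv (deriv fun t => χ t * modeExp ξ t) t = (deriv (deriv χ) t -
      2 * Complex.I * ξ * deriv χ t - ξ ^ 2 * χ t) * modeExp ξ t := by
  have h0 := (contDiff_infty_iff_deriv.1 hχ).1
  have h1 := (contDiff_infty_iff_deriv.1 (contDiff_infty_iff_deriv.1 hχ).2).1
  have e : deriv (fun t => χ t * modeExp ξ t) =
      fun t => (deriv χ t - Complex.I * ξ * χ t) * modeExp ξ t := by
    funext t
    refine ((h0 t).hasDerivAt.mul (hasDerivAt_modeExp ξ t)).deriv.trans ?_
    ring
  rw [e]
  refine (((h1 t).hasDerivAt.sub ((h0 t).hasDerivAt.const_mul (Complex.I * ξ))).mul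
    (hasDerivAt_modeExp ξ t)).deriv.trans ?_
  simp only [Pi.sub_apply]
  linear_combination (-(ξ : ℂ) ^ 2 * χ t * modeExp ξ t) * (-Complex.I_sq)

lemma modeExp_alphaMode_add {Λ α : ℝ} (hΛ : 0 < Λ) (m : ℤ) (t : ℝ) :
    modeExp (alphaMode Λ α m) (t + Λ) =
      modeExp (alphaMode Λ α m) t * Complex.exp (-Complex.I * (Λ * α : ℝ)) := by
  unfold modeExp
  rw [← Complex.exp_add, Complex.exp_eq_exp_iff_exists_int]
  refine ⟨-m, ?_⟩
  unfold alphaMode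
  push_cast
  have : (Λ : ℂ) ≠ 0 := by exact_mod_cast hΛ.ne'
  field_simp
  ring

/-- The equation is tested with `χ(t) e^{-iα_m t} b(s)`, where `χ` is a smooth periodic partition of
unity. The product of `U` with the conjugate mode is periodic, so integrals against `χ` reduce to
the cell and those against `χ'` and `χ''` vanish. What remains of the symbol is `k² - α_m² = -ζ²`,
and `k²(Γ - 1)` goes to the right side. -/
theorem integral_mode_helmholtz {k Λ α : ℝ} (hΛ : 0 < Λ) (m : ℤ) {U Γ : ℝ × ℝ → ℂ}
    (hweak : ∀ a b : ℝ → ℂ, ContDiff ℝ ∞ a → ContDiff ℝ ∞ b → HasCompactSupport a →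
      HasCompactSupport b → ∫ p : ℝ × ℝ, U p * (deriv (deriv a) p.1 * b p.2 +
        a p.1 * deriv (deriv b) p.2 + (k : ℂ) ^ 2 * Γ p * (a p.1 * b p.2)) = 0)
    (hU : ∀ g : ℝ → ℂ, Continuous g → HasCompactSupport g →
      Integrable (fun p : ℝ × ℝ => U p * g p.2) ((cellMeasure Λ).prod volume))
    (hΓ : MemLp (fun p => Γ p - 1) ⊤ ((cellMeasure Λ).prod volume))
    (hΓper : ∀ t s, Γ (t + Λ, s) = Γ (t, s))
    (hUper : ∀ t s, U (t + Λ, s) * Complex.exp (-Complex.I * (Λ * α : ℝ)) = U (t, s))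
    {b : ℝ → ℂ} (hb : ContDiff ℝ ∞ b) (hb' : HasCompactSupport b) :
    ∫ p : ℝ × ℝ, U p * modeExp (alphaMode Λ α m) p.1 *
        (deriv (deriv b) p.2 - decay k (alphaMode Λ α m) ^ 2 * b p.2) ∂(cellMeasure Λ).prod volume =
      -∫ p : ℝ × ℝ, (k : ℂ) ^ 2 * (Γ p - 1) * U p * modeExp (alphaMode Λ α m) p.1 * b p.2
        ∂(cellMeasure Λ).prod volume := by
  set ξ := alphaMode Λ α m with hξ
  set ν := (cellMeasure Λ).prod (volume : Measure ℝ) with hν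
  obtain ⟨σ, hσ, hσ0, hσ1⟩ := exists_smooth_step hΛ
  have hσ' := (contDiff_infty_iff_deriv.1 hσ).2
  have hσ'' := (contDiff_infty_iff_deriv.1 hσ').2
  have hσ'0 := deriv_eq_zero_of_eqOn_Iic hσ hσ0
  have hσ'1 := deriv_eq_zero_of_eqOn_Ici hσ hσ1
  have hσ''0 := deriv_eq_zero_of_eqOn_Iic hσ' hσ'0
  have hσ''1 := deriv_eq_zero_of_eqOn_Ici hσ' hσ'1
  have hb'' : ContDiff ℝ ∞ (deriv (deriv b)) :=
    (contDiff_infty_iff_deriv.1 (contDiff_infty_iff_deriv.1 hb).2).2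
  set χ : ℝ → ℂ := fun t => σ (t + Λ) - σ t with hχdef
  have hχ : ContDiff ℝ ∞ χ := (hσ.comp (by fun_prop)).sub hσ
  have dχ : deriv χ = fun t => deriv σ (t + Λ) - deriv σ t := by
    funext t
    have h1 := (hσ.differentiable (by norm_num) (t + Λ)).hasDerivAt.comp_add_const t Λ
    exact (h1.sub (hσ.differentiable (by norm_num) t).hasDerivAt).deriv
  have ddχ : deriv (deriv χ) = fun t => deriv (deriv σ) (t + Λ) - deriv (deriv σ) t := by
    rw [dχ]
    funext t
    have h1 := (hσ'.differentiable (by norm_num) (t + Λ)).hasDerivAt.comp_add_const t Λ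
    exact (h1.sub (hσ'.differentiable (by norm_num) t).hasDerivAt).deriv
  have hχsupp : HasCompactSupport χ := by
    refine HasCompactSupport.intro (isCompact_Icc (a := -Λ) (b := Λ)) fun t ht => ?_
    simp only [hχdef]
    by_cases h : t < -Λ
    · rw [hσ0 t (by linarith), hσ0 (t + Λ) (by linarith), sub_zero]
    · have : Λ < t := by
        by_contra h'
        exact ht ⟨by linarith, by linarith⟩
      rw [hσ1 t (by linarith), hσ1 (t + Λ) (by linarith), sub_self]
  -- integrability over the cell
  have hE : AEStronglyMeasurable (fun p : ℝ × ℝ => modeExp ξ p.1) ν :=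
    ((contDiff_modeExp ξ).continuous.comp continuous_fst).aestronglyMeasurable
  have hUE : ∀ g : ℝ → ℂ, Continuous g → HasCompactSupport g →
      Integrable (fun p : ℝ × ℝ => U p * modeExp ξ p.1 * g p.2) ν := fun g hg hg' => by
    refine ((hU g hg hg').mul_bdd (c := 1) hE (Eventually.of_forall fun p =>
      (norm_modeExp _ _).le)).congr (Eventually.of_forall fun p => ?_)
    simp only
    ring
  have hS : Integrable (fun p : ℝ × ℝ =>
      (k : ℂ) ^ 2 * (Γ p - 1) * U p * modeExp ξ p.1 * b p.2) ν := by
    refine (((hUE b hb.continuous hb').mul_of_top_right hΓ).const_mul ((k : ℂ) ^ 2)).congr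
      (Eventually.of_forall fun p => ?_)
    simp only [Pi.mul_apply]
    ring
  have hL : Integrable (fun p : ℝ × ℝ => U p * modeExp ξ p.1 *
      (deriv (deriv b) p.2 - decay k ξ ^ 2 * b p.2)) ν :=
    hUE (fun s => deriv (deriv b) s - decay k ξ ^ 2 * b s)
      (hb''.continuous.sub (continuous_const.mul hb.continuous)) (hb'.deriv.deriv.sub hb'.mul_left)
  -- periodicity
  have hper : ∀ t s, U (t + Λ, s) * modeExp ξ (t + Λ) = U (t, s) * modeExp ξ t := fun t s => by
    rw [hξ, modeExp_alphaMode_add hΛ, ← hUper t s]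
    ring
  obtain ⟨i1, e1⟩ := integral_periodic_mul_step hΛ (P := fun p => U p * modeExp ξ p.1 *
      (deriv (deriv b) p.2 - decay k ξ ^ 2 * b p.2) +
      (k : ℂ) ^ 2 * (Γ p - 1) * U p * modeExp ξ p.1 * b p.2)
    (fun t s => by simp only [mul_assoc _ (U _), hper, hΓper]) (hL.add hS) hσ.continuous hσ0 hσ1
  obtain ⟨i2, e2⟩ := integral_periodic_mul_step hΛ (P := fun p => U p * modeExp ξ p.1 *
      ((-2 * Complex.I * ξ) * b p.2)) (fun t s => by simp only [hper])
    (hUE (fun s => (-2 * Complex.I * ξ) * b s) (continuous_const.mul hb.continuous) hb'.mul_left)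
    hσ'.continuous hσ'0 hσ'1
  obtain ⟨i3, e3⟩ := integral_periodic_mul_step hΛ (P := fun p => U p * modeExp ξ p.1 * b p.2)
    (fun t s => by simp only [hper]) (hUE b hb.continuous hb') hσ''.continuous hσ''0 hσ''1
  have hw := hweak (fun t => χ t * modeExp ξ t) b (hχ.mul (contDiff_modeExp ξ)) hb
    hχsupp.mul_right hb'
  have hzero : (1 - 0) * ∫ p : ℝ × ℝ, U p * modeExp ξ p.1 *
      (deriv (deriv b) p.2 - decay k ξ ^ 2 * b p.2) +
      (k : ℂ) ^ 2 * (Γ p - 1) * U p * modeExp ξ p.1 * b p.2 ∂ν = 0 := by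
    rw [← e1]
    -- The commutator terms: the first and second derivatives of the smooth step have equal
    -- constants, namely zero, on both sides.
    have h23 : (∫ p : ℝ × ℝ, U p * modeExp ξ p.1 * ((-2 * Complex.I * ξ) * b p.2) *
        (deriv σ (p.1 + Λ) - deriv σ p.1)) + ∫ p : ℝ × ℝ, U p * modeExp ξ p.1 * b p.2 *
        (deriv (deriv σ) (p.1 + Λ) - deriv (deriv σ) p.1) = 0 := by
      rw [e2, e3]; simp
    have h4 := integral_add i1 (i2.add i3)
    simp only [Pi.add_apply] at h4
    rw [integral_add i2 i3, h23, add_zero] at h4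
    rw [← hw, ← h4]
    refine integral_congr_ae (Eventually.of_forall fun p => ?_)
    have h5 := deriv_deriv_mul_modeExp hχ ξ p.1
    rw [ddχ, dχ] at h5
    simp only [h5]
    simp only [decay_sq, hχdef]
    push_cast
    ring
  rw [sub_zero, one_mul, integral_add hL hS] at hzero
  exact eq_neg_of_add_eq_zero_left hzero


/-! ### Outgoing solutions of `A'' - ζ² A = -F` on the line -/

lemma contDiff_integral_of_contDiff {f : ℝ → ℂ} (hf : ContDiff ℝ ∞ f) (a : ℝ) :
    ContDiff ℝ ∞ fun s => ∫ x in a..s, f x := by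
  have h : ∀ s, HasDerivAt (fun s => ∫ x in a..s, f x) (f s) s := fun s =>
    (hf.continuous.integral_hasStrictDerivAt a s).hasDerivAt
  refine contDiff_infty_iff_deriv.2 ⟨fun s => (h s).differentiableAt, ?_⟩
  rw [funext fun s => (h s).deriv]
  exact hf

lemma hasDerivAt_exp_mul_ofReal (ζ : ℂ) (s : ℝ) :
    HasDerivAt (fun s : ℝ => Complex.exp (ζ * s)) (ζ * Complex.exp (ζ * s)) s := by
  have h1 : HasDerivAt (fun s : ℝ => ζ * (s : ℂ)) ζ s := by
    simpa using (hasDerivAt_id s).ofReal_comp.const_mul ζ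
  have := h1.cexp
  rwa [mul_comm] at this

lemma contDiff_exp_mul_ofReal (ζ : ℂ) : ContDiff ℝ ∞ fun s : ℝ => Complex.exp (ζ * s) :=
  Complex.contDiff_exp.comp (contDiff_const.mul Complex.ofRealCLM.contDiff)

/-- A smooth solution of `W'' = ζ² W - f`, given by the variation of constants formula. -/
def outgoing (ζ : ℂ) (N : ℝ) (f : ℝ → ℂ) (s : ℝ) : ℂ :=
  (Complex.exp (-ζ * s) * (∫ x in (-N)..s, Complex.exp (ζ * x) * f x) -
    Complex.exp (ζ * s) * ∫ x in N..s, Complex.exp (-ζ * x) * f x) / (2 * ζ)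

def outgoingDeriv (ζ : ℂ) (N : ℝ) (f : ℝ → ℂ) (s : ℝ) : ℂ :=
  (-Complex.exp (-ζ * s) * (∫ x in (-N)..s, Complex.exp (ζ * x) * f x) -
    Complex.exp (ζ * s) * ∫ x in N..s, Complex.exp (-ζ * x) * f x) / 2

lemma exp_neg_mul_mul_exp (ζ : ℂ) (s : ℝ) :
    Complex.exp (-ζ * s) * Complex.exp (ζ * s) = 1 := by
  rw [← Complex.exp_add]; simp

lemma hasDerivAt_integral_exp_mul {f : ℝ → ℂ} (hf : Continuous f) (ζ : ℂ) (a s : ℝ) :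
    HasDerivAt (fun s => ∫ x in a..s, Complex.exp (ζ * x) * f x) (Complex.exp (ζ * s) * f s) s :=
  (Continuous.integral_hasStrictDerivAt (f := fun x : ℝ => Complex.exp (ζ * x) * f x)
    (by fun_prop) a s).hasDerivAt

lemma hasDerivAt_outgoing {ζ : ℂ} (hζ : ζ ≠ 0) (N : ℝ) {f : ℝ → ℂ} (hf : Continuous f) (s : ℝ) :
    HasDerivAt (outgoing ζ N f) (outgoingDeriv ζ N f s) s := by
  have h := (((hasDerivAt_exp_mul_ofReal (-ζ) s).mul (hasDerivAt_integral_exp_mul hf ζ (-N) s)).sub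
    ((hasDerivAt_exp_mul_ofReal ζ s).mul (hasDerivAt_integral_exp_mul hf (-ζ) N s))).div_const (2 * ζ)
  refine h.congr_deriv ?_
  rw [outgoingDeriv]
  generalize Complex.exp (-ζ * s) = a
  generalize Complex.exp (ζ * s) = b
  field_simp
  ring

lemma hasDerivAt_outgoingDeriv (ζ : ℂ) (N : ℝ) {f : ℝ → ℂ} (hf : Continuous f)
    (s : ℝ) : HasDerivAt (outgoingDeriv ζ N f) (ζ ^ 2 * outgoing ζ N f s - f s) s := by
  have h := (((hasDerivAt_exp_mul_ofReal (-ζ) s).neg.mul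
    (hasDerivAt_integral_exp_mul hf ζ (-N) s)).sub
    ((hasDerivAt_exp_mul_ofReal ζ s).mul (hasDerivAt_integral_exp_mul hf (-ζ) N s))).div_const 2
  refine h.congr_deriv ?_
  rw [outgoing]
  simp only [Pi.neg_apply]
  have h2 := exp_neg_mul_mul_exp ζ s
  generalize Complex.exp (-ζ * s) = a at *
  generalize Complex.exp (ζ * s) = b at *
  field_simp
  linear_combination (-2 * f s) * h2

lemma contDiff_outgoing (ζ : ℂ) (N : ℝ) {f : ℝ → ℂ} (hf : ContDiff ℝ ∞ f) :
    ContDiff ℝ ∞ (outgoing ζ N f) := by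
  unfold outgoing
  have h1 := contDiff_integral_of_contDiff ((contDiff_exp_mul_ofReal ζ).mul hf) (-N)
  have h2 := contDiff_integral_of_contDiff ((contDiff_exp_mul_ofReal (-ζ)).mul hf) N
  exact (((contDiff_exp_mul_ofReal (-ζ)).mul h1).sub ((contDiff_exp_mul_ofReal ζ).mul h2)).div_const _

/-- For `|s| ≤ N` the two variation-of-constants integrals cover the parts of the support of `f`
below and above `s`, where `|s - τ|` has a fixed sign. -/
lemma outgoing_eq_integral {ζ : ℂ} {N : ℝ} {f : ℝ → ℂ} (hf : Continuous f)
    (hsupp : ∀ x, N < |x| → f x = 0) {s : ℝ} (hs : |s| ≤ N) :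
    outgoing ζ N f s = ∫ τ, profile |s - τ| ζ * f τ := by
  have hs' := abs_le.1 hs
  have hN : -N ≤ N := hs'.1.trans hs'.2
  have hzero : ∀ τ, τ ∉ Ioc (-N) N → τ ≠ -N → profile |s - τ| ζ * f τ = 0 := by
    intro τ hτ hne
    rw [hsupp τ, mul_zero]
    rw [lt_abs]
    by_contra! h
    exact hτ ⟨lt_of_le_of_ne (by linarith [h.2]) hne.symm, h.1⟩
  have h1 : ∫ τ, profile |s - τ| ζ * f τ = ∫ τ in (-N)..N, profile |s - τ| ζ * f τ := by
    rw [intervalIntegral.integral_of_le hN, ← integral_indicator measurableSet_Ioc]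
    refine integral_congr_ae ?_
    filter_upwards [Measure.ae_ne volume (-N)] with τ hτ
    by_cases h : τ ∈ Ioc (-N) N
    · rw [indicator_of_mem h]
    · rw [indicator_of_notMem h, hzero τ h hτ]
  have hc : Continuous fun τ => profile |s - τ| ζ * f τ := by
    unfold profile
    fun_prop
  rw [h1, ← intervalIntegral.integral_add_adjacent_intervals (hc.intervalIntegrable (-N) s)
    (hc.intervalIntegrable s N), outgoing, intervalIntegral.integral_symm s N]
  have e1 : ∫ τ in (-N)..s, profile |s - τ| ζ * f τ =
      Complex.exp (-ζ * s) / (2 * ζ) * ∫ x in (-N)..s, Complex.exp (ζ * x) * f x := by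
    rw [← intervalIntegral.integral_const_mul]
    refine intervalIntegral.integral_congr fun τ hτ => ?_
    rw [uIcc_of_le hs'.1] at hτ
    rw [abs_of_nonneg (by linarith [hτ.2]), profile,
      show -(ζ * ((s - τ : ℝ) : ℂ)) = -ζ * s + ζ * τ by push_cast; ring, Complex.exp_add]
    ring
  have e2 : ∫ τ in s..N, profile |s - τ| ζ * f τ =
      Complex.exp (ζ * s) / (2 * ζ) * ∫ x in s..N, Complex.exp (-ζ * x) * f x := by
    rw [← intervalIntegral.integral_const_mul]
    refine intervalIntegral.integral_congr fun τ hτ => ?_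
    rw [uIcc_of_le hs'.2] at hτ
    rw [abs_of_nonpos (by linarith [hτ.1]), profile,
      show -(ζ * ((-(s - τ) : ℝ) : ℂ)) = ζ * s + -ζ * τ by push_cast; ring, Complex.exp_add]
    ring
  rw [e1, e2]
  ring

lemma integral_exp_mul_eq_of_le {ζ : ℂ} {N : ℝ} {f : ℝ → ℂ} (hf : Continuous f)
    (hsupp : ∀ x, N < |x| → f x = 0) (a : ℝ) {s : ℝ} (hs : N ≤ s) :
    ∫ x in a..s, Complex.exp (ζ * x) * f x = ∫ x in a..N, Complex.exp (ζ * x) * f x := by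
  have hc : Continuous fun x : ℝ => Complex.exp (ζ * x) * f x := by fun_prop
  rw [← intervalIntegral.integral_add_adjacent_intervals (hc.intervalIntegrable a N)
    (hc.intervalIntegrable N s), add_eq_left]
  refine (intervalIntegral.integral_congr_ae (g := fun _ => 0) (Eventually.of_forall fun x hx => ?_)).trans
    (by simp)
  rw [uIoc_of_le hs] at hx
  rw [hsupp x (lt_of_lt_of_le hx.1 (le_abs_self x)), mul_zero]

lemma integral_exp_mul_eq_of_ge {ζ : ℂ} {N : ℝ} {f : ℝ → ℂ} (hf : Continuous f)
    (hsupp : ∀ x, N < |x| → f x = 0) (a : ℝ) {s : ℝ} (hs : s ≤ -N) :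
    ∫ x in a..s, Complex.exp (ζ * x) * f x = ∫ x in a..(-N), Complex.exp (ζ * x) * f x := by
  have hc : Continuous fun x : ℝ => Complex.exp (ζ * x) * f x := by fun_prop
  rw [← intervalIntegral.integral_add_adjacent_intervals (hc.intervalIntegrable a (-N))
    (hc.intervalIntegrable (-N) s), add_eq_left]
  refine (intervalIntegral.integral_congr_ae (g := fun _ => 0) ?_).trans (by simp)
  filter_upwards [Measure.ae_ne volume (-N)] with x hne hx
  rw [uIoc_comm, uIoc_of_le hs] at hx
  have hx2 := lt_of_le_of_ne hx.2 hne
  rw [hsupp x (lt_of_lt_of_le (by linarith) (neg_le_abs x)), mul_zero]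

/-- A radiating `A` is tested by the cut-off outgoing solution without boundary contribution. -/
theorem exists_test_function {ζ : ℂ} (hζ : ζ ≠ 0) {N : ℝ} (hN : 0 < N) {A : ℝ → ℂ}
    (hA : ∀ g : ℝ → ℂ, Continuous g → HasCompactSupport g → Integrable fun s => A s * g s)
    {cUp cDown : ℂ} (hUp : ∀ s, N ≤ s → A s = cUp * Complex.exp (-ζ * s))
    (hDown : ∀ s, s ≤ -N → A s = cDown * Complex.exp (ζ * s))
    {f : ℝ → ℂ} (hf : ContDiff ℝ ∞ f) (hsupp : ∀ x, N < |x| → f x = 0) :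
    ∃ b : ℝ → ℂ, ContDiff ℝ ∞ b ∧ HasCompactSupport b ∧ (∀ s, |s| ≤ N → b s = outgoing ζ N f s) ∧
      ∫ s, A s * (deriv (deriv b) s - ζ ^ 2 * b s) = -∫ s, A s * f s := by
  have hfc := hf.continuous
  obtain ⟨σ, hσ, hσ0, hσ1⟩ := exists_smooth_step (Λ := 1) one_pos
  -- Equal to `1` up to `N` and to `0` beyond `N + 1`; the product `η s * η (-s)` is the two-sided
  -- cut-off.
  set η : ℝ → ℂ := fun s => σ (N + 1 - s) with hη
  have hηs : ContDiff ℝ ∞ η := hσ.comp (contDiff_const.sub contDiff_id)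
  have hη' := (contDiff_infty_iff_deriv.1 hηs).2
  have hη'' := (contDiff_infty_iff_deriv.1 hη').2
  have hη1 : ∀ s ≤ N, η s = 1 := fun s hs => hσ1 _ (by linarith)
  have hη0 : ∀ s, N + 1 ≤ s → η s = 0 := fun s hs => hσ0 _ (by linarith)
  have dη1 := deriv_eq_zero_of_eqOn_Iic hηs hη1
  have dη0 := deriv_eq_zero_of_eqOn_Ici hηs hη0
  have ddη1 := deriv_eq_zero_of_eqOn_Iic hη' dη1
  have ddη0 := deriv_eq_zero_of_eqOn_Ici hη' dη0
  have hd0 : ∀ s, HasDerivAt η (deriv η s) s := fun s =>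
    (hηs.differentiable (by norm_num) s).hasDerivAt
  have hd1 : ∀ s, HasDerivAt (deriv η) (deriv (deriv η) s) s := fun s =>
    (hη'.differentiable (by norm_num) s).hasDerivAt
  have hd0n : ∀ s, HasDerivAt (fun s => η (-s)) (-deriv η (-s)) s := fun s => by
    have := (hd0 (-s)).scomp s (hasDerivAt_neg s)
    rwa [neg_one_smul] at this
  have hd1n : ∀ s, HasDerivAt (fun s => deriv η (-s)) (-deriv (deriv η) (-s)) s := fun s => by
    have := (hd1 (-s)).scomp s (hasDerivAt_neg s)
    rwa [neg_one_smul] at this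
  set W := outgoing ζ N f with hW
  set W' := outgoingDeriv ζ N f with hW'
  have dW : ∀ s, HasDerivAt W (W' s) s := hasDerivAt_outgoing hζ N hfc
  have dW' : ∀ s, HasDerivAt W' (ζ ^ 2 * W s - f s) s := hasDerivAt_outgoingDeriv ζ N hfc
  set b : ℝ → ℂ := fun s => η s * η (-s) * W s with hb
  have hbs : ContDiff ℝ ∞ b := (hηs.mul (hηs.comp contDiff_neg)).mul (contDiff_outgoing ζ N hf)
  have hbc : HasCompactSupport b := by
    refine HasCompactSupport.intro (isCompact_Icc (a := -(N + 1)) (b := N + 1)) fun s hs => ?_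
    simp only [hb]
    by_cases h : s < -(N + 1)
    · rw [hη0 (-s) (by linarith)]; ring
    · have : N + 1 < s := by
        by_contra h'
        exact hs ⟨by linarith, by linarith⟩
      rw [hη0 s this.le]; ring
  set b' : ℝ → ℂ := fun s => (deriv η s * η (-s) - η s * deriv η (-s)) * W s +
    η s * η (-s) * W' s with hb'
  have db : deriv b = b' := by
    funext s
    refine (((hd0 s).mul (hd0n s)).mul (dW s)).deriv.trans ?_
    simp only [hb', Pi.mul_apply]
    ring
  -- The commutator of the cut-off with the operator, so that `b'' - ζ² b = E - f`. It is supported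
  -- in `N ≤ |s| ≤ N + 1`.
  set E : ℝ → ℂ := fun s => (deriv (deriv η) s * η (-s) - 2 * deriv η s * deriv η (-s) +
      η s * deriv (deriv η) (-s)) * W s +
      2 * (deriv η s * η (-s) - η s * deriv η (-s)) * W' s with hE
  have ddb : ∀ s, deriv (deriv b) s - ζ ^ 2 * b s = E s - f s := by
    intro s
    rw [db]
    have h1 := ((((hd1 s).mul (hd0n s)).sub ((hd0 s).mul (hd1n s))).mul (dW s)).add
      (((hd0 s).mul (hd0n s)).mul (dW' s))
    have h2 : deriv b' s = _ := h1.deriv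
    rw [h2]
    have hηf : η s * η (-s) * f s = f s := by
      rcases le_or_gt |s| N with h | h
      · have := abs_le.1 h
        rw [hη1 s this.2, hη1 (-s) (by linarith), one_mul, one_mul]
      · rw [hsupp s h, mul_zero]
    simp only [hE, hb, Pi.mul_apply, Pi.sub_apply]
    linear_combination (-1 : ℂ) * hηf
  -- the boundary terms are total derivatives
  set J : ℝ → ℂ := fun s : ℝ => Complex.exp (-(2 * ζ) * s) * (deriv (deriv η) s - 2 * ζ * deriv η s)
    with hJ
  have hK : HasCompactSupport fun s : ℝ => Complex.exp (-(2 * ζ) * s) * deriv η s := by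
    refine HasCompactSupport.intro (isCompact_Icc (a := N) (b := N + 1)) fun s hs => ?_
    by_cases h : s ≤ N
    · rw [dη1 s h, mul_zero]
    · rw [dη0 s (by by_contra h'; exact hs ⟨by linarith, by linarith⟩), mul_zero]
  have hKd : ∀ s : ℝ, HasDerivAt (fun s : ℝ => Complex.exp (-(2 * ζ) * s) * deriv η s) (J s) s := by
    intro s
    refine ((hasDerivAt_exp_mul_ofReal (-(2 * ζ)) s).mul (hd1 s)).congr_deriv ?_
    simp only [hJ]
    ring
  have hKi : Continuous fun s : ℝ => Complex.exp (-(2 * ζ) * s) * deriv η s :=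
    (contDiff_exp_mul_ofReal _).continuous.mul hη'.continuous
  have hJc : Continuous J := (contDiff_exp_mul_ofReal _).continuous.mul
    (hη''.continuous.sub (continuous_const.mul hη'.continuous))
  have hJs : HasCompactSupport J := by
    rw [show J = deriv fun s : ℝ => Complex.exp (-(2 * ζ) * s) * deriv η s from
      funext fun s => (hKd s).deriv.symm]
    exact hK.deriv
  have hJi : Integrable J := hJc.integrable_of_hasCompactSupport hJs
  have hJ0 : ∫ s, J s = 0 := integral_eq_zero_of_hasDerivAt_of_integrable hKd hJi
    (hKi.integrable_of_hasCompactSupport hK)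
  -- Beyond `±N` the functions `A` and `W` are multiples of the same outgoing exponential, so their
  -- product with the derivatives of the cut-off is a multiple of the total derivative `J`. This is
  -- where the radiation condition enters.
  have hAE : ∀ s, A s * E s = cUp * ((∫ x in (-N)..N, Complex.exp (ζ * x) * f x) / (2 * ζ)) * J s +
      cDown * (-(∫ x in N..(-N), Complex.exp (-ζ * x) * f x) / (2 * ζ)) * J (-s) := by
    intro s
    rcases le_or_gt s (-N) with h | h
    · have w0 : W s = -Complex.exp (ζ * s) * (∫ x in N..(-N), Complex.exp (-ζ * x) * f x) / (2 * ζ) := by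
        rw [hW, outgoing, integral_exp_mul_eq_of_ge hfc hsupp _ h,
          integral_exp_mul_eq_of_ge hfc hsupp _ h]
        simp
      have w1 : W' s = -Complex.exp (ζ * s) * (∫ x in N..(-N), Complex.exp (-ζ * x) * f x) / 2 := by
        rw [hW', outgoingDeriv, integral_exp_mul_eq_of_ge hfc hsupp _ h,
          integral_exp_mul_eq_of_ge hfc hsupp _ h]
        simp
      simp only [hE, hJ]
      rw [hDown s h, w0, w1, hη1 s (by linarith), dη1 s (by linarith), ddη1 s (by linarith),
        show -(2 * ζ) * ((-s : ℝ) : ℂ) = ζ * s + ζ * s by push_cast; ring, Complex.exp_add]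
      field_simp
      ring
    · rcases le_or_gt N s with h' | h'
      · have w0 : W s = Complex.exp (-ζ * s) * (∫ x in (-N)..N, Complex.exp (ζ * x) * f x) / (2 * ζ) := by
          rw [hW, outgoing, integral_exp_mul_eq_of_le hfc hsupp _ h',
            integral_exp_mul_eq_of_le hfc hsupp _ h']
          simp
        have w1 : W' s = -Complex.exp (-ζ * s) * (∫ x in (-N)..N, Complex.exp (ζ * x) * f x) / 2 := by
          rw [hW', outgoingDeriv, integral_exp_mul_eq_of_le hfc hsupp _ h',
            integral_exp_mul_eq_of_le hfc hsupp _ h']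
          simp
        simp only [hE, hJ]
        rw [hUp s h', w0, w1, hη1 (-s) (by linarith), dη1 (-s) (by linarith), ddη1 (-s) (by linarith),
          show -(2 * ζ) * (s : ℂ) = -ζ * s + -ζ * s by ring, Complex.exp_add]
        field_simp
        ring
      · simp only [hE, hJ]
        rw [dη1 (-s) (by linarith), ddη1 (-s) (by linarith), dη1 s h'.le, ddη1 s h'.le]
        ring
  have hAE0 : ∫ s, A s * E s = 0 := by
    simp only [hAE]
    rw [integral_add (hJi.const_mul _) (hJi.comp_neg.const_mul _), integral_const_mul,
      integral_const_mul, integral_neg_eq_self J, hJ0]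
    simp
  have hAEi : Integrable fun s => A s * E s := by
    simp only [hAE]
    exact (hJi.const_mul _).add (hJi.comp_neg.const_mul _)
  have hfs : HasCompactSupport f := HasCompactSupport.intro (isCompact_Icc (a := -N) (b := N))
    fun s hs => hsupp s (by
      rw [lt_abs]
      by_contra! h
      exact hs ⟨by linarith [h.2], h.1⟩)
  refine ⟨b, hbs, hbc, fun s hs => ?_, ?_⟩
  · have := abs_le.1 hs
    simp only [hb]
    rw [hη1 s this.2, hη1 (-s) (by linarith), one_mul, one_mul]
  · simp only [ddb, mul_sub]
    rw [integral_sub hAEi (hA f hfc hfs), hAE0, zero_sub]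


/-! ### The modes of the scattered field -/

lemma I_mul_betaMode {k Λ α : ℝ} (hk : 0 < k) (m : ℤ) :
    Complex.I * betaMode k Λ α m = -decay k (alphaMode Λ α m) := by
  rw [betaMode]
  split_ifs with h
  · have h1 : alphaMode Λ α m ^ 2 - k ^ 2 ≤ 0 := by
      rw [← sq_abs, sub_nonpos]
      gcongr
    rw [decay, Real.sqrt_eq_zero_of_nonpos h1]
    push_cast
    ring
  · rw [decay_of_gt hk (not_le.1 h), ← mul_assoc, Complex.I_mul_I]
    ring

lemma integral_hasSum_mul_modeExp {Λ α : ℝ} (hΛ : 0 < Λ) {c : ℤ → ℂ} {g : ℝ → ℂ}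
    (hg : ∀ t ∈ Ioo (-Λ / 2) (Λ / 2),
      HasSum (fun n : ℤ => c n * Complex.exp (Complex.I * (alphaMode Λ α n * t : ℝ))) (g t))
    (m : ℤ) : ∫ t, g t * modeExp (alphaMode Λ α m) t ∂cellMeasure Λ = Λ * c m := by
  -- The modes have modulus one, so convergence at the single point `t = 0` already gives absolute
  -- summability of the coefficients and permits integration term by term.
  have hc : Summable fun n => ‖c n‖ := by
    have h := (hg 0 ⟨by linarith, by linarith⟩).summable.norm
    simpa only [norm_mul, norm_exp_I_mul_ofReal, mul_one] using h
  have h := intervalIntegral.hasSum_integral_of_dominated_convergence (μ := volume)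
    (a := -Λ / 2) (b := Λ / 2)
    (F := fun (n : ℤ) (t : ℝ) => c n * Complex.exp (Complex.I * (alphaMode Λ α n * t : ℝ)) *
      modeExp (alphaMode Λ α m) t)
    (f := fun t => g t * modeExp (alphaMode Λ α m) t) (fun n _ => ‖c n‖)
    (fun n => Continuous.aestronglyMeasurable
      (Continuous.mul (by fun_prop) (contDiff_modeExp _).continuous))
    (fun n => Eventually.of_forall fun t _ => by
      rw [norm_mul, norm_mul, norm_exp_I_mul_ofReal, norm_modeExp, mul_one, mul_one])
    (Eventually.of_forall fun t _ => hc) intervalIntegrable_const (by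
      filter_upwards [Measure.ae_ne volume (Λ / 2)] with t hne ht
      rw [uIoc_of_le (by linarith)] at ht
      exact (hg t ⟨ht.1, lt_of_le_of_ne ht.2 hne⟩).mul_right _)
  have e : ∀ n : ℤ, ∫ t in (-Λ / 2)..(Λ / 2), c n *
      Complex.exp (Complex.I * (alphaMode Λ α n * t : ℝ)) * modeExp (alphaMode Λ α m) t =
      if n = m then Λ * c m else 0 := by
    intro n
    have h1 := integral_exp_alphaMode (α := α) hΛ (-Λ / 2) m n
    rw [show -Λ / 2 + Λ = Λ / 2 by ring] at h1
    simp only [mul_assoc, modeExp]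
    rw [intervalIntegral.integral_const_mul, h1]
    split_ifs with h2
    · rw [h2, mul_comm]
    · simp
  simp only [e] at h
  rw [integral_cellMeasure hΛ]
  exact h.unique (hasSum_ite_eq m _)

def planeWave (α β : ℝ) (p : ℝ × ℝ) : ℂ :=
  Complex.exp (Complex.I * (α * p.1 : ℝ)) * Complex.exp (-(Complex.I * β) * (p.2 : ℝ))

lemma integral_exp_mul_helmholtz (ζ : ℂ) {b : ℝ → ℂ} (hb : ContDiff ℝ ∞ b)
    (hb' : HasCompactSupport b) :
    ∫ s : ℝ, Complex.exp (-ζ * s) * (deriv (deriv b) s - ζ ^ 2 * b s) = 0 := by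
  have h0 := (contDiff_infty_iff_deriv.1 hb).1
  have hb1 := (contDiff_infty_iff_deriv.1 hb).2
  have h1 := (contDiff_infty_iff_deriv.1 hb1).1
  have hb2 := (contDiff_infty_iff_deriv.1 hb1).2
  have hc := (contDiff_exp_mul_ofReal (-ζ)).continuous
  refine integral_eq_zero_of_hasDerivAt_of_integrable
    (f := fun s : ℝ => Complex.exp (-ζ * s) * (deriv b s + ζ * b s)) (fun s => ?_) ?_ ?_
  · refine ((hasDerivAt_exp_mul_ofReal (-ζ) s).mul
      ((h1 s).hasDerivAt.add ((h0 s).hasDerivAt.const_mul ζ))).congr_deriv ?_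
    simp only [Pi.add_apply]
    ring
  · exact (hc.mul (hb2.continuous.sub (continuous_const.mul
      hb.continuous))).integrable_of_hasCompactSupport (hb'.deriv.deriv.sub hb'.mul_left).mul_left
  · exact (hc.mul (hb1.continuous.add (continuous_const.mul
      hb.continuous))).integrable_of_hasCompactSupport (hb'.deriv.add hb'.mul_left).mul_left

/-- Orthogonality removes all modes except `m = 0`, and in that mode `e^{-iβs}` solves the
homogeneous equation because `(iβ)² = α² - k²`. -/
lemma integral_planeWave_mode {k Λ α β : ℝ} (hΛ : 0 < Λ) (hβ : β ^ 2 = k ^ 2 - α ^ 2) (m : ℤ)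
    {b : ℝ → ℂ} (hb : ContDiff ℝ ∞ b) (hb' : HasCompactSupport b) :
    ∫ p : ℝ × ℝ, planeWave α β p * modeExp (alphaMode Λ α m) p.1 *
      (deriv (deriv b) p.2 - decay k (alphaMode Λ α m) ^ 2 * b p.2) ∂(cellMeasure Λ).prod volume
      = 0 := by
  have e : ∀ p : ℝ × ℝ, planeWave α β p * modeExp (alphaMode Λ α m) p.1 *
      (deriv (deriv b) p.2 - decay k (alphaMode Λ α m) ^ 2 * b p.2) =
      (Complex.exp (Complex.I * (α * p.1 : ℝ)) * modeExp (alphaMode Λ α m) p.1) *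
      (Complex.exp (-(Complex.I * β) * (p.2 : ℝ)) *
        (deriv (deriv b) p.2 - decay k (alphaMode Λ α m) ^ 2 * b p.2)) := fun p => by
    rw [planeWave]; ring
  simp only [e]
  rw [integral_prod_mul (fun t : ℝ => Complex.exp (Complex.I * (α * t : ℝ)) *
    modeExp (alphaMode Λ α m) t) (fun s : ℝ => Complex.exp (-(Complex.I * β) * s) *
        (deriv (deriv b) s - decay k (alphaMode Λ α m) ^ 2 * b s))]
  have h1 := integral_exp_alphaMode (α := α) hΛ (-Λ / 2) m 0
  rw [show -Λ / 2 + Λ = Λ / 2 by ring, ← integral_cellMeasure hΛ] at h1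
  have e0 : alphaMode Λ α 0 = α := by simp [alphaMode]
  simp only [e0] at h1
  by_cases hm : m = 0
  · have h2 : decay k (alphaMode Λ α m) ^ 2 = (Complex.I * β) ^ 2 := by
      rw [hm, e0, decay_sq, mul_pow, Complex.I_sq, ← Complex.ofReal_pow, hβ]
      push_cast
      ring
    rw [h2, integral_exp_mul_helmholtz _ hb hb', mul_zero]
  · rw [if_neg (fun h => hm h.symm)] at h1
    unfold modeExp
    rw [h1, zero_mul]

lemma integrable_planeWave_mul (Λ α β : ℝ) {g : ℝ → ℂ} (hg : Continuous g)
    (hg' : HasCompactSupport g) :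
    Integrable (fun p : ℝ × ℝ => planeWave α β p * g p.2) ((cellMeasure Λ).prod volume) := by
  have h1 : Integrable (fun t : ℝ => Complex.exp (Complex.I * (α * t : ℝ))) (cellMeasure Λ) :=
    Integrable.of_bound (C := 1) (Continuous.aestronglyMeasurable (by fun_prop))
      (Eventually.of_forall fun t => (norm_exp_I_mul_ofReal _).le)
  have h2 : Integrable fun s : ℝ => Complex.exp (-(Complex.I * β) * s) * g s :=
    ((contDiff_exp_mul_ofReal _).continuous.mul hg).integrable_of_hasCompactSupport hg'.mul_left
  refine (h1.mul_prod h2).congr (Eventually.of_forall fun p => ?_)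
  simp only [planeWave]
  ring

lemma locallyIntegrable_of_mul_test {A : ℝ → ℂ}
    (hA : ∀ g : ℝ → ℂ, Continuous g → HasCompactSupport g → Integrable fun s => A s * g s) :
    LocallyIntegrable A := by
  intro x
  let φ : ContDiffBump x := ⟨1, 2, one_pos, one_lt_two⟩
  refine ⟨Metric.closedBall x 1, Metric.closedBall_mem_nhds x one_pos, ?_⟩
  have h := hA (fun s => (φ s : ℂ)) (Complex.continuous_ofReal.comp φ.continuous)
    (φ.hasCompactSupport.comp_left Complex.ofReal_zero)
  refine (h.integrableOn (s := Metric.closedBall x 1)).congr_fun (fun s hs => ?_)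
    Metric.isClosed_closedBall.measurableSet
  simp only
  rw [φ.one_of_mem_closedBall hs]
  simp

/-- Pairing of the layer-wise potential with a test function. -/
lemma integrable_profile_kernel {ζ : ℂ} (hζ : 0 ≤ ζ.re) {F : ℝ × ℝ → ℂ} (hF : Integrable F)
    {g : ℝ → ℂ} (hg : Integrable g) :
    Integrable (fun z : (ℝ × ℝ) × ℝ => F z.1 * profile |z.2 - z.1.2| ζ * g z.2)
      (volume.prod volume) := by
  have h1 : Continuous fun z : (ℝ × ℝ) × ℝ => profile |z.2 - z.1.2| ζ := by
    unfold profile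
    fun_prop
  refine ((hF.mul_prod hg).mul_bdd (c := 1 / (2 * ‖ζ‖)) h1.aestronglyMeasurable
    (Eventually.of_forall fun z => norm_profile_le (abs_nonneg _) hζ)).congr
    (Eventually.of_forall fun z => ?_)
  simp only
  ring

/-- The `m`-th mode of a radiating field is the layer-wise potential of its sources. -/
theorem ae_integral_scattered_mul_modeExp {k Λ α β : ℝ} (hk : 0 < k) (hΛ : 0 < Λ)
    (hW : ∀ m : ℤ, |alphaMode Λ α m| ≠ k) (hβ : β ^ 2 = k ^ 2 - α ^ 2) {U Us Γ : ℝ × ℝ → ℂ}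
    (hweak : ∀ a b : ℝ → ℂ, ContDiff ℝ ∞ a → ContDiff ℝ ∞ b → HasCompactSupport a →
      HasCompactSupport b → ∫ p : ℝ × ℝ, U p * (deriv (deriv a) p.1 * b p.2 +
        a p.1 * deriv (deriv b) p.2 + (k : ℂ) ^ 2 * Γ p * (a p.1 * b p.2)) = 0)
    (hU : ∀ g : ℝ → ℂ, Continuous g → HasCompactSupport g →
      Integrable (fun p : ℝ × ℝ => U p * g p.2) ((cellMeasure Λ).prod volume))
    (hΓ : MemLp (fun p => Γ p - 1) ⊤ ((cellMeasure Λ).prod volume))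
    (hΓper : ∀ t s, Γ (t + Λ, s) = Γ (t, s))
    (hUper : ∀ t s, U (t + Λ, s) * Complex.exp (-Complex.I * (Λ * α : ℝ)) = U (t, s))
    (hsum : ∀ p, U p = Us p + planeWave α β p) {H : ℝ} (hH : 0 < H) {cUp cDown : ℤ → ℂ}
    (hUp : ∀ t ∈ Ioo (-Λ / 2) (Λ / 2), ∀ s, H ≤ s → HasSum (fun n : ℤ => cUp n *
      Complex.exp (Complex.I * (alphaMode Λ α n : ℂ) * t + Complex.I * betaMode k Λ α n * s))
      (Us (t, s)))
    (hDown : ∀ t ∈ Ioo (-Λ / 2) (Λ / 2), ∀ s, s ≤ -H → HasSum (fun n : ℤ => cDown n *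
      Complex.exp (Complex.I * (alphaMode Λ α n : ℂ) * t - Complex.I * betaMode k Λ α n * s))
      (Us (t, s)))
    {F : ℝ × ℝ → ℂ} (hF : Integrable F) {R : ℝ} (hFR : ∀ q, F q ≠ 0 → |q.2| ≤ R)
    (hFeq : F = (Ioo (-Λ / 2) (Λ / 2) ×ˢ univ).indicator fun p => (k : ℂ) ^ 2 * (Γ p - 1) * U p)
    (m : ℤ) :
    ∀ᵐ s, ∫ t, Us (t, s) * modeExp (alphaMode Λ α m) t ∂cellMeasure Λ =
      ∫ q : ℝ × ℝ, F q * modeExp (alphaMode Λ α m) q.1 *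
        profile |s - q.2| (decay k (alphaMode Λ α m)) := by
  set ξ := alphaMode Λ α m with hξ
  set ζ := decay k ξ with hζdef
  have hζ : ζ ≠ 0 := decay_ne_zero (hW m) hk
  set ν := (cellMeasure Λ).prod (volume : Measure ℝ) with hν
  set A : ℝ → ℂ := fun s => ∫ t, Us (t, s) * modeExp ξ t ∂cellMeasure Λ with hA
  set B : ℝ → ℂ := fun s => ∫ q : ℝ × ℝ, F q * modeExp ξ q.1 * profile |s - q.2| ζ with hB
  have hFE : Integrable fun q : ℝ × ℝ => F q * modeExp ξ q.1 :=
    hF.mul_bdd (c := 1) ((contDiff_modeExp ξ).continuous.comp continuous_fst).aestronglyMeasurable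
      (Eventually.of_forall fun p => (norm_modeExp _ _).le)
  have hUsE : ∀ g : ℝ → ℂ, Continuous g → HasCompactSupport g →
      Integrable (fun p : ℝ × ℝ => Us p * modeExp ξ p.1 * g p.2) ν := fun g hg hg' => by
    refine (((hU g hg hg').sub (integrable_planeWave_mul Λ α β hg hg')).mul_bdd (c := 1)
      ((contDiff_modeExp ξ).continuous.comp continuous_fst).aestronglyMeasurable
      (Eventually.of_forall fun p => (norm_modeExp _ _).le)).congr
      (Eventually.of_forall fun p => ?_)
    simp only [Pi.sub_apply, hsum, Function.comp]
    ring
  have hIE : ∀ g : ℝ → ℂ, Continuous g → HasCompactSupport g →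
      Integrable (fun p : ℝ × ℝ => planeWave α β p * modeExp ξ p.1 * g p.2) ν := fun g hg hg' => by
    refine ((integrable_planeWave_mul Λ α β hg hg').mul_bdd (c := 1)
      ((contDiff_modeExp ξ).continuous.comp continuous_fst).aestronglyMeasurable
      (Eventually.of_forall fun p => (norm_modeExp _ _).le)).congr
      (Eventually.of_forall fun p => ?_)
    simp only [Function.comp]
    ring
  have hAg : ∀ g : ℝ → ℂ, Continuous g → HasCompactSupport g →
      Integrable fun s => A s * g s := fun g hg hg' => by
    have h := (hUsE g hg hg').integral_prod_right
    refine h.congr (Eventually.of_forall fun s => ?_)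
    simp only [hA]
    rw [integral_mul_const]
  have hAint : ∀ g : ℝ → ℂ, Continuous g → HasCompactSupport g →
      ∫ p : ℝ × ℝ, Us p * modeExp ξ p.1 * g p.2 ∂ν = ∫ s, A s * g s := fun g hg hg' => by
    rw [integral_prod_symm _ (hUsE g hg hg')]
    refine integral_congr_ae (Eventually.of_forall fun s => ?_)
    simp only [hA]
    rw [integral_mul_const]
  have hBg : ∀ g : ℝ → ℂ, Continuous g → HasCompactSupport g →
      Integrable (fun s => B s * g s) ∧
      ∫ s, B s * g s = ∫ q : ℝ × ℝ, F q * modeExp ξ q.1 * ∫ s, profile |q.2 - s| ζ * g s := by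
    intro g hg hg'
    have hk2 := integrable_profile_kernel (decay_re_nonneg k ξ) hFE
      (hg.integrable_of_hasCompactSupport hg')
    have e : ∀ s, B s * g s = ∫ q : ℝ × ℝ, F q * modeExp ξ q.1 * profile |s - q.2| ζ * g s :=
      fun s => by simp only [hB]; rw [integral_mul_const]
    refine ⟨hk2.integral_prod_right.congr (Eventually.of_forall fun s => (e s).symm), ?_⟩
    simp only [e]
    rw [← integral_integral_swap (f := fun (q : ℝ × ℝ) (s : ℝ) =>
      F q * modeExp ξ q.1 * profile |s - q.2| ζ * g s) hk2]
    refine integral_congr_ae (Eventually.of_forall fun q => ?_)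
    simp only
    rw [← integral_const_mul]
    refine integral_congr_ae (Eventually.of_forall fun s => ?_)
    simp only
    rw [abs_sub_comm, mul_assoc]
  have hAUp : ∀ s, H ≤ s → A s = Λ * cUp m * Complex.exp (-ζ * s) := fun s hs => by
    simp only [hA]
    rw [integral_hasSum_mul_modeExp (α := α) hΛ (c := fun n => cUp n *
      Complex.exp (Complex.I * betaMode k Λ α n * s)) (g := fun t => Us (t, s)) (fun t ht => ?_) m]
    · rw [I_mul_betaMode hk]; ring
    · refine (hUp t ht s hs).congr_fun fun n => ?_
      rw [mul_assoc, ← Complex.exp_add]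
      congr 2
      push_cast
      ring
  have hADown : ∀ s, s ≤ -H → A s = Λ * cDown m * Complex.exp (ζ * s) := fun s hs => by
    simp only [hA]
    rw [integral_hasSum_mul_modeExp (α := α) hΛ (c := fun n => cDown n *
      Complex.exp (-(Complex.I * betaMode k Λ α n) * s)) (g := fun t => Us (t, s)) (fun t ht => ?_) m]
    · rw [I_mul_betaMode hk, neg_neg]; ring
    · refine (hDown t ht s hs).congr_fun fun n => ?_
      rw [mul_assoc, ← Complex.exp_add]
      congr 2
      push_cast
      ring
  -- The two sides are compared weakly. For a test function `g`, let `b` be the cut-off outgoing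
  -- solution of `b'' - ζ² b = -g`; testing the mode equation with `b` and the symmetry of the
  -- kernel `profile |s - τ|` give the same pairing.
  refine ae_eq_of_integral_contDiff_smul_eq (locallyIntegrable_of_mul_test hAg)
    (locallyIntegrable_of_mul_test fun g hg hg' => (hBg g hg hg').1) fun g hg hg' => ?_
  set f : ℝ → ℂ := fun s => (g s : ℂ) with hf
  have hfs : ContDiff ℝ ∞ f := Complex.ofRealCLM.contDiff.comp hg
  have hfc : HasCompactSupport f := hg'.comp_left Complex.ofReal_zero
  obtain ⟨R₀, hR₀⟩ := hfc.isCompact.isBounded.exists_norm_le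
  -- Large enough for the Rayleigh expansions to hold beyond `±N` and for both the sources and the
  -- support of `f` to lie within `|s| ≤ N`.
  set N := max H (max R R₀) with hN
  have hNH : H ≤ N := le_max_left _ _
  have hNR : R ≤ N := (le_max_left _ _).trans (le_max_right _ _)
  have hNR₀ : R₀ ≤ N := (le_max_right _ _).trans (le_max_right _ _)
  have hsupp : ∀ x, N < |x| → f x = 0 := fun x hx => by
    by_contra h
    have := hR₀ x (subset_tsupport f h)
    rw [Real.norm_eq_abs] at this
    linarith
  obtain ⟨b, hb, hb', hbW, hbA⟩ := exists_test_function hζ (hH.trans_le hNH) hAg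
    (fun s hs => hAUp s (hNH.trans hs)) (fun s hs => hADown s (hs.trans (neg_le_neg hNH))) hfs hsupp
  have hb'' : ContDiff ℝ ∞ (deriv (deriv b)) :=
    (contDiff_infty_iff_deriv.1 (contDiff_infty_iff_deriv.1 hb).2).2
  have hop : Continuous fun s => deriv (deriv b) s - ζ ^ 2 * b s :=
    hb''.continuous.sub (continuous_const.mul hb.continuous)
  have hop' : HasCompactSupport fun s => deriv (deriv b) s - ζ ^ 2 * b s :=
    hb'.deriv.deriv.sub hb'.mul_left
  have key := integral_mode_helmholtz hΛ m hweak hU hΓ hΓper hUper hb hb'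
  have split : ∫ p : ℝ × ℝ, U p * modeExp ξ p.1 * (deriv (deriv b) p.2 - ζ ^ 2 * b p.2) ∂ν =
      ∫ s, A s * (deriv (deriv b) s - ζ ^ 2 * b s) := by
    rw [← hAint _ hop hop', ← add_zero (∫ p : ℝ × ℝ, Us p * _ * _ ∂ν),
      ← integral_planeWave_mode hΛ hβ m hb hb', ← integral_add (hUsE _ hop hop') (hIE _ hop hop')]
    refine integral_congr_ae (Eventually.of_forall fun p => ?_)
    simp only [hsum]
    ring
  have hsrc : ∫ p : ℝ × ℝ, (k : ℂ) ^ 2 * (Γ p - 1) * U p * modeExp ξ p.1 * b p.2 ∂ν =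
      ∫ q : ℝ × ℝ, F q * modeExp ξ q.1 * b q.2 := by
    rw [hν, cellMeasure_prod, ← integral_indicator (measurableSet_Ioo.prod MeasurableSet.univ)]
    refine integral_congr_ae (Eventually.of_forall fun p => ?_)
    simp only [hFeq, indicator_apply]
    split_ifs <;> simp
  rw [split, hsrc, hbA] at key
  have key2 := neg_injective key
  have e1 : ∫ s, g s • A s = ∫ s, A s * f s := by
    refine integral_congr_ae (Eventually.of_forall fun s => ?_)
    simp only [hf, Complex.real_smul, mul_comm]
  have e2 : ∫ s, g s • B s = ∫ s, B s * f s := by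
    refine integral_congr_ae (Eventually.of_forall fun s => ?_)
    simp only [hf, Complex.real_smul, mul_comm]
  rw [e1, e2, key2, (hBg f hfs.continuous hfc).2]
  refine integral_congr_ae (Eventually.of_forall fun q => ?_)
  simp only
  by_cases h : F q = 0
  · simp [h]
  · have h1 := (hFR q h).trans hNR
    rw [hbW q.2 h1, outgoing_eq_integral hfs.continuous hsupp h1]


/-! ### Uniqueness from the Fourier modes -/

lemma modeExp_alphaMode_eq {Λ α : ℝ} (m : ℤ) (t : ℝ) :
    modeExp (alphaMode Λ α m) t = modeExp α t * fourier (-m) (t : AddCircle Λ) := by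
  rw [fourier_coe_apply, modeExp, modeExp, ← Complex.exp_add]
  congr 1
  unfold alphaMode
  push_cast
  ring

/-- After removal of the factor `e^{-iαt}`, the hypothesis says that a continuous functional on
`C(AddCircle Λ, ℂ)` vanishes on all characters, hence everywhere by density of trigonometric
polynomials. Every test function supported in the open cell extends periodically. -/
lemma ae_eq_zero_of_integral_modeExp_eq_zero {Λ α : ℝ} (hΛ : 0 < Λ) {W : ℝ → ℂ}
    (hW : Integrable W (cellMeasure Λ))
    (h0 : ∀ m : ℤ, ∫ t, W t * modeExp (alphaMode Λ α m) t ∂cellMeasure Λ = 0) :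
    W =ᵐ[cellMeasure Λ] 0 := by
  have : Fact (0 < Λ) := ⟨hΛ⟩
  have hW0 : Integrable (fun t => W t * modeExp α t) (cellMeasure Λ) :=
    hW.mul_bdd (c := 1) (contDiff_modeExp α).continuous.aestronglyMeasurable
      (Eventually.of_forall fun t => (norm_modeExp _ _).le)
  have hi : ∀ h : C(AddCircle Λ, ℂ),
      Integrable (fun t : ℝ => W t * modeExp α t * h (t : AddCircle Λ)) (cellMeasure Λ) := fun h =>
    hW0.mul_bdd (c := ‖h‖) (h.continuous.comp (AddCircle.continuous_mk' Λ)).aestronglyMeasurable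
      (Eventually.of_forall fun t => h.norm_coe_le_norm _)
  let L : C(AddCircle Λ, ℂ) →L[ℂ] ℂ := LinearMap.mkContinuous
    { toFun := fun h => ∫ t : ℝ, W t * modeExp α t * h (t : AddCircle Λ) ∂cellMeasure Λ
      map_add' := fun h₁ h₂ => by
        rw [← integral_add (hi h₁) (hi h₂)]
        simp only [ContinuousMap.add_apply, mul_add]
      map_smul' := fun c h => by
        simp only [ContinuousMap.smul_apply, RingHom.id_apply, smul_eq_mul]
        rw [← integral_const_mul]
        refine integral_congr_ae (Eventually.of_forall fun t => ?_)
        simp only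
        ring }
    (∫ t, ‖W t * modeExp α t‖ ∂cellMeasure Λ) fun h => by
      refine (norm_integral_le_integral_norm _).trans ?_
      rw [← integral_mul_const]
      refine integral_mono (hi h).norm (hW0.norm.mul_const _) fun t => ?_
      simp only
      rw [norm_mul]
      gcongr
      exact h.norm_coe_le_norm _
  have hLapp : ∀ h, L h = ∫ t : ℝ, W t * modeExp α t * h (t : AddCircle Λ) ∂cellMeasure Λ :=
    fun h => rfl
  have hspan : Submodule.span ℂ (range (@fourier Λ)) ≤ L.ker := by
    rw [Submodule.span_le]
    rintro _ ⟨n, rfl⟩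
    change L (fourier n) = 0
    rw [hLapp, ← h0 (-n)]
    refine integral_congr_ae (Eventually.of_forall fun t => ?_)
    simp only
    rw [modeExp_alphaMode_eq, neg_neg, mul_assoc]
  have hL0 : ∀ h, L h = 0 := fun h => by
    have h1 := Submodule.topologicalClosure_minimal _ hspan L.isClosed_ker
    rw [span_fourier_closure_eq_top] at h1
    exact h1 (Submodule.mem_top : h ∈ ⊤)
  have key := isOpen_Ioo.ae_eq_zero_of_integral_contDiff_smul_eq_zero (μ := volume) (f := W)
    (U := Ioo (-Λ / 2) (Λ / 2)) (IntegrableOn.locallyIntegrableOn hW) fun g hg hg' hgs => ?_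
  · exact (ae_restrict_iff' measurableSet_Ioo).2 key
  · have hgz : ∀ t, t ∉ Ioo (-Λ / 2) (Λ / 2) → g t = 0 := fun t ht =>
      image_eq_zero_of_notMem_tsupport fun h => ht (hgs h)
    -- The factor `modeExp (-α)` undoes the quasi-periodic twist contained in the functional.
    let F : ℝ → ℂ := fun t => (g t : ℂ) * modeExp (-α) t
    have hFc : Continuous F := (Complex.continuous_ofReal.comp hg.continuous).mul
      (contDiff_modeExp _).continuous
    let h : C(AddCircle Λ, ℂ) := ⟨AddCircle.liftIco Λ (-Λ / 2) F, AddCircle.liftIco_continuous (by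
      simp only [F]
      rw [hgz (-Λ / 2) (by simp), hgz (-Λ / 2 + Λ) (fun h => by linarith [h.2])]
      simp) hFc.continuousOn⟩
    rw [← setIntegral_eq_integral_of_forall_compl_eq_zero (s := Ioo (-Λ / 2) (Λ / 2))
      (fun t ht => by rw [hgz t ht, zero_smul]), ← hL0 h, hLapp]
    refine integral_congr_ae ?_
    filter_upwards [ae_cellMeasure Λ] with t ht
    have h1 : h (t : AddCircle Λ) = F t :=
      AddCircle.liftIco_coe_apply (p := Λ) (a := -Λ / 2) (f := F)
        (show t ∈ Ico (-Λ / 2) (-Λ / 2 + Λ) from ⟨ht.1.le, by linarith [ht.2]⟩)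
    rw [h1]
    have h2 : modeExp α t * modeExp (-α) t = 1 := by
      rw [modeExp, modeExp, ← Complex.exp_add]
      simp
    simp only [F]
    rw [Complex.real_smul]
    linear_combination (-(g t : ℂ) * W t) * h2

/-- A field with the modes of a potential is that potential. -/
lemma ae_eq_latticePotential {k Λ α δ : ℝ} (hk : 0 < k) (hΛ : 0 < Λ) (hδ : 0 < δ)
    (hW : ∀ m : ℤ, |alphaMode Λ α m| ≠ k) {F : ℝ × ℝ → ℂ} (hFi : Integrable F)
    (hF : ∀ q, F q ≠ 0 → |q.1| ≤ Λ / 2 - δ) {Us : ℝ × ℝ → ℂ}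
    (hUsm : AEStronglyMeasurable Us ((cellMeasure Λ).prod volume))
    (hUs : ∀ g : ℝ → ℂ, Continuous g → HasCompactSupport g →
      Integrable (fun p : ℝ × ℝ => Us p * g p.2) ((cellMeasure Λ).prod volume))
    (hmode : ∀ m : ℤ, ∀ᵐ s, ∫ t, Us (t, s) * modeExp (alphaMode Λ α m) t ∂cellMeasure Λ =
      ∫ q : ℝ × ℝ, F q * modeExp (alphaMode Λ α m) q.1 *
        profile |s - q.2| (decay k (alphaMode Λ α m))) :
    Us =ᵐ[(cellMeasure Λ).prod volume] latticePotential k Λ α F := by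
  -- Countably many cut-offs exhaust the line, so almost every horizontal slice of the field is
  -- integrable over the cell.
  have hslice : ∀ᵐ s, ∀ n : ℕ, |s| ≤ (n : ℝ) + 1 → Integrable (fun t => Us (t, s)) (cellMeasure Λ) := by
    rw [ae_all_iff]
    intro n
    let φ : ContDiffBump (0 : ℝ) := ⟨n + 1, n + 2, by positivity, by linarith⟩
    have h := hUs (fun s => (φ s : ℂ)) (Complex.continuous_ofReal.comp φ.continuous)
      (φ.hasCompactSupport.comp_left Complex.ofReal_zero)
    filter_upwards [h.prod_left_ae] with s hs hsn
    have h1 : φ s = 1 := φ.one_of_mem_closedBall (by simpa using hsn)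
    simpa [h1] using hs
  have hzero : ∀ᵐ s, (fun t => Us (t, s) - latticePotential k Λ α F (t, s)) =ᵐ[cellMeasure Λ] 0 := by
    filter_upwards [hslice, ae_all_iff.2 hmode] with s hs hm
    obtain ⟨n, hn⟩ := exists_nat_ge |s|
    have hi1 := hs n (by linarith)
    have hi2 : Integrable (fun t => latticePotential k Λ α F (t, s)) (cellMeasure Λ) :=
      (integrable_latticeGreen_mul hk hΛ hδ hW hFi hF s).integral_prod_left
    refine ae_eq_zero_of_integral_modeExp_eq_zero (α := α) hΛ (hi1.sub hi2) fun m => ?_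
    have hb : ∀ {f : ℝ → ℂ}, Integrable f (cellMeasure Λ) →
        Integrable (fun t => f t * modeExp (alphaMode Λ α m) t) (cellMeasure Λ) := fun hf =>
      hf.mul_bdd (c := 1) (contDiff_modeExp _).continuous.aestronglyMeasurable
        (Eventually.of_forall fun t => (norm_modeExp _ _).le)
    have h2 := integral_latticePotential_mul_exp hk hΛ hδ hW hFi hF s m
    have h3 := hm m
    simp only [sub_mul]
    rw [integral_sub (hb hi1) (hb hi2), h3, sub_eq_zero]
    exact h2.symm
  have hm : AEStronglyMeasurable (fun p => Us p - latticePotential k Λ α F p)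
      ((cellMeasure Λ).prod volume) :=
    hUsm.sub (aestronglyMeasurable_latticePotential hk hΛ hδ hW hFi.aestronglyMeasurable hF)
  have h1 : ∫⁻ p, ‖Us p - latticePotential k Λ α F p‖ₑ ∂(cellMeasure Λ).prod volume = 0 := by
    rw [lintegral_prod_symm _ hm.enorm]
    refine lintegral_eq_zero_of_ae_eq_zero ?_
    filter_upwards [hzero] with s hs
    refine lintegral_eq_zero_of_ae_eq_zero ?_
    filter_upwards [hs] with t ht
    simp only [Pi.zero_apply] at ht ⊢
    rw [ht, enorm_zero]
  rw [lintegral_eq_zero_iff' hm.enorm] at h1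
  filter_upwards [h1] with p hp
  simpa [sub_eq_zero] using hp


/-! ### Scattered fields in the plane -/

lemma measurableSet_unitCell (Λ : ℝ) : MeasurableSet (unitCell Λ) := by
  rw [unitCell_eq_preimage]
  exact planeEquiv.measurable (measurableSet_Ioo.prod MeasurableSet.univ)

lemma isOpen_unitCell (Λ : ℝ) : IsOpen (unitCell Λ) := by
  rw [unitCell_eq_preimage]
  exact (isOpen_Ioo.prod isOpen_univ).preimage continuous_planeEquiv

lemma planeEquiv_symm_mem_unitCell {Λ : ℝ} {p : ℝ × ℝ} :
    planeEquiv.symm p ∈ unitCell Λ ↔ p.1 ∈ Ioo (-Λ / 2) (Λ / 2) := by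
  rw [planeEquiv_symm_apply]
  simp [unitCell]

lemma shift_planeEquiv_symm (Λ t s : ℝ) :
    shift Λ (planeEquiv.symm (t, s)) = planeEquiv.symm (t + Λ, s) := by
  rw [planeEquiv_symm_apply, planeEquiv_symm_apply, shift]
  simp

lemma incidentWave_planeEquiv_symm (α β : ℝ) (p : ℝ × ℝ) :
    incidentWave α β (planeEquiv.symm p) = planeWave α β p := by
  rw [planeEquiv_symm_apply, incidentWave, planeWave, ← Complex.exp_add]
  congr 1
  simp
  ring

lemma planeWave_add_period (Λ α β t s : ℝ) :
    planeWave α β (t + Λ, s) * Complex.exp (-Complex.I * (Λ * α : ℝ)) = planeWave α β (t, s) := by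
  rw [planeWave, planeWave, ← Complex.exp_add, ← Complex.exp_add, ← Complex.exp_add]
  congr 1
  push_cast
  ring

lemma continuous_planeWave (α β : ℝ) : Continuous (planeWave α β) := by
  have : planeWave α β = fun p : ℝ × ℝ =>
    Complex.exp (Complex.I * (α * p.1 : ℝ)) * Complex.exp (-(Complex.I * β) * (p.2 : ℝ)) := rfl
  rw [this]
  fun_prop

lemma measurePreserving_planeEquiv_symm_cell (Λ : ℝ) :
    MeasurePreserving planeEquiv.symm ((cellMeasure Λ).prod volume)
      (volume.restrict (unitCell Λ)) :=
  (measurePreserving_planeEquiv_cell Λ).symm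

lemma integrable_mul_of_locallyIntegrable {Λ : ℝ} {u : Plane → ℂ} (hu : LocallyIntegrable u)
    {g : ℝ → ℂ} (hg : Continuous g) (hg' : HasCompactSupport g) :
    Integrable (fun p : ℝ × ℝ => u (planeEquiv.symm p) * g p.2) ((cellMeasure Λ).prod volume) := by
  have hK : IsCompact (planeEquiv.symm '' (Icc (-Λ / 2) (Λ / 2) ×ˢ tsupport g)) :=
    (isCompact_Icc.prod hg'.isCompact).image continuous_planeEquiv_symm
  have h1 : IntegrableOn (fun x : Plane => u x * g (x 1))
      (planeEquiv.symm '' (Icc (-Λ / 2) (Λ / 2) ×ˢ tsupport g)) :=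
    (hu.integrableOn_isCompact hK).mul_continuousOn (Continuous.continuousOn (by fun_prop)) hK
  have h2 : IntegrableOn (fun x : Plane => u x * g (x 1)) (unitCell Λ) := by
    refine h1.of_forall_sdiff_eq_zero (measurableSet_unitCell Λ) fun x hx => ?_
    rw [image_eq_zero_of_notMem_tsupport (f := g), mul_zero]
    exact fun h => hx.2 ⟨planeEquiv x, ⟨⟨hx.1.1.le, hx.1.2.le⟩, h⟩, by simp⟩
  have h3 := (measurePreserving_planeEquiv_symm_cell Λ).integrable_comp_emb
    planeEquiv.symm.measurableEmbedding (g := fun x : Plane => u x * g (x 1))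
  refine (h3.2 h2).congr (Eventually.of_forall fun p => ?_)
  simp [planeEquiv_symm_apply]

lemma mem_scatterer {Λ : ℝ} {γ : Plane → ℂ} {x : Plane} (hx : x ∈ unitCell Λ) (h : γ x - 1 ≠ 0) :
    x ∈ scatterer Λ γ :=
  subset_closure ⟨hx, h⟩

/-- A compact subset of the unit cell stays away from its lateral boundary. -/
lemma exists_bounds_of_isCompact {Λ : ℝ} {D : Set Plane} (hD : IsCompact D)
    (hDΛ : D ⊆ unitCell Λ) :
    ∃ δ > 0, ∃ R : ℝ, ∀ x ∈ D, |x 0| ≤ Λ / 2 - δ ∧ |x 1| ≤ R := by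
  rcases D.eq_empty_or_nonempty with rfl | hne
  · exact ⟨1, one_pos, 0, by simp⟩
  obtain ⟨a, ha, hmax⟩ := hD.exists_isMaxOn hne (f := fun x : Plane => |x 0|)
    (Continuous.continuousOn (by fun_prop))
  obtain ⟨b, -, hmax'⟩ := hD.exists_isMaxOn hne (f := fun x : Plane => |x 1|)
    (Continuous.continuousOn (by fun_prop))
  have h := hDΛ ha
  have h' : |a 0| < Λ / 2 := abs_lt.2 ⟨by linarith [h.1], h.2⟩
  refine ⟨Λ / 2 - |a 0|, by linarith, |b 1|, fun x hx => ⟨?_, hmax' hx⟩⟩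
  have := hmax hx
  simp only [mem_ofPred_eq] at this
  linarith

/-- The source `k²(γ - 1)u` of the scattered field, in Cartesian coordinates. -/
def source (k Λ : ℝ) (γ u : Plane → ℂ) : ℝ × ℝ → ℂ :=
  (Ioo (-Λ / 2) (Λ / 2) ×ˢ univ).indicator fun p =>
    (k : ℂ) ^ 2 * (γ (planeEquiv.symm p) - 1) * u (planeEquiv.symm p)

lemma mem_scatterer_of_source_ne_zero {k Λ : ℝ} {γ u : Plane → ℂ} {p : ℝ × ℝ}
    (hp : source k Λ γ u p ≠ 0) : planeEquiv.symm p ∈ scatterer Λ γ := by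
  have h1 : p ∈ Ioo (-Λ / 2) (Λ / 2) ×ˢ (univ : Set ℝ) := by
    by_contra h
    exact hp (indicator_of_notMem h _)
  rw [source, indicator_of_mem h1] at hp
  exact mem_scatterer (planeEquiv_symm_mem_unitCell.2 h1.1)
    (right_ne_zero_of_mul (left_ne_zero_of_mul hp))

lemma source_planeEquiv {k Λ : ℝ} {γ u : Plane → ℂ} (hDΛ : scatterer Λ γ ⊆ unitCell Λ)
    (y : Plane) : source k Λ γ u (planeEquiv y) =
      (scatterer Λ γ).indicator (fun y => (k : ℂ) ^ 2 * (γ y - 1) * u y) y := by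
  by_cases hy : y ∈ scatterer Λ γ
  · have h1 : planeEquiv y ∈ Ioo (-Λ / 2) (Λ / 2) ×ˢ (univ : Set ℝ) := ⟨hDΛ hy, mem_univ _⟩
    rw [source, indicator_of_mem h1, indicator_of_mem hy]
    simp
  · rw [indicator_of_notMem hy]
    by_contra h
    exact hy (by simpa using mem_scatterer_of_source_ne_zero h)

lemma integrable_source {k Λ : ℝ} {γ u : Plane → ℂ} (hu : LocallyIntegrable u)
    (hγ : MemLp (fun x => γ x - 1) ⊤ (volume.restrict (unitCell Λ))) {R : ℝ}
    (hR : ∀ x ∈ scatterer Λ γ, |x 1| ≤ R) : Integrable (source k Λ γ u) := by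
  -- Equal to `1` on the vertical extent of the scatterer, so inserting it does not change the
  -- source but makes local integrability of `u` sufficient.
  let φ : ContDiffBump (0 : ℝ) := ⟨max R 1, max R 1 + 1, by positivity, by linarith⟩
  have h1 := (integrable_mul_of_locallyIntegrable (Λ := Λ) hu (g := fun s => (φ s : ℂ))
    (Complex.continuous_ofReal.comp φ.continuous)
    (φ.hasCompactSupport.comp_left Complex.ofReal_zero)).mul_of_top_right
    ((hγ.comp_measurePreserving (measurePreserving_planeEquiv_symm_cell Λ)))
  have h2 := h1.const_mul ((k : ℂ) ^ 2)
  rw [cellMeasure_prod] at h2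
  rw [source, integrable_indicator_iff (measurableSet_Ioo.prod MeasurableSet.univ)]
  refine IntegrableOn.congr_fun h2 (fun p hp => ?_) (measurableSet_Ioo.prod MeasurableSet.univ)
  simp only [Function.comp, Pi.mul_apply]
  by_cases h : γ (planeEquiv.symm p) - 1 = 0
  · simp [h]
  · have h3 := hR _ (mem_scatterer (planeEquiv_symm_mem_unitCell.2 hp.1) h)
    rw [planeEquiv_symm_apply] at h3
    have h4 : φ p.2 = 1 := φ.one_of_mem_closedBall (by
      simp only [Metric.mem_closedBall, Real.dist_eq, sub_zero]
      exact (show |p.2| ≤ R by simpa using h3).trans (le_max_left _ _))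
    rw [h4]
    push_cast
    ring

/-- Almost everywhere in the unit cell, a radiating scattered field is the quasi-periodic volume
potential of its source. -/
theorem ae_eq_latticePotential_source {k Λ α β δ R : ℝ} (hk : 0 < k) (hΛ : 0 < Λ) (hδ : 0 < δ)
    (hW : ∀ m : ℤ, |alphaMode Λ α m| ≠ k) (hβ : β ^ 2 = k ^ 2 - α ^ 2) {γ u us : Plane → ℂ}
    (hγper : ∀ x, γ (shift Λ x) = γ x)
    (hγ : MemLp (fun x => γ x - 1) ⊤ (volume.restrict (unitCell Λ)))
    (hD : ∀ x ∈ scatterer Λ γ, |x 0| ≤ Λ / 2 - δ ∧ |x 1| ≤ R)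
    (hsum : ∀ x, u x = us x + incidentWave α β x) (hu : SolvesHelmholtz k γ u)
    (hqp : IsQuasiPeriodic Λ α us) (hrad : SatisfiesRayleigh k Λ α us) :
    us =ᵐ[volume.restrict (unitCell Λ)]
      fun x => latticePotential k Λ α (source k Λ γ u) (planeEquiv x) := by
  obtain ⟨H, hH, cUp, cDown, hUp, hDown⟩ := hrad
  have hFi := integrable_source (k := k) hu.1 hγ fun x hx => (hD x hx).2
  have hFδ : ∀ q, source k Λ γ u q ≠ 0 → |q.1| ≤ Λ / 2 - δ ∧ |q.2| ≤ R := fun q hq => by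
    simpa [planeEquiv_symm_apply] using hD _ (mem_scatterer_of_source_ne_zero hq)
  have hsum' : ∀ p, u (planeEquiv.symm p) = us (planeEquiv.symm p) + planeWave α β p := fun p => by
    rw [hsum, incidentWave_planeEquiv_symm]
  have hU := fun (g : ℝ → ℂ) (hg : Continuous g) (hg' : HasCompactSupport g) =>
    integrable_mul_of_locallyIntegrable (Λ := Λ) hu.1 hg hg'
  have hmode := ae_integral_scattered_mul_modeExp hk hΛ hW hβ
    (U := fun p => u (planeEquiv.symm p)) (Us := fun p => us (planeEquiv.symm p))
    (Γ := fun p => γ (planeEquiv.symm p)) (fun a b ha hb ha' hb' => hu.integral_product ha hb ha' hb')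
    hU (hγ.comp_measurePreserving (measurePreserving_planeEquiv_symm_cell Λ))
    (fun t s => by rw [← shift_planeEquiv_symm, hγper])
    (fun t s => by
      have h := hqp (planeEquiv.symm (t, s))
      rw [shift_planeEquiv_symm] at h
      rw [hsum', hsum', add_mul, h, planeWave_add_period])
    hsum' hH (cUp := cUp) (cDown := cDown)
    (fun t ht s hs => by
      have h := hUp (planeEquiv.symm (t, s)) (planeEquiv_symm_mem_unitCell.2 ht)
      rw [planeEquiv_symm_apply] at h ⊢
      exact h hs)
    (fun t ht s hs => by
      have h := hDown (planeEquiv.symm (t, s)) (planeEquiv_symm_mem_unitCell.2 ht)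
      rw [planeEquiv_symm_apply] at h ⊢
      exact h hs)
    hFi (fun q hq => (hFδ q hq).2) rfl
  have hus : ∀ p, us (planeEquiv.symm p) = u (planeEquiv.symm p) - planeWave α β p := fun p => by
    rw [hsum', add_sub_cancel_right]
  have hUsm : AEStronglyMeasurable (fun p => us (planeEquiv.symm p))
      ((cellMeasure Λ).prod volume) := by
    simp only [hus]
    exact (hu.1.aestronglyMeasurable.restrict.comp_measurePreserving
      (measurePreserving_planeEquiv_symm_cell Λ)).sub (continuous_planeWave α β).aestronglyMeasurable
  have key := ae_eq_latticePotential hk hΛ hδ hW hFi (fun q hq => (hFδ q hq).1) hUsm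
    (fun g hg hg' => by
      simp only [hus, sub_mul]
      exact (hU g hg hg').sub (integrable_planeWave_mul Λ α β hg hg')) hmode
  filter_upwards [(measurePreserving_planeEquiv_cell Λ).quasiMeasurePreserving.ae key] with x hx
  simpa using hx

end QPScattering
end

/-! ### The quasi-periodic Lippmann–Schwinger equation. -/

open QPScattering Filter

theorem theorem2p4
    (k Λ θ α β : ℝ) (hk : 0 < k) (hΛ : 0 < Λ) (hθ : θ ∈ Set.Ioo 0 Real.pi)
    (hα : α = k * Real.cos θ) (hβ : β = Real.sqrt (k ^ 2 - α ^ 2))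
    -- `α` is not a Wood's anomaly
    (hWood : ∀ m : ℤ, |QPScattering.alphaMode Λ α m| ≠ k)
    (γ : QPScattering.Plane → ℂ)
    (hγ_per : ∀ x, γ (QPScattering.shift Λ x) = γ x)
    (hγ_bdd : MeasureTheory.MemLp (fun x => γ x - 1) ⊤
      (MeasureTheory.volume.restrict (QPScattering.unitCell Λ)))
    -- `γ - 1` is compactly supported in the unit cell
    (hD_compact : IsCompact (QPScattering.scatterer Λ γ))
    (hD_subset : QPScattering.scatterer Λ γ ⊆ QPScattering.unitCell Λ)
    -- the total field `u` and the scattered field `us`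
    (u us : QPScattering.Plane → ℂ)
    (hu_total : ∀ x, u x = us x + QPScattering.incidentWave α β x)
    (hu_eq : QPScattering.SolvesHelmholtz k γ u)
    -- choice of the representative of `us` for which pointwise values are meaningful off `D`
    (hus_cont : ContinuousOn us (QPScattering.unitCell Λ \ QPScattering.scatterer Λ γ))
    (hus_qp : QPScattering.IsQuasiPeriodic Λ α us)
    (hus_rad : QPScattering.SatisfiesRayleigh k Λ α us) :
    ∀ x ∈ QPScattering.unitCell Λ \ QPScattering.scatterer Λ γ,
      (∀ y ∈ QPScattering.scatterer Λ γ,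
        Summable (QPScattering.greenTerm k Λ α x y) (SummationFilter.conditional ℤ)) ∧
      MeasureTheory.IntegrableOn
        (fun y => (k : ℂ) ^ 2 * (γ y - 1) * QPScattering.qpGreen k Λ α x y * u y)
        (QPScattering.scatterer Λ γ) MeasureTheory.volume ∧
      us x = ∫ y in QPScattering.scatterer Λ γ,
        (k : ℂ) ^ 2 * (γ y - 1) * QPScattering.qpGreen k Λ α x y * u y := by
  have hβ2 : β ^ 2 = k ^ 2 - α ^ 2 := by
    rw [hβ, Real.sq_sqrt]
    rw [hα]
    nlinarith [Real.cos_sq_le_one θ, sq_nonneg k]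
  obtain ⟨δ, hδ, R, hD⟩ := exists_bounds_of_isCompact hD_compact hD_subset
  have hclosed : IsClosed (scatterer Λ γ) := isClosed_closure
  have hK : IsClosed (planeEquiv.symm ⁻¹' scatterer Λ γ) := hclosed.preimage continuous_planeEquiv_symm
  have hKδ : ∀ q ∈ planeEquiv.symm ⁻¹' scatterer Λ γ, |q.1| ≤ Λ / 2 - δ := fun q hq => by
    simpa [planeEquiv_symm_apply] using (hD _ hq).1
  have hFi := integrable_source (k := k) hu_eq.1 hγ_bdd fun x hx => (hD x hx).2
  have hF : ∀ q, source k Λ γ u q ≠ 0 → q ∈ planeEquiv.symm ⁻¹' scatterer Λ γ := fun q hq =>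
    mem_scatterer_of_source_ne_zero hq
  have hnot : ∀ x ∈ unitCell Λ \ scatterer Λ γ,
      planeEquiv x ∉ planeEquiv.symm ⁻¹' scatterer Λ γ := fun x hx h => hx.2 (by simpa using h)
  have hae := ae_eq_latticePotential_source hk hΛ hδ hWood hβ2 hγ_per hγ_bdd hD hu_total hu_eq
    hus_qp hus_rad
  -- Both functions are continuous on the open set `Ω \ D`, so almost everywhere equality there is
  -- equality at every point.
  have heq : EqOn us (fun x => latticePotential k Λ α (source k Λ γ u) (planeEquiv x))
      (unitCell Λ \ scatterer Λ γ) := by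
    refine Measure.eqOn_open_of_ae_eq (ae_restrict_of_ae_restrict_of_subset sdiff_subset hae)
      ((isOpen_unitCell Λ).sdiff hclosed) hus_cont fun x hx => ?_
    exact ((continuousAt_latticePotential hk hΛ hδ hWood hK hKδ hFi hF (p := planeEquiv x) hx.1 (hnot x hx)).comp
      (f := planeEquiv) continuous_planeEquiv.continuousAt).continuousWithinAt
  intro x hx
  have hdist : ∀ y ∈ scatterer Λ γ, |x 0 - y 0| < Λ := fun y hy => by
    have h1 := hx.1
    have h2 := hD_subset hy
    exact abs_lt.2 ⟨by linarith [h1.1, h2.2], by linarith [h1.2, h2.1]⟩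
  have hne : ∀ y ∈ scatterer Λ γ, x ≠ y := fun y hy h => hx.2 (h ▸ hy)
  -- On `D` the closed form of the lattice sum may be replaced by the series, because `x` and `y`
  -- both lie in the cell and differ; off `D` both sides vanish.
  have hint : ∀ y, latticeGreen k Λ α (planeEquiv x - planeEquiv y) *
      source k Λ γ u (planeEquiv y) = (scatterer Λ γ).indicator
        (fun y => (k : ℂ) ^ 2 * (γ y - 1) * qpGreen k Λ α x y * u y) y := fun y => by
    rw [source_planeEquiv hD_subset]
    by_cases hy : y ∈ scatterer Λ γ
    · rw [indicator_of_mem hy, indicator_of_mem hy,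
        qpGreen_eq hk hΛ hWood (hdist y hy) (hne y hy), planeEquiv_apply, planeEquiv_apply,
        Prod.mk_sub_mk]
      ring
    · rw [indicator_of_notMem hy, indicator_of_notMem hy, mul_zero]
  refine ⟨fun y hy => (hasSum_greenTerm hk hΛ hWood (hdist y hy) (hne y hy)).summable, ?_, ?_⟩
  · have h := (measurePreserving_planeEquiv.integrable_comp_emb planeEquiv.measurableEmbedding).2
      (integrable_latticeGreen_mul_of_notMem hk hΛ hδ hWood hK hKδ hFi hF (p := planeEquiv x)
        hx.1 (hnot x hx))
    rw [← integrable_indicator_iff hclosed.measurableSet]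
    exact h.congr (Eventually.of_forall hint)
  · rw [heq hx, ← integral_indicator hclosed.measurableSet]
    simp only [latticePotential]
    rw [← measurePreserving_planeEquiv.integral_comp']
    exact integral_congr_ae (Eventually.of_forall hint)
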